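/- **Setting.** Let $d\ge 2$. For $\lambda>0$ let $\mathbb{S}^d(\lambda)=\{x\in\mathbb{R}^{d+1}: x\cdot x=1/\lambda\}$ be the round sphere of curvature $\lambda$ with geodesic distance $d_\lambda$, let $\sin_\lambda t=\frac{\sin\sqrt\lambda t}{\sqrt\lambda}$, $\cos_\lambda t=\cos\sqrt\lambda t$, $\tan_\lambda=\sin_\lambda/\cos_\lambda$, and write $\mathbb{S}^d=\mathbb{S}^d(1)$. For a convex body $K$ in $\mathbb{R}^d$ or in $\mathbb{S}^d(\lambda)$ let $n_K$ be the outer unit normal, $\mathrm{vol}_{\mathrm{bd}K}$ the $(d-1)$-dimensional Hausdorff measure on the boundary, and $H_{d-1}(K,\cdot)$ the generalized Gauss--Kronecker curvature, which exists almost everywhere on $\mathrm{bd}\,K$ (written $H^e_{d-1}$ in $\mathbb{R}^d$, $H^\lambda_{d-1}$ in $\mathbb{S}^d(\lambda)$, $H^s_{d-1}$ if $\lambda=1$). All integrals below that define areas take values in $[0,\infty]$, with $0^0=1$ and $0^t=\infty$ for $t<0$, and $-\log 0=+\infty$, $-\log\infty=-\infty$. Let $p\in\mathbb{R}\setminus\{-d\}$.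 *Euclidean functionals.* For a convex body $K\subset\mathbb{R}^d$ with $0\in\mathrm{int}\,K$ let $\kappa_0(K,x)=\frac{H^e_{d-1}(K,x)}{(x\cdot n_K(x))^{d+1}}$, let $V_K(\mathrm{d}x)=\frac1d\,(x\cdot n_K(x))\,\mathrm{vol}_{\mathrm{bd}K}(\mathrm{d}x)$, let $K^\circ$ be the polar body, and $$\mathrm{as}_p(K)=d\int_{\mathrm{bd}K}\kappa_0(K,x)^{\frac{p}{d+p}}\,V_K(\mathrm{d}x),\qquad \mathcal{E}(K)=\lim_{q\to0^+}\Big(\frac{\mathrm{as}_q(K^\circ)}{d\,\mathrm{vol}_d(K^\circ)}\Big)^{1+\frac dq},\qquad E_{PW}(K)=-\log\mathcal{E}(K).$$ *Functionals on $\mathbb{S}^d(\lambda)$.* Let $o\in\mathbb{S}^d(\lambda)$. The gnomonic projection $g_o^\lambda(u)=\frac{u}{\lambda\,u\cdot o}-o$ maps the open half-sphere around $o$ onto $o^\perp\cong\mathbb{R}^d$. Let $K\subset\mathbb{S}^d(\lambda)$ be a convex body that contains $o$ in its interior and lies in this half-sphere. Its $o$-polar $K^o$ is the body with $g_o^\lambda(K^o)=g_o^\lambda(K)^\circ$.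 With $H(K,u)$ the great hypersphere tangent to $K$ at $u$, put $$f_o^\lambda(K,u)=\sqrt{\left|\frac{\lambda+(\tan_\lambda d_\lambda(o,H(K,u)))^2}{1+\lambda(\tan_\lambda d_\lambda(o,H(K,u)))^2}\right|},$$ $$\mathrm{as}_p^{\lambda,o}(K)=\int_{\mathrm{bd}K}\Big(\frac{H^\lambda_{d-1}(K,u)}{f^\lambda_o(K,u)^{d+1}}\Big)^{\frac{p}{d+p}}f^\lambda_o(K,u)\,\mathrm{vol}_{\mathrm{bd}K}(\mathrm{d}u),$$ $$\mathcal{E}^{\lambda,o}(K)=\lim_{q\to0^+}\Big(\frac{\mathrm{as}^{\lambda,o}_q(K^o)}{\mathrm{as}^{\lambda,o}_0(K^o)}\Big)^{1+\frac dq},\qquad E_{PW}^{\lambda,o}(K)=-\log\mathcal{E}^{\lambda,o}(K).$$ *Functionals on $\mathbb{S}^d$.* For a convex body $K\subset\mathbb{S}^d$ contained in an open half-sphere let $K^*=\{v\in\mathbb{S}^d: v\cdot u\ge0\ \text{for all}\ u\in K\}$, $P^s(K)=\mathrm{vol}_{\mathrm{bd}K}(\mathrm{bd}K)$, and $$\Omega^s_p(K)=\int_{\mathrm{bd}K}H^s_{d-1}(K,u)^{\frac{p}{d+p}}\,\mathrm{vol}_{\mathrm{bd}K}(\mathrm{d}u),\qquad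 \mathcal{E}^s(K)=\lim_{q\to0^+}\Big(\frac{\Omega^s_q(K^*)}{P^s(K^*)}\Big)^{1+\frac dq},\qquad E^s(K)=-\log\mathcal{E}^s(K).$$ **Theorem.** Let $d\ge2$ and let $\overline K\subset\mathbb{R}^d$ be a convex body that contains the origin in its interior. For every $\lambda>0$ choose a point $o=o_\lambda\in\mathbb{S}^d(\lambda)$ and a linear isometry $\mathbb{R}^d\cong o^\perp$, consider $\mathbb{R}^d$ as the projective model of $\mathbb{S}^d(\lambda)$ around $o$, and evaluate each functional on $\mathbb{S}^d(\lambda)$ at $\overline K$ through the body $(g_o^\lambda)^{-1}(\overline K)\subset\mathbb{S}^d(\lambda)$. Then: 1. For every $p\in\mathbb{R}\setminus\{-d\}$, $$\lim_{\lambda\to0^+}\mathrm{as}_p^{\lambda,o}(\overline K)=\mathrm{as}_p(\overline K)\qquad\text{and}\qquad\lim_{\lambda\to1}\mathrm{as}_p^{\lambda,o}(\overline K)=\Omega_p^s(\overline K).$$ 2. The limits $q\to0^+$ that define $\mathcal{E}^{\lambda,o}(\overline K)$ (for all $\lambda>0$), $\mathcal{E}(\overline K)$ and $\mathcal{E}^s(\overline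 K)$ exist in $[0,\infty]$, and $$\lim_{\lambda\to0^+}\mathcal{E}^{\lambda,o}(\overline K)=\mathcal{E}(\overline K),\qquad\lim_{\lambda\to1}\mathcal{E}^{\lambda,o}(\overline K)=\mathcal{E}^s(\overline K),$$ $$\lim_{\lambda\to0^+}E_{PW}^{\lambda,o}(\overline K)=E_{PW}(\overline K),\qquad\lim_{\lambda\to1}E_{PW}^{\lambda,o}(\overline K)=E^s(\overline K).$$ The limits as $\lambda\to1$ include the value at $\lambda=1$, that is, $\mathrm{as}_p^{1,o}(\overline K)=\Omega^s_p(\overline K)$, $\mathcal{E}^{1,o}(\overline K)=\mathcal{E}^s(\overline K)$ and $E_{PW}^{1,o}(\overline K)=E^s(\overline K)$. -/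

import Mathlib

open Filter Topology MeasureTheory Asymptotics
open scoped ENNReal InnerProductSpace

noncomputable section

/-- Euclidean space `ℝⁿ`. -/
abbrev Euc (n : ℕ) : Type := EuclideanSpace ℝ (Fin n)

/-! ### Outer normals and generalized Gauss–Kronecker curvature

The definitions in this section serve both for bodies in `ℝⁿ` and for bodies in a round sphere
centered at the origin of `ℝⁿ`. The submodule `V` is the tangent space at `x` of the ambient
manifold: the whole space `⊤` for `ℝⁿ`, and `xᗮ` for the sphere through `x`. -/

/-- The outer unit normals of `K` at `x` that are tangent to the ambient manifold.
For the sphere (`V = xᗮ`) the last condition reads `⟪y, v⟫ ≤ 0` for all `y ∈ K`. -/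
def outerNormals {n : ℕ} (V : Submodule ℝ (Euc n)) (K : Set (Euc n)) (x : Euc n) :
    Set (Euc n) :=
  {v | v ∈ V ∧ ‖v‖ = 1 ∧ ∀ y ∈ K, ⟪y - x, v⟫_ℝ ≤ 0}

open Classical in
/-- The outer unit normal `n_K(x)`. It is the unique element of `outerNormals V K x` where there
is exactly one (almost everywhere on the boundary of a convex body), and `0` elsewhere. -/
def outerNormal {n : ℕ} (V : Submodule ℝ (Euc n)) (K : Set (Euc n)) (x : Euc n) : Euc n :=
  if h : ∃ v, outerNormals V K x = {v} then h.choose else 0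

/-- The hypersurface `B`, with unit normal `v` and tangent space `T` at `x`, is twice
differentiable at `x` in the generalized (Alexandrov) sense, with second fundamental form `A`:
for `y ∈ B` tending to `x`, the height of `y` below the tangent hyperplane is
`½ ⟪A w, w⟫ + o(‖y - x‖²)`, where `w` is the tangential part of `y - x`. -/
structure IsSecondFundamentalForm {n : ℕ} (B : Set (Euc n)) (T : Submodule ℝ (Euc n))
    (x v : Euc n) (A : T →ₗ[ℝ] T) : Prop where
  symm : A.IsSymmetric
  expansion :
    (fun y : Euc n => -⟪y - x, v⟫_ℝ
        - (1 / 2) * ⟪A (T.orthogonalProjectionOnto (y - x)),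
            T.orthogonalProjectionOnto (y - x)⟫_ℝ)
      =o[𝓝[B] x] fun y => ‖y - x‖ ^ 2

/-- `k` is the generalized Gauss–Kronecker curvature at `x` of the body `K` with boundary `B`:
the outer normal at `x` is unique, and `k` is the determinant of the second fundamental form. -/
def HasGaussKronecker {n : ℕ} (V : Submodule ℝ (Euc n)) (K B : Set (Euc n)) (x : Euc n)
    (k : ℝ) : Prop :=
  ∃ v, outerNormals V K x = {v} ∧
    ∃ A : (V ⊓ (ℝ ∙ v)ᗮ : Submodule ℝ (Euc n)) →ₗ[ℝ] (V ⊓ (ℝ ∙ v)ᗮ : Submodule ℝ (Euc n)),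
      IsSecondFundamentalForm B (V ⊓ (ℝ ∙ v)ᗮ) x v A ∧ LinearMap.det A = k

open Classical in
/-- The generalized Gauss–Kronecker curvature; it exists almost everywhere on the boundary of a
convex body, and is set to be `0` where it does not exist. -/
def gaussKronecker {n : ℕ} (V : Submodule ℝ (Euc n)) (K B : Set (Euc n)) (x : Euc n) : ℝ :=
  if h : ∃ k, HasGaussKronecker V K B x k then h.choose else 0

/-! ### Euclidean convex bodies: `L_p`-affine surface area and centro-affine entropy -/

/-- The outer unit normal of a body `K ⊆ ℝᵈ`. -/
def normalE {d : ℕ} (K : Set (Euc d)) (x : Euc d) : Euc d := outerNormal ⊤ K x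

/-- The Euclidean curvature `H^e_{d-1}(K, x)`. -/
def curvE {d : ℕ} (K : Set (Euc d)) (x : Euc d) : ℝ := gaussKronecker ⊤ K (frontier K) x

/-- The centro-affine curvature `κ₀(K, x) = H^e_{d-1}(K, x) / (x · n_K(x))^{d+1}`. -/
def centroAffineCurv {d : ℕ} (K : Set (Euc d)) (x : Euc d) : ℝ :=
  curvE K x / ⟪x, normalE K x⟫_ℝ ^ (d + 1)

/-- Lutwak's `L_p`-affine surface area `as_p(K) = d ∫ κ₀(K, x)^{p/(d+p)} V_K(dx)`, where
`V_K(dx) = (1/d) (x · n_K(x)) vol_{bd K}(dx)` is the cone volume measure. -/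
def affineSurfaceArea {d : ℕ} (p : ℝ) (K : Set (Euc d)) : ℝ≥0∞ :=
  (d : ℝ≥0∞) * ∫⁻ x in frontier K,
    ENNReal.ofReal (centroAffineCurv K x) ^ (p / (d + p)) *
      ENNReal.ofReal ((1 / d) * ⟪x, normalE K x⟫_ℝ) ∂μHE[d - 1]

/-- The polar body `K°`. -/
def polarBody {d : ℕ} (K : Set (Euc d)) : Set (Euc d) := {y | ∀ x ∈ K, ⟪x, y⟫_ℝ ≤ 1}

/-- `(as_q(K°) / (d vol_d(K°)))^{1 + d/q}`. -/
def entropyQuotientE {d : ℕ} (K : Set (Euc d)) (q : ℝ) : ℝ≥0∞ :=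
  (affineSurfaceArea q (polarBody K) / ((d : ℝ≥0∞) * volume (polarBody K))) ^ (1 + d / q)

/-- The entropy power functional `𝓔(K)`. -/
def entropyPowerE {d : ℕ} (K : Set (Euc d)) : ℝ≥0∞ := limUnder (𝓝[>] 0) (entropyQuotientE K)

/-- The centro-affine entropy `E_PW(K) = -log 𝓔(K)`. -/
def entropyPW {d : ℕ} (K : Set (Euc d)) : EReal := -ENNReal.log (entropyPowerE K)

/-! ### Bodies in the sphere `𝕊ᵈ(λ)` of curvature `λ > 0` -/

/-- The model `𝕊ᵈ(λ) = {x ∈ ℝᵈ⁺¹ : x · x = 1/λ}` of the space form of curvature `λ > 0`. -/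
def sphereLam (d : ℕ) (lam : ℝ) : Set (Euc (d + 1)) := Metric.sphere 0 (1 / √lam)

/-- The boundary of `K ⊆ 𝕊ᵈ(λ)` relative to `𝕊ᵈ(λ)`. -/
def bdLam {d : ℕ} (lam : ℝ) (K : Set (Euc (d + 1))) : Set (Euc (d + 1)) :=
  closure K ∩ closure (sphereLam d lam \ K)

/-- The outer unit normal of `K ⊆ 𝕊ᵈ(λ)` at `u`, a tangent vector of `𝕊ᵈ(λ)` at `u`. -/
def normalLam {d : ℕ} (K : Set (Euc (d + 1))) (u : Euc (d + 1)) : Euc (d + 1) :=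
  outerNormal (ℝ ∙ u)ᗮ K u

/-- The curvature `H^λ_{d-1}(K, u)` of the boundary of `K` as a hypersurface of `𝕊ᵈ(λ)`. -/
def curvLam {d : ℕ} (lam : ℝ) (K : Set (Euc (d + 1))) (u : Euc (d + 1)) : ℝ :=
  gaussKronecker (ℝ ∙ u)ᗮ K (bdLam lam K) u

/-- `sin_λ`, for `λ > 0`. -/
def sinLam (lam t : ℝ) : ℝ := Real.sin (√lam * t) / √lam

/-- `cos_λ`, for `λ > 0`. -/
def cosLam (lam t : ℝ) : ℝ := Real.cos (√lam * t)

/-- `tan_λ`, for `λ > 0`. -/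
def tanLam (lam t : ℝ) : ℝ := sinLam lam t / cosLam lam t

/-- The geodesic distance of `𝕊ᵈ(λ)`: the angle times the radius. -/
def distLam {d : ℕ} (lam : ℝ) (u v : Euc (d + 1)) : ℝ :=
  InnerProductGeometry.angle u v / √lam

/-- The tangent hyperplane `H(K, u)`: the great hypersphere of `𝕊ᵈ(λ)` through `u` that is
orthogonal to the normal of `K` at `u`. -/
def tangentHyperplaneLam {d : ℕ} (lam : ℝ) (K : Set (Euc (d + 1))) (u : Euc (d + 1)) :
    Set (Euc (d + 1)) :=
  {y ∈ sphereLam d lam | ⟪y, normalLam K u⟫_ℝ = 0}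

/-- The minimal geodesic distance `d_λ(o, H(K, u))` of `o` to the tangent hyperplane at `u`. -/
def distTangentLam {d : ℕ} (lam : ℝ) (o : Euc (d + 1)) (K : Set (Euc (d + 1)))
    (u : Euc (d + 1)) : ℝ :=
  sInf (distLam lam o '' tangentHyperplaneLam lam K u)

/-- The weight function `f^λ_o(K, u)`. -/
def weightLam {d : ℕ} (lam : ℝ) (o : Euc (d + 1)) (K : Set (Euc (d + 1)))
    (u : Euc (d + 1)) : ℝ :=
  √|(lam + tanLam lam (distTangentLam lam o K u) ^ 2) /
      (1 + lam * tanLam lam (distTangentLam lam o K u) ^ 2)|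

/-- The extended `L_p`-affine surface area `as_p^{λ,o}(K)` of a body `K ⊆ 𝕊ᵈ(λ)`. -/
def affineSurfaceAreaLam {d : ℕ} (lam : ℝ) (o : Euc (d + 1)) (p : ℝ)
    (K : Set (Euc (d + 1))) : ℝ≥0∞ :=
  ∫⁻ u in bdLam lam K,
    ENNReal.ofReal (curvLam lam K u / weightLam lam o K u ^ (d + 1)) ^ (p / (d + p)) *
      ENNReal.ofReal (weightLam lam o K u) ∂μHE[d - 1]

/-- The gnomonic projection `u ↦ u / (λ u · o) - o` of the open half-sphere of `𝕊ᵈ(λ)` around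
`o ∈ 𝕊ᵈ(λ)` onto the linear hyperplane `oᗮ ≅ ℝᵈ`. -/
def gnomonic {d : ℕ} (lam : ℝ) (o u : Euc (d + 1)) : Euc (d + 1) :=
  (lam * ⟪u, o⟫_ℝ)⁻¹ • u - o

/-- The `o`-polar `K^o ⊆ 𝕊ᵈ(λ)` of a body `K` in the open half-sphere around `o`: the body whose
gnomonic projection is the polar body of the gnomonic projection of `K`. -/
def oPolar {d : ℕ} (lam : ℝ) (o : Euc (d + 1)) (K : Set (Euc (d + 1))) : Set (Euc (d + 1)) :=
  {v ∈ sphereLam d lam | 0 < ⟪v, o⟫_ℝ ∧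
    ∀ u ∈ K, ⟪gnomonic lam o u, gnomonic lam o v⟫_ℝ ≤ 1}

/-- `(as_q^{λ,o}(K^o) / as_0^{λ,o}(K^o))^{1 + d/q}`. -/
def entropyQuotientLam {d : ℕ} (lam : ℝ) (o : Euc (d + 1)) (K : Set (Euc (d + 1)))
    (q : ℝ) : ℝ≥0∞ :=
  (affineSurfaceAreaLam lam o q (oPolar lam o K) /
    affineSurfaceAreaLam lam o 0 (oPolar lam o K)) ^ (1 + d / q)

/-- The entropy power functional `𝓔^{λ,o}(K)`. -/
def entropyPowerLam {d : ℕ} (lam : ℝ) (o : Euc (d + 1)) (K : Set (Euc (d + 1))) : ℝ≥0∞ :=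
  limUnder (𝓝[>] 0) (entropyQuotientLam lam o K)

/-- The entropy `E_PW^{λ,o}(K) = -log 𝓔^{λ,o}(K)`. -/
def entropyPWLam {d : ℕ} (lam : ℝ) (o : Euc (d + 1)) (K : Set (Euc (d + 1))) : EReal :=
  -ENNReal.log (entropyPowerLam lam o K)

/-! ### Bodies in the unit sphere `𝕊ᵈ = 𝕊ᵈ(1)`: floating area and spherical entropy -/

/-- The `L_p`-floating area `Ω_p^s(K)` of `K ⊆ 𝕊ᵈ`. -/
def floatingArea {d : ℕ} (p : ℝ) (K : Set (Euc (d + 1))) : ℝ≥0∞ :=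
  ∫⁻ u in bdLam 1 K, ENNReal.ofReal (curvLam 1 K u) ^ (p / (d + p)) ∂μHE[d - 1]

/-- The perimeter `P^s(K)` of `K ⊆ 𝕊ᵈ`. -/
def perimeterS {d : ℕ} (K : Set (Euc (d + 1))) : ℝ≥0∞ := μHE[d - 1] (bdLam 1 K)

/-- The spherical dual body `K^*` of `K ⊆ 𝕊ᵈ`. -/
def dualS {d : ℕ} (K : Set (Euc (d + 1))) : Set (Euc (d + 1)) :=
  {v ∈ sphereLam d 1 | ∀ u ∈ K, 0 ≤ ⟪v, u⟫_ℝ}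

/-- `(Ω_q^s(K^*) / P^s(K^*))^{1 + d/q}`. -/
def entropyQuotientS {d : ℕ} (K : Set (Euc (d + 1))) (q : ℝ) : ℝ≥0∞ :=
  (floatingArea q (dualS K) / perimeterS (dualS K)) ^ (1 + d / q)

/-- The spherical entropy power functional `𝓔^s(K)`. -/
def entropyPowerS {d : ℕ} (K : Set (Euc (d + 1))) : ℝ≥0∞ :=
  limUnder (𝓝[>] 0) (entropyQuotientS K)

/-- The spherical curvature entropy `E^s(K) = -log 𝓔^s(K)`. -/
def entropyS {d : ℕ} (K : Set (Euc (d + 1))) : EReal := -ENNReal.log (entropyPowerS K)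

/-! ### The projective model -/

/-- The data that make `ℝᵈ` the projective model of `𝕊ᵈ(λ)` around a point `o`: the point
`o ∈ 𝕊ᵈ(λ)` and an isometric identification of `ℝᵈ` with the hyperplane `oᗮ`. -/
structure ProjectiveModel (d : ℕ) (lam : ℝ) where
  o : Euc (d + 1)
  o_mem : o ∈ sphereLam d lam
  chart : Euc d →ₗᵢ[ℝ] Euc (d + 1)
  chart_orth : ∀ x, ⟪chart x, o⟫_ℝ = 0

/-- The body of `𝕊ᵈ(λ)` in the open half-sphere around `o` whose gnomonic projection is
`Kbar ⊆ ℝᵈ`. -/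
def ProjectiveModel.lift {d : ℕ} {lam : ℝ} (M : ProjectiveModel d lam) (Kbar : Set (Euc d)) :
    Set (Euc (d + 1)) :=
  {u ∈ sphereLam d lam | 0 < ⟪u, M.o⟫_ℝ ∧ ∃ x ∈ Kbar, gnomonic lam M.o u = M.chart x}

end

/-! The gnomonic projection moves every functional to the boundary of the Euclidean body `L`. There
it is an integral of powers of a weighted curvature `modelCurv lam L` against a weighted boundary
measure `modelMeasure lam f L`, where `f` is the inverse gnomonic projection for `λ > 0` and the
identity for `λ = 0`. If `h` is the Euclidean distance of the tangent hyperplane from the origin,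
the spherical distance satisfies `tan_λ² = h²`, so the weight is `√((λ + h²) / (1 + λ h²))`. It
equals `h` at `λ = 0`, which gives the centro-affine curvature and the cone measure, and `1` at `λ =
1`, which gives the floating area.

The projection maps great hyperspheres to hyperplanes. Hence normals correspond
(`outerNormals_lift`), heights over tangent hyperplanes change by explicit positive factors, second
fundamental forms pull back (`IsSecondFundamentalForm.transfer`), and the curvature is multiplied by
the power `(d + 1) / 2` of `(1 + λ|x|²) / (1 + λh²)` (`curvLam_lift`). The boundary measures are
compared without an area formula: the chordal distance `gnomDistSq` depends continuously on `λ` down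
to `0`, so the boundaries in two models are bi-Lipschitz with constants close to `1`. As `|x|` and
`h` stay in compact intervals, `h` away from `0`, measures and curvatures at `λ` near `λ₀` agree
with those at `λ₀` up to any factor `c > 1` (`eventually_model_le`). This gives the limits of the
affine surface areas, infinite values included (`tendsto_lintegral_rpow`).

For the entropies put `s = q / (d + q)`, so that `1 + d / q = 1 / s`. The defining quotient is then
a power mean of exponent `s`, monotone in `s`; its limit exists and is the infimum `geomMean`.
Continuity of this infimum under factors close to `1` is `tendsto_geomMean`. The upper estimate
needs a single power mean. For the lower one, the normalized measures satisfy `(1 - η) P' ≤ P`, and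
the remaining mass `η` contributes at most a factor `(C / η) ^ (η / s₀)`, which tends to `1`.

Three facts complete the proof. The `o`-polar is the lift of the polar body, and the spherical dual
is its lift through the reflected chart. The Rademacher theorem for the gauge gives a unique normal
almost everywhere. The cone volume formula `natCast_mul_volume_eq`, proved by cutting the boundary
into nearly flat pieces, identifies the Euclidean denominator with the total mass of the measure and
shows that all the measures are finite and nonzero. -/

/-! ### Power means and geometric means of possibly non-measurable functions -/

section PowerMean

variable {α : Type*} [MeasurableSpace α]

/-- The power mean of exponent `s` of `k` with respect to the normalization of `m`. -/
noncomputable def powerMean (m : Measure α) (k : α → ℝ≥0∞) (s : ℝ) : ℝ≥0∞ :=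
  ((∫⁻ x, k x ^ s ∂m) / m Set.univ) ^ (1 / s)

/-- The geometric mean, as the limit of the power means when the exponent tends to `0`. -/
noncomputable def geomMean (m : Measure α) (k : α → ℝ≥0∞) : ℝ≥0∞ :=
  sInf (powerMean m k '' Set.Ioi 0)

/-- Jensen's inequality for the normalized measure. Since `k` need not be measurable, `k ^ s` is
replaced by a measurable minorant `u` with the same integral, and the inequality is applied to `u ^
(1 / s) ≤ k`. -/
theorem powerMean_mono_exponent (m : Measure α) [IsFiniteMeasure m] (hm : m ≠ 0) (k : α → ℝ≥0∞)
    {s t : ℝ} (hs : 0 < s) (hst : s ≤ t) : powerMean m k s ≤ powerMean m k t := by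
  have ht : 0 < t := hs.trans_le hst
  have hmu : m Set.univ ≠ 0 := by simpa using hm
  have hmt : m Set.univ ≠ ∞ := measure_ne_top m _
  obtain ⟨u, hu, hle, hint⟩ := exists_measurable_le_lintegral_eq m (fun x => k x ^ s)
  set P : Measure α := (m Set.univ)⁻¹ • m with hP
  have : IsProbabilityMeasure P := ⟨by simp [hP, ENNReal.inv_mul_cancel hmu hmt]⟩
  have hv : Measurable fun x => u x ^ (1 / s) := hu.pow_const _
  have key := eLpNorm'_le_eLpNorm'_of_exponent_le hs hst P hv.aestronglyMeasurable
  simp only [eLpNorm', enorm_eq_self, hP, lintegral_smul_measure, smul_eq_mul] at key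
  have h1 : ∀ x, (u x ^ (1 / s)) ^ s = u x := fun x => by
    rw [← ENNReal.rpow_mul, one_div, inv_mul_cancel₀ hs.ne', ENNReal.rpow_one]
  have h2 : ∀ x, (u x ^ (1 / s)) ^ t ≤ k x ^ t := fun x => by
    refine ENNReal.rpow_le_rpow ?_ ht.le
    calc u x ^ (1 / s) ≤ (k x ^ s) ^ (1 / s) := ENNReal.rpow_le_rpow (hle x) (by positivity)
      _ = k x := by rw [← ENNReal.rpow_mul, one_div, mul_inv_cancel₀ hs.ne', ENNReal.rpow_one]
  simp only [h1] at key
  unfold powerMean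
  rw [hint, ENNReal.div_eq_inv_mul, ENNReal.div_eq_inv_mul]
  refine key.trans (ENNReal.rpow_le_rpow ?_ (by positivity))
  exact mul_le_mul' le_rfl (lintegral_mono h2)

theorem tendsto_powerMean (m : Measure α) [IsFiniteMeasure m] (hm : m ≠ 0) (k : α → ℝ≥0∞) :
    Tendsto (powerMean m k) (𝓝[>] 0) (𝓝 (geomMean m k)) := by
  refine MonotoneOn.tendsto_nhdsGT ?_ (OrderBot.bddBelow _)
  intro s hs t _ hst
  exact powerMean_mono_exponent m hm k hs hst

theorem geomMean_le_powerMean (m : Measure α) (k : α → ℝ≥0∞) {s : ℝ} (hs : 0 < s) :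
    geomMean m k ≤ powerMean m k s :=
  sInf_le ⟨s, hs, rfl⟩

/-- The substitution `s = q / (d + q)` has `1 / s = 1 + d / q`, so the quotient is exactly a power
mean whose exponent tends to `0`. -/
theorem tendsto_div_rpow_one_add_div (m : Measure α) [IsFiniteMeasure m] (hm : m ≠ 0)
    (k : α → ℝ≥0∞) {d : ℝ} (hd : 0 < d) :
    Tendsto (fun q : ℝ => ((∫⁻ x, k x ^ (q / (d + q)) ∂m) / m Set.univ) ^ (1 + d / q)) (𝓝[>] 0)
      (𝓝 (geomMean m k)) := by
  have h : Tendsto (fun q : ℝ => q / (d + q)) (𝓝[>] 0) (𝓝[>] 0) := by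
    refine tendsto_nhdsWithin_iff.2 ⟨?_, ?_⟩
    · have : ContinuousAt (fun q : ℝ => q / (d + q)) 0 := by
        refine ContinuousAt.div (by fun_prop) (by fun_prop) (by simpa using hd.ne')
      have := this.tendsto
      simp only [zero_div] at this
      exact this.mono_left nhdsWithin_le_nhds
    · filter_upwards [self_mem_nhdsWithin] with q hq
      have : (0 : ℝ) < q := hq
      exact div_pos this (by positivity)
  refine ((tendsto_powerMean m hm k).comp h).congr' ?_
  filter_upwards [self_mem_nhdsWithin] with q hq
  have hq : (0 : ℝ) < q := hq
  simp only [Function.comp, powerMean]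
  congr 1
  field_simp
  ring

/-- The integral loses `c` through the measure and `c ^ s` through the function, the total mass in
the denominator loses another `c`, and the root of order `s` is taken. The factor blows up as `s →
0`, so this serves only for a fixed exponent. -/
theorem powerMean_le_of_le {m m' : Measure α} {k k' : α → ℝ≥0∞} {c : ℝ≥0∞} (hc1 : 1 ≤ c)
    (hc : c ≠ ∞) (h1 : m' ≤ c • m) (h2 : m ≤ c • m') (hk : ∀ᵐ x ∂m, k' x ≤ c * k x) {s : ℝ}
    (hs : 0 < s) : powerMean m' k' s ≤ c ^ (2 / s + 1) * powerMean m k s := by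
  have hc0 : c ≠ 0 := (zero_lt_one.trans_le hc1).ne'
  have e1 : ∫⁻ x, k' x ^ s ∂m' ≤ c * (c ^ s * ∫⁻ x, k x ^ s ∂m) := by
    calc ∫⁻ x, k' x ^ s ∂m' ≤ ∫⁻ x, k' x ^ s ∂(c • m) := lintegral_mono' h1 le_rfl
      _ = c * ∫⁻ x, k' x ^ s ∂m := by rw [lintegral_smul_measure, smul_eq_mul]
      _ ≤ c * ∫⁻ x, c ^ s * k x ^ s ∂m := by
        gcongr 1
        refine lintegral_mono_ae ?_
        filter_upwards [hk] with x hx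
        rw [← ENNReal.mul_rpow_of_nonneg _ _ hs.le]
        exact ENNReal.rpow_le_rpow hx hs.le
      _ = _ := by rw [lintegral_const_mul' _ _ (ENNReal.rpow_ne_top_of_nonneg hs.le hc)]
  have e2 : m Set.univ / c ≤ m' Set.univ := by
    refine ENNReal.div_le_of_le_mul' ?_
    simpa using h2 Set.univ
  have e3 : (∫⁻ x, k' x ^ s ∂m') / m' Set.univ
      ≤ c ^ (2 + s) * ((∫⁻ x, k x ^ s ∂m) / m Set.univ) := by
    refine (ENNReal.div_le_div e1 e2).trans_eq ?_
    rw [ENNReal.rpow_add _ _ hc0 hc, ENNReal.rpow_ofNat, pow_two, div_eq_mul_inv, div_eq_mul_inv,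
      div_eq_mul_inv, ENNReal.mul_inv (Or.inr (by simp [hc0])) (Or.inr (by simp [hc])), inv_inv]
    ring
  calc powerMean m' k' s ≤ (c ^ (2 + s) * ((∫⁻ x, k x ^ s ∂m) / m Set.univ)) ^ (1 / s) :=
        ENNReal.rpow_le_rpow e3 (by positivity)
    _ = _ := by
      rw [ENNReal.mul_rpow_of_nonneg _ _ (by positivity), ← ENNReal.rpow_mul, powerMean]
      congr 2
      field_simp

/-- With the measure fixed, every power mean changes by at most the factor `c`, independently of the
exponent, so the bound survives the infimum. -/
theorem geomMean_le_mul_of_le {m : Measure α} {k k' : α → ℝ≥0∞} {c : ℝ≥0∞} (hc0 : c ≠ 0)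
    (hc : c ≠ ∞) (hk : ∀ᵐ x ∂m, k' x ≤ c * k x) : geomMean m k' ≤ c * geomMean m k := by
  have : c * geomMean m k = ⨅ a ∈ powerMean m k '' Set.Ioi 0, c * a := by
    rw [geomMean, sInf_eq_iInf]
    rw [ENNReal.mul_iInf_of_ne hc0 hc]
    congr with a
    rw [ENNReal.mul_iInf_of_ne hc0 hc]
  rw [this]
  refine le_iInf₂ ?_
  rintro _ ⟨s, hs, rfl⟩
  have hs : 0 < s := hs
  refine (geomMean_le_powerMean m k' hs).trans ?_
  have e1 : ∫⁻ x, k' x ^ s ∂m ≤ c ^ s * ∫⁻ x, k x ^ s ∂m := by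
    rw [← lintegral_const_mul' _ _ (ENNReal.rpow_ne_top_of_nonneg hs.le hc)]
    refine lintegral_mono_ae ?_
    filter_upwards [hk] with x hx
    rw [← ENNReal.mul_rpow_of_nonneg _ _ hs.le]
    exact ENNReal.rpow_le_rpow hx hs.le
  calc powerMean m k' s ≤ (c ^ s * ((∫⁻ x, k x ^ s ∂m) / m Set.univ)) ^ (1 / s) := by
        refine ENNReal.rpow_le_rpow ?_ (by positivity)
        rw [← mul_div_assoc]
        gcongr
    _ = _ := by
      rw [ENNReal.mul_rpow_of_nonneg _ _ (by positivity), ← ENNReal.rpow_mul, powerMean,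
        one_div, mul_inv_cancel₀ hs.ne', ENNReal.rpow_one]

theorem tendsto_two_point_mean {A B η : ℝ} (hA : 0 < A) (hB : 0 < B) :
    Tendsto (fun s : ℝ => Real.exp (((1 - η) * (A ^ s - 1) + η * (B ^ s - 1)) / s)) (𝓝[>] 0)
      (𝓝 (A ^ (1 - η) * B ^ η)) := by
  have key : ∀ X : ℝ, 0 < X → Tendsto (fun s : ℝ => (X ^ s - 1) / s) (𝓝[>] 0)
      (𝓝 (Real.log X)) := fun X hX => by
    have h := (Real.hasStrictDerivAt_const_rpow hX 0).hasDerivAt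
    rw [hasDerivAt_iff_tendsto_slope] at h
    simp only [Real.rpow_zero, one_mul] at h
    refine (h.mono_left (nhdsWithin_mono _ fun x hx => ne_of_gt hx)).congr fun s => ?_
    simp [slope_def_field]
  have h := ((key A hA).const_mul (1 - η)).add ((key B hB).const_mul η)
  have h' := (Real.continuous_exp.tendsto _).comp h
  have e : Real.exp ((1 - η) * Real.log A + η * Real.log B) = A ^ (1 - η) * B ^ η := by
    rw [Real.exp_add, Real.rpow_def_of_pos hA, Real.rpow_def_of_pos hB, mul_comm (Real.log A),
      mul_comm (Real.log B)]
  rw [e] at h'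
  refine h'.congr fun s => ?_
  simp only [Function.comp]
  congr 1
  ring

/-- Write `P = (1 - η) P' + Q` with `Q` of mass `η`. For `s ≤ s₀` the power mean over `Q` is at most
`B = (C / η) ^ (1 / s₀)`, so for small `s` the integral of `k ^ s` over `P` is at most `(1 - η) A ^
s + η B ^ s`. The inequality `log x ≤ x - 1` and `s → 0` leave `A ^ (1 - η) * B ^ η`. -/
theorem geomMean_le_of_mixture {P P' : Measure α} [IsProbabilityMeasure P]
    [IsProbabilityMeasure P'] {k : α → ℝ≥0∞} {η : ℝ} (hη0 : 0 < η) (hη1 : η < 1)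
    (hle : ENNReal.ofReal (1 - η) • P' ≤ P) {s₀ C A : ℝ} (hs₀ : 0 < s₀) (hC : 0 < C)
    (hint : ∫⁻ x, k x ^ s₀ ∂P ≤ ENNReal.ofReal C) (hA : 0 < A)
    (hG : geomMean P' k < ENNReal.ofReal A) :
    geomMean P k ≤ ENNReal.ofReal (A ^ (1 - η) * ((C / η) ^ (1 / s₀)) ^ η) := by
  set B : ℝ := (C / η) ^ (1 / s₀) with hBdef
  have hB : 0 < B := by positivity
  have hfin : IsFiniteMeasure (ENNReal.ofReal (1 - η) • P') :=
    Measure.smul_finite _ ENNReal.ofReal_ne_top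
  set Q : Measure α := P - ENNReal.ofReal (1 - η) • P' with hQ
  have hPQ : Q + ENNReal.ofReal (1 - η) • P' = P := Measure.sub_add_cancel_of_le hle
  have hQle : Q ≤ P := Measure.sub_le
  have hQfin : IsFiniteMeasure Q := isFiniteMeasure_of_le P hQle
  have hQu : Q Set.univ = ENNReal.ofReal η := by
    have := congrArg (fun μ : Measure α => μ Set.univ) hPQ
    simp only [Measure.add_apply, Measure.smul_apply, measure_univ, smul_eq_mul, mul_one] at this
    have h1 : ENNReal.ofReal η + ENNReal.ofReal (1 - η) = 1 := by
      rw [← ENNReal.ofReal_add hη0.le (by linarith)]; simp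
    rw [← h1] at this
    exact (ENNReal.add_left_inj ENNReal.ofReal_ne_top).1 this
  have hQ0 : Q ≠ 0 := fun h => by
    rw [h] at hQu
    simp only [Measure.coe_zero, Pi.zero_apply] at hQu
    exact (ENNReal.ofReal_pos.2 hη0).ne hQu
  have hη' : ENNReal.ofReal η ≠ 0 := (ENNReal.ofReal_pos.2 hη0).ne'
  have hQs : ∀ s, 0 < s → s ≤ s₀ → ∫⁻ x, k x ^ s ∂Q ≤ ENNReal.ofReal (η * B ^ s) := by
    intro s hs hss
    have h1 := powerMean_mono_exponent Q hQ0 k hs hss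
    have h2 : powerMean Q k s₀ ≤ ENNReal.ofReal B := by
      rw [hBdef, ← ENNReal.ofReal_rpow_of_pos (by positivity), powerMean, hQu,
        ENNReal.ofReal_div_of_pos hη0]
      refine ENNReal.rpow_le_rpow ?_ (by positivity)
      gcongr
      exact (lintegral_mono' hQle le_rfl).trans hint
    have h3 := ENNReal.rpow_le_rpow (h1.trans h2) hs.le
    rw [powerMean, ← ENNReal.rpow_mul, one_div, inv_mul_cancel₀ hs.ne', ENNReal.rpow_one, hQu,
      ENNReal.ofReal_rpow_of_pos hB,
      ENNReal.div_le_iff hη' ENNReal.ofReal_ne_top, ← ENNReal.ofReal_mul (by positivity)] at h3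
    rwa [mul_comm]
  have hlim := ENNReal.tendsto_ofReal (tendsto_two_point_mean (η := η) hA hB)
  refine ge_of_tendsto hlim ?_
  have hev : ∀ᶠ s in 𝓝[>] (0 : ℝ), powerMean P' k s < ENNReal.ofReal A :=
    (tendsto_powerMean P' (IsProbabilityMeasure.ne_zero P') k).eventually_lt_const hG
  have hev2 : ∀ᶠ s in 𝓝[>] (0 : ℝ), s < s₀ := by
    exact mem_nhdsWithin_of_mem_nhds (Iio_mem_nhds hs₀)
  filter_upwards [hev, hev2, self_mem_nhdsWithin] with s h1 h2 h3
  have hs : (0 : ℝ) < s := h3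
  have hP's : ∫⁻ x, k x ^ s ∂P' ≤ ENNReal.ofReal (A ^ s) := by
    have h4 := ENNReal.rpow_le_rpow h1.le hs.le
    rwa [powerMean, ← ENNReal.rpow_mul, one_div, inv_mul_cancel₀ hs.ne', ENNReal.rpow_one,
      measure_univ, div_one, ENNReal.ofReal_rpow_of_pos hA] at h4
  refine (geomMean_le_powerMean P k hs).trans ?_
  have hPs : ∫⁻ x, k x ^ s ∂P ≤ ENNReal.ofReal (η * B ^ s + (1 - η) * A ^ s) := by
    rw [← hPQ, lintegral_add_measure, lintegral_smul_measure, smul_eq_mul,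
      ENNReal.ofReal_add (by positivity) (mul_nonneg (by linarith) (by positivity)),
      ENNReal.ofReal_mul (p := 1 - η) (by linarith)]
    gcongr
    exact hQs s hs h2.le
  rw [powerMean, measure_univ, div_one]
  have hpos : 0 < η * B ^ s + (1 - η) * A ^ s :=
    add_pos_of_pos_of_nonneg (by positivity) (mul_nonneg (by linarith) (by positivity))
  calc (∫⁻ x, k x ^ s ∂P) ^ (1 / s)
      ≤ (ENNReal.ofReal (η * B ^ s + (1 - η) * A ^ s)) ^ (1 / s) :=
        ENNReal.rpow_le_rpow hPs (by positivity)
    _ = ENNReal.ofReal ((η * B ^ s + (1 - η) * A ^ s) ^ (1 / s)) :=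
        ENNReal.ofReal_rpow_of_pos hpos
    _ ≤ _ := by
        refine ENNReal.ofReal_le_ofReal ?_
        rw [Real.rpow_def_of_pos hpos]
        refine Real.exp_le_exp.2 ?_
        rw [mul_one_div]
        gcongr
        have := Real.log_le_sub_one_of_pos hpos
        linarith

theorem powerMean_normalize (m : Measure α) [IsFiniteMeasure m] (hm : m ≠ 0) (k : α → ℝ≥0∞)
    (s : ℝ) : powerMean ((m Set.univ)⁻¹ • m) k s = powerMean m k s := by
  have hmu : m Set.univ ≠ 0 := by simpa using hm
  have hmt : m Set.univ ≠ ∞ := measure_ne_top m _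
  simp [powerMean, ENNReal.inv_mul_cancel hmu hmt, ENNReal.div_eq_inv_mul]

theorem geomMean_normalize (m : Measure α) [IsFiniteMeasure m] (hm : m ≠ 0) (k : α → ℝ≥0∞) :
    geomMean ((m Set.univ)⁻¹ • m) k = geomMean m k := by
  simp only [geomMean]
  congr 1
  exact Set.image_congr fun s _ => powerMean_normalize m hm k s

/-- The second factor tends to `1` because `η log η → 0`: a small unknown mass hardly changes a
geometric mean once one power mean is finite. -/
theorem tendsto_mixture_bound {b C s₀ : ℝ} (hb : 0 < b) (hC : 0 < C) :
    Tendsto (fun η : ℝ => b ^ (1 - η) * ((C / η) ^ (1 / s₀)) ^ η) (𝓝[>] 0) (𝓝 b) := by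
  have h1 : Tendsto (fun η : ℝ => b ^ (1 - η)) (𝓝[>] 0) (𝓝 b) := by
    have : ContinuousAt (fun η : ℝ => b ^ (1 - η)) 0 :=
      ContinuousAt.rpow continuousAt_const (by fun_prop) (Or.inl hb.ne')
    have := this.tendsto
    simp only [sub_zero, Real.rpow_one] at this
    exact this.mono_left nhdsWithin_le_nhds
  have h2 : Tendsto (fun η : ℝ => Real.exp (1 / s₀ * (Real.log C * η - Real.log η * η)))
      (𝓝[>] 0) (𝓝 1) := by
    have h3 : Tendsto (fun η : ℝ => Real.log η * η) (𝓝[>] 0) (𝓝 0) :=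
      by simpa using tendsto_log_mul_rpow_nhdsGT_zero (r := 1) one_pos
    have h4 : Tendsto (fun η : ℝ => Real.log C * η) (𝓝[>] 0) (𝓝 0) := by
      have : Continuous fun η : ℝ => Real.log C * η := by fun_prop
      have := this.tendsto 0
      simp only [mul_zero] at this
      exact this.mono_left nhdsWithin_le_nhds
    have h5 := (Real.continuous_exp.tendsto _).comp ((h4.sub h3).const_mul (1 / s₀))
    simpa [Function.comp_def] using h5
  have h6 := h1.mul h2
  rw [mul_one] at h6
  refine h6.congr' ?_
  filter_upwards [self_mem_nhdsWithin] with η hη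
  have hη : (0 : ℝ) < η := hη
  congr 1
  rw [← Real.rpow_mul (by positivity), Real.rpow_def_of_pos (by positivity),
    Real.log_div hC.ne' hη.ne']
  congr 1
  ring

theorem ENNReal.exists_one_lt_rpow_mul_lt {a b : ℝ≥0∞} (h : a < b) (r : ℝ) :
    ∃ c : ℝ≥0∞, 1 < c ∧ c ≠ ∞ ∧ c ^ r * a < b := by
  have h1 : Tendsto (fun c : ℝ≥0∞ => c ^ r * a) (𝓝 1) (𝓝 (1 ^ r * a)) :=
    ENNReal.Tendsto.mul_const ((ENNReal.continuous_rpow_const).tendsto 1) (Or.inl (by simp))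
  rw [ENNReal.one_rpow, one_mul] at h1
  have h2 : ∀ᶠ c in 𝓝[>] (1 : ℝ≥0∞), c ^ r * a < b :=
    (h1.eventually_lt_const h).filter_mono nhdsWithin_le_nhds
  have h3 : ∀ᶠ c in 𝓝[>] (1 : ℝ≥0∞), c < ∞ :=
    mem_nhdsWithin_of_mem_nhds (Iio_mem_nhds ENNReal.one_lt_top)
  have : (𝓝[>] (1 : ℝ≥0∞)).NeBot := nhdsGT_neBot_of_exists_gt ⟨2, by simp⟩
  obtain ⟨c, hc1, hc2, hc3⟩ := (h2.and (h3.and self_mem_nhdsWithin)).exists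
  exact ⟨c, hc3, hc2.ne, hc1⟩

/-- Continuity of the geometric mean when the measure and the function are perturbed by factors
close to `1`. -/
theorem tendsto_geomMean {ι : Type*} {l : Filter ι} (m : Measure α) [IsFiniteMeasure m]
    (hm : m ≠ 0) (k : α → ℝ≥0∞) (m' : ι → Measure α) (k' : ι → α → ℝ≥0∞)
    (h : ∀ c : ℝ≥0∞, 1 < c → c ≠ ∞ → ∀ᶠ i in l, m' i ≤ c • m ∧ m ≤ c • m' i ∧
      (∀ᵐ x ∂m, k' i x ≤ c * k x) ∧ ∀ᵐ x ∂m, k x ≤ c * k' i x) :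
    Tendsto (fun i => geomMean (m' i) (k' i)) l (𝓝 (geomMean m k)) := by
  have hmu : m Set.univ ≠ 0 := by simpa using hm
  refine tendsto_order.2 ⟨fun b hb => ?_, fun b hb => ?_⟩
  -- Lower estimate. A finite power mean of `k` controls the mass left out of the mixture; if there
  -- is none, all power means of the perturbed data are infinite as well.
  · by_cases hfin : ∃ s₀ : ℝ, 0 < s₀ ∧ powerMean m k s₀ ≠ ∞
    · obtain ⟨s₀, hs₀, hfin⟩ := hfin
      obtain ⟨b₁, hb₁, hb₁G⟩ := exists_between hb
      obtain ⟨b₂, hb₂, hb₂G⟩ := exists_between hb₁G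
      have hb₁t : b₁ ≠ ∞ := (hb₁G.trans_le le_top).ne
      have hb₂t : b₂ ≠ ∞ := (hb₂G.trans_le le_top).ne
      have hb₁0 : 0 < b₁.toReal := ENNReal.toReal_pos (zero_le.trans_lt hb₁).ne' hb₁t
      set P : Measure α := (m Set.univ)⁻¹ • m with hP
      have hPp : IsProbabilityMeasure P :=
        ⟨by simp [hP, ENNReal.inv_mul_cancel hmu (measure_ne_top m _)]⟩
      have hPint : ∫⁻ x, k x ^ s₀ ∂P ≠ ∞ := by
        intro hinf
        rw [← powerMean_normalize m hm, powerMean, hinf, measure_univ, div_one] at hfin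
        exact hfin (ENNReal.top_rpow_of_pos (by positivity))
      obtain ⟨C, hC0, hC⟩ : ∃ C : ℝ, 0 < C ∧ ∫⁻ x, k x ^ s₀ ∂P ≤ ENNReal.ofReal C := by
        refine ⟨(∫⁻ x, k x ^ s₀ ∂P).toReal + 1, by positivity, ?_⟩
        rw [← ENNReal.ofReal_toReal hPint]
        exact ENNReal.ofReal_le_ofReal (by simp)
      have hlim := ENNReal.tendsto_ofReal (tendsto_mixture_bound (s₀ := s₀) hb₁0 hC0)
      rw [ENNReal.ofReal_toReal hb₁t] at hlim
      have hηev : ∀ᶠ η in 𝓝[>] (0 : ℝ), η < 1 := mem_nhdsWithin_of_mem_nhds (Iio_mem_nhds one_pos)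
      obtain ⟨η, ⟨hη, hη1⟩, hη0⟩ :=
        (((hlim.eventually_lt_const hb₁G).and hηev).and self_mem_nhdsWithin).exists
      have hη0 : 0 < η := hη0
      -- The bound `c₁ * b < b₁` absorbs the change of the function. The bound `c₂ ^ 2 * (1 - η) <
      -- 1` gives `(1 - η) P' ≤ P`, where one factor comes from the measures and one from their
      -- total masses.
      obtain ⟨c₁, hc₁, hc₁t, hc₁'⟩ := ENNReal.exists_one_lt_rpow_mul_lt hb₁ 1
      have hlt : ENNReal.ofReal (1 - η) < 1 := by
        rw [← ENNReal.ofReal_one]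
        exact (ENNReal.ofReal_lt_ofReal_iff one_pos).2 (by linarith)
      obtain ⟨c₂, hc₂, hc₂t, hc₂'⟩ := ENNReal.exists_one_lt_rpow_mul_lt hlt 2
      have hcmin : 1 < min c₁ c₂ := lt_min hc₁ hc₂
      have hcmint : min c₁ c₂ ≠ ∞ := ne_top_of_le_ne_top hc₁t (min_le_left _ _)
      filter_upwards [h (min c₁ c₂) hcmin hcmint] with i ⟨hi1, hi2, hi3, hi4⟩
      set c := min c₁ c₂ with hc
      have hc0 : c ≠ 0 := (zero_lt_one.trans hcmin).ne'
      have hm'f : IsFiniteMeasure (m' i) := by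
        refine ⟨(hi1 Set.univ).trans_lt ?_⟩
        simpa using ENNReal.mul_lt_top hcmint.lt_top (measure_lt_top m _)
      have hm'0 : m' i ≠ 0 := by
        intro h0
        rw [h0, smul_zero] at hi2
        exact hm (le_antisymm hi2 (Measure.zero_le _))
      have hm'u : m' i Set.univ ≠ 0 := by simpa using hm'0
      set P' : Measure α := (m' i Set.univ)⁻¹ • m' i with hP'
      have hP'p : IsProbabilityMeasure P' :=
        ⟨by simp [hP', ENNReal.inv_mul_cancel hm'u (measure_ne_top (m' i) _)]⟩
      have hle : ENNReal.ofReal (1 - η) • P' ≤ P := by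
        have h1 : (m' i Set.univ)⁻¹ ≤ c * (m Set.univ)⁻¹ := by
          rw [ENNReal.inv_le_iff_inv_le, ENNReal.mul_inv (Or.inl hc0) (Or.inl hcmint), inv_inv,
            ← ENNReal.div_eq_inv_mul]
          exact ENNReal.div_le_of_le_mul' (by simpa using hi2 Set.univ)
        have h2 : ENNReal.ofReal (1 - η) * c ^ 2 ≤ 1 := by
          have : ENNReal.ofReal (1 - η) * c₂ ^ (2 : ℝ) ≤ 1 := by
            rw [mul_comm]; exact hc₂'.le
          refine le_trans ?_ this
          rw [ENNReal.rpow_ofNat]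
          gcongr
          exact min_le_right _ _
        intro E
        simp only [hP, hP', Measure.smul_apply, smul_eq_mul]
        calc ENNReal.ofReal (1 - η) * ((m' i Set.univ)⁻¹ * m' i E)
            ≤ ENNReal.ofReal (1 - η) * (c * (m Set.univ)⁻¹ * (c * m E)) := by
              gcongr
              simpa using hi1 E
          _ = (ENNReal.ofReal (1 - η) * c ^ 2) * ((m Set.univ)⁻¹ * m E) := by ring
          _ ≤ 1 * ((m Set.univ)⁻¹ * m E) := by gcongr
          _ = _ := one_mul _
      -- Otherwise the mixture bound, which the choice of `η` puts below the geometric mean for `m`,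
      -- would be an upper bound for that geometric mean.
      have hGP' : b₁ ≤ geomMean P' k := by
        by_contra hlt
        push Not at hlt
        rw [← ENNReal.ofReal_toReal hb₁t] at hlt
        have := geomMean_le_of_mixture hη0 hη1 hle hs₀ hC0 hC hb₁0 hlt
        rw [hP, geomMean_normalize m hm] at this
        exact absurd hη (not_lt.2 this)
      have hac : m' i ≪ m := Measure.absolutelyContinuous_of_le_smul hi1
      have h3 := geomMean_le_mul_of_le hc0 hcmint (hac.ae_le hi4)
      rw [← geomMean_normalize (m' i) hm'0 k] at h3
      have h4 : b₁ ≤ c₁ * geomMean (m' i) (k' i) :=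
        hGP'.trans (h3.trans (mul_le_mul' (min_le_left _ _) le_rfl))
      rw [ENNReal.rpow_one] at hc₁'
      have h5 : c₁ * b < c₁ * geomMean (m' i) (k' i) := hc₁'.trans_le h4
      exact lt_of_mul_lt_mul_left' h5
    · push Not at hfin
      filter_upwards [h 2 (by norm_num) (by norm_num)] with i ⟨hi1, hi2, hi3, hi4⟩
      have : geomMean (m' i) (k' i) = ∞ := by
        rw [geomMean, sInf_eq_top]
        rintro _ ⟨s, hs, rfl⟩
        have hac : m' i ≪ m := Measure.absolutelyContinuous_of_le_smul hi1
        have h1 := powerMean_le_of_le (by norm_num) (by norm_num) hi2 hi1 (hac.ae_le hi4) hs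
        rw [hfin s hs, top_le_iff, ENNReal.mul_eq_top] at h1
        have hne : (2 : ℝ≥0∞) ^ (2 / s + 1) ≠ ∞ :=
          ENNReal.rpow_ne_top_of_nonneg (by have : (0 : ℝ) < s := hs; positivity) (by norm_num)
        tauto
      rw [this]
      exact hb.trans_le le_top
  -- Upper estimate: some power mean of fixed exponent `s` is already below `b`, and it is stable.
  · obtain ⟨_, ⟨s, hs, rfl⟩, hsb⟩ := sInf_lt_iff.1 hb
    have hs : (0 : ℝ) < s := hs
    obtain ⟨c, hc, hct, hcb⟩ := ENNReal.exists_one_lt_rpow_mul_lt hsb (2 / s + 1)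
    filter_upwards [h c hc hct] with i ⟨hi1, hi2, hi3, hi4⟩
    exact ((geomMean_le_powerMean _ _ hs).trans
      (powerMean_le_of_le hc.le hct hi1 hi2 hi3 hs)).trans_lt hcb

/-- Multiplicative closeness also covers the limits `0` and `∞`, where it forces `u i = a`
eventually. -/
theorem ENNReal.tendsto_of_eventually_le_mul {ι : Type*} {l : Filter ι} {u : ι → ℝ≥0∞} {a : ℝ≥0∞}
    (h : ∀ c : ℝ≥0∞, 1 < c → c ≠ ∞ → ∀ᶠ i in l, u i ≤ c * a ∧ a ≤ c * u i) :
    Tendsto u l (𝓝 a) := by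
  refine tendsto_order.2 ⟨fun b hb => ?_, fun b hb => ?_⟩
  · obtain ⟨c, hc, hct, hcb⟩ := ENNReal.exists_one_lt_rpow_mul_lt hb 1
    rw [ENNReal.rpow_one] at hcb
    filter_upwards [h c hc hct] with i hi
    exact lt_of_mul_lt_mul_left' (hcb.trans_le hi.2)
  · obtain ⟨c, hc, hct, hcb⟩ := ENNReal.exists_one_lt_rpow_mul_lt hb 1
    rw [ENNReal.rpow_one] at hcb
    filter_upwards [h c hc hct] with i hi
    exact hi.1.trans_lt hcb

end PowerMean

/-! ### Convex bodies with the origin in the interior -/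

theorem LipschitzOnWith.euclideanHausdorffMeasure_image_le {X Y : Type*} [EMetricSpace X]
    [MeasurableSpace X] [BorelSpace X] [EMetricSpace Y] [MeasurableSpace Y] [BorelSpace Y]
    {K : NNReal} {f : X → Y} {s : Set X} (h : LipschitzOnWith K f s) (n : ℕ) :
    μHE[n] (f '' s) ≤ (K : ℝ≥0∞) ^ n * μHE[n] s := by
  simp only [Measure.euclideanHausdorffMeasure_def, Measure.smul_apply, ENNReal.smul_def,
    smul_eq_mul]
  have := h.hausdorffMeasure_image_le (d := n) (by positivity)
  rw [ENNReal.rpow_natCast] at this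
  calc _ ≤ _ * ((K : ℝ≥0∞) ^ n * μH[n] s) := by gcongr
    _ = _ := by ring

/-- A convex body with the origin in its interior. -/
structure IsBody {d : ℕ} (L : Set (Euc d)) : Prop where
  convex : Convex ℝ L
  isCompact : IsCompact L
  mem_nhds : L ∈ 𝓝 (0 : Euc d)

namespace IsBody

variable {d : ℕ} {L : Set (Euc d)}

theorem exists_radii (hL : IsBody L) : ∃ r R : ℝ, 0 < r ∧ 0 < R ∧
    Metric.closedBall 0 r ⊆ L ∧ L ⊆ Metric.closedBall 0 R := by
  obtain ⟨r, hr, hrL⟩ := Metric.nhds_basis_closedBall.mem_iff.1 hL.mem_nhds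
  obtain ⟨R, hR⟩ := hL.isCompact.isBounded.subset_closedBall 0
  exact ⟨r, max R 1, hr, by positivity, hrL,
    hR.trans (Metric.closedBall_subset_closedBall (le_max_left _ _))⟩

theorem isClosed (hL : IsBody L) : IsClosed L := hL.isCompact.isClosed

theorem zero_mem (hL : IsBody L) : (0 : Euc d) ∈ L := mem_of_mem_nhds hL.mem_nhds

theorem absorbent (hL : IsBody L) : Absorbent ℝ L := absorbent_nhds_zero hL.mem_nhds

theorem frontier_subset (hL : IsBody L) : frontier L ⊆ L := hL.isClosed.frontier_subset

theorem gauge_le_one_iff (hL : IsBody L) {x : Euc d} : gauge L x ≤ 1 ↔ x ∈ L := by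
  rw [gauge_le_one_iff_mem_closure hL.convex hL.mem_nhds, hL.isClosed.closure_eq]

theorem gauge_eq_one_iff (hL : IsBody L) {x : Euc d} : gauge L x = 1 ↔ x ∈ frontier L :=
  gauge_eq_one_iff_mem_frontier hL.convex hL.mem_nhds

theorem continuous_gauge (hL : IsBody L) : Continuous (gauge L) :=
  _root_.continuous_gauge hL.convex hL.mem_nhds

theorem gauge_smul (_ : IsBody L) {t : ℝ} (ht : 0 ≤ t) (x : Euc d) :
    gauge L (t • x) = t * gauge L x := by
  rw [gauge_smul_of_nonneg ht, smul_eq_mul]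

theorem norm_le_mul_gauge (hL : IsBody L) {R : ℝ} (hR : 0 < R) (h : L ⊆ Metric.closedBall 0 R)
    (x : Euc d) : ‖x‖ ≤ R * gauge L x := by
  have := le_gauge_of_subset_closedBall (x := x) hL.absorbent hR.le h
  rwa [div_le_iff₀ hR, mul_comm] at this

theorem gauge_pos (hL : IsBody L) {x : Euc d} (hx : x ≠ 0) : 0 < gauge L x := by
  obtain ⟨r, R, hr, hR, -, hRL⟩ := hL.exists_radii
  have := hL.norm_le_mul_gauge hR hRL x
  have h2 : 0 < ‖x‖ := norm_pos_iff.2 hx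
  exact pos_of_mul_pos_right (h2.trans_le this) hR.le

theorem inv_gauge_smul_mem_frontier (hL : IsBody L) {x : Euc d} (hx : x ≠ 0) :
    (gauge L x)⁻¹ • x ∈ frontier L := by
  have := hL.gauge_pos hx
  rw [← hL.gauge_eq_one_iff, hL.gauge_smul (by positivity), inv_mul_cancel₀ this.ne']

/-! ### Lipschitz bounds for the gauge and the radial projection. -/

theorem lipschitz_gauge (hL : IsBody L) {r : ℝ} (hr : 0 < r) (h : Metric.closedBall 0 r ⊆ L)
    (x y : Euc d) : |gauge L x - gauge L y| ≤ r⁻¹ * ‖x - y‖ := by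
  have := hL.convex.lipschitzWith_gauge (r := Real.toNNReal r)
    (Real.toNNReal_pos.2 hr) (by rw [Real.coe_toNNReal _ hr.le]; exact Metric.ball_subset_closedBall.trans h)
  have := this.dist_le_mul x y
  rwa [Real.dist_eq, dist_eq_norm, NNReal.coe_inv, Real.coe_toNNReal _ hr.le] at this

theorem radial_lipschitz (hL : IsBody L) {r R : ℝ} (hr : 0 < r) (hR : 0 < R)
    (hrL : Metric.closedBall 0 r ⊆ L) (hRL : L ⊆ Metric.closedBall 0 R) {w w' : Euc d}
    (hw : 1 ≤ ‖w‖) (hw' : 1 ≤ ‖w'‖) :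
    ‖(gauge L w)⁻¹ • w - (gauge L w')⁻¹ • w'‖ ≤ (R + R ^ 2 * r⁻¹) * ‖w - w'‖ := by
  have h1 := hL.norm_le_mul_gauge hR hRL w
  have h2 := hL.norm_le_mul_gauge hR hRL w'
  have h3 := hL.lipschitz_gauge hr hrL w' w
  have g1 : 0 < gauge L w := hL.gauge_pos (norm_pos_iff.1 (by linarith))
  have g2 : 0 < gauge L w' := hL.gauge_pos (norm_pos_iff.1 (by linarith))
  have e : (gauge L w)⁻¹ • w - (gauge L w')⁻¹ • w' = (gauge L w)⁻¹ • (w - w')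
      + ((gauge L w)⁻¹ * (gauge L w')⁻¹ * (gauge L w' - gauge L w)) • w' := by
    rw [smul_sub, sub_add, sub_right_inj, ← sub_smul]
    congr 1
    field_simp
    ring
  have b1 : (gauge L w)⁻¹ ≤ R := by
    rw [inv_le_comm₀ g1 hR, inv_le_iff_one_le_mul₀ hR]
    linarith
  have b2 : (gauge L w')⁻¹ * ‖w'‖ ≤ R := by
    rw [inv_mul_le_iff₀ g2]; linarith
  rw [e]
  refine (norm_add_le _ _).trans ?_
  rw [norm_smul, norm_smul, norm_mul, norm_mul, Real.norm_of_nonneg (by positivity),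
    Real.norm_of_nonneg (by positivity), Real.norm_eq_abs]
  rw [norm_sub_rev w' w] at h3
  calc (gauge L w)⁻¹ * ‖w - w'‖ +
        (gauge L w)⁻¹ * (gauge L w')⁻¹ * |gauge L w' - gauge L w| * ‖w'‖
      = (gauge L w)⁻¹ * ‖w - w'‖ +
        (gauge L w)⁻¹ * ((gauge L w')⁻¹ * ‖w'‖) * |gauge L w' - gauge L w| := by ring
    _ ≤ R * ‖w - w'‖ + R * R * (r⁻¹ * ‖w - w'‖) := by gcongr
    _ = _ := by ring

/-! #### Support values -/

theorem inner_le_mul_gauge (hL : IsBody L) {x v : Euc d} (hv : v ∈ outerNormals ⊤ L x)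
    (y : Euc d) : ⟪y, v⟫_ℝ ≤ ⟪x, v⟫_ℝ * gauge L y := by
  rcases eq_or_ne y 0 with rfl | hy
  · simp
  have h1 := hv.2.2 _ (hL.frontier_subset (hL.inv_gauge_smul_mem_frontier hy))
  have h2 := hL.gauge_pos hy
  rw [inner_sub_left, inner_smul_left, RCLike.conj_to_real, sub_nonpos, inv_mul_le_iff₀ h2] at h1
  linarith

theorem le_inner (_ : IsBody L) {r : ℝ} (hr : 0 < r) (hrL : Metric.closedBall 0 r ⊆ L)
    {x v : Euc d} (hv : v ∈ outerNormals ⊤ L x) : r ≤ ⟪x, v⟫_ℝ := by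
  have h1 := hv.2.2 (r • v) (hrL (by simp [norm_smul, hv.2.1, abs_of_pos hr]))
  rw [inner_sub_left, inner_smul_left, RCLike.conj_to_real, real_inner_self_eq_norm_sq,
    hv.2.1] at h1
  linarith

theorem inner_pos (hL : IsBody L) {x v : Euc d} (hv : v ∈ outerNormals ⊤ L x) :
    0 < ⟪x, v⟫_ℝ := by
  obtain ⟨r, R, hr, hR, hrL, hRL⟩ := hL.exists_radii
  exact hr.trans_le (hL.le_inner hr hrL hv)

/-- The gauge lies above the linear function `⟪·, v⟫ / ⟪x, v⟫` and touches it at `x`, so the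
difference has a minimum there and its derivative vanishes. -/
theorem gradient_gauge_eq (hL : IsBody L) {x v : Euc d} (hx : x ∈ frontier L)
    (hv : v ∈ outerNormals ⊤ L x) (hg : DifferentiableAt ℝ (gauge L) x) :
    gradient (gauge L) x = (⟪x, v⟫_ℝ)⁻¹ • v := by
  have hpos := hL.inner_pos hv
  have hmin : IsLocalMin (fun y => gauge L y - (⟪x, v⟫_ℝ)⁻¹ * ⟪v, y⟫_ℝ) x := by
    refine Eventually.of_forall fun y => ?_
    have h1 := hL.inner_le_mul_gauge hv y
    beta_reduce
    rw [(hL.gauge_eq_one_iff).2 hx, real_inner_comm x v, inv_mul_cancel₀ hpos.ne', sub_self,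
      sub_nonneg, inv_mul_le_iff₀ hpos, real_inner_comm]
    exact h1
  have hd : HasFDerivAt (fun y => gauge L y - (⟪x, v⟫_ℝ)⁻¹ * ⟪v, y⟫_ℝ)
      (fderiv ℝ (gauge L) x - (⟪x, v⟫_ℝ)⁻¹ • innerSL ℝ v) x := by
    refine hg.hasFDerivAt.sub ?_
    exact ((innerSL ℝ v).hasFDerivAt (x := x)).const_mul ((⟪x, v⟫_ℝ)⁻¹)
  have h0 := hmin.hasFDerivAt_eq_zero hd
  rw [sub_eq_zero] at h0
  refine ext_inner_right ℝ fun y => ?_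
  rw [inner_gradient_left, h0]
  simp [inner_smul_left]

theorem exists_outerNormal (hL : IsBody L) {x : Euc d} (hx : x ∈ frontier L) :
    ∃ v, v ∈ outerNormals ⊤ L x := by
  obtain ⟨f, hf⟩ := geometric_hahn_banach_open_point hL.convex.interior isOpen_interior hx.2
  set u : Euc d := (InnerProductSpace.toDual ℝ (Euc d)).symm f with hu
  have hfu : ∀ y, f y = ⟪y, u⟫_ℝ := fun y => by
    rw [real_inner_comm, hu, InnerProductSpace.toDual_symm_apply]
  have h0 : (0 : Euc d) ∈ interior L := mem_interior_iff_mem_nhds.2 hL.mem_nhds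
  have hu0 : u ≠ 0 := by
    intro h
    have := hf 0 h0
    simp [hfu, h] at this
  have hle : ∀ y ∈ L, ⟪y, u⟫_ℝ ≤ ⟪x, u⟫_ℝ := by
    intro y hy
    have hcl : y ∈ closure (interior L) := by
      rw [hL.convex.closure_interior_eq_closure_of_nonempty_interior ⟨0, h0⟩]
      exact subset_closure hy
    refine le_on_closure (f := fun y => ⟪y, u⟫_ℝ) (g := fun _ => ⟪x, u⟫_ℝ) (fun z hz => ?_)
      (by fun_prop) (by fun_prop) hcl
    have := hf z hz
    rw [hfu, hfu] at this
    exact this.le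
  refine ⟨‖u‖⁻¹ • u, trivial, norm_smul_inv_norm hu0, fun y hy => ?_⟩
  rw [inner_smul_right, inner_sub_left]
  exact mul_nonpos_of_nonneg_of_nonpos (by positivity) (by linarith [hle y hy])

/-- Hahn–Banach provides a normal and the gradient leaves no choice. The support value is the
reciprocal of the norm of the gradient, a formula that is measurable in `x`. -/
theorem outerNormals_eq_singleton (hL : IsBody L) {x : Euc d} (hx : x ∈ frontier L)
    (hg : DifferentiableAt ℝ (gauge L) x) :
    outerNormals ⊤ L x = {‖gradient (gauge L) x‖⁻¹ • gradient (gauge L) x} ∧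
      ⟪x, ‖gradient (gauge L) x‖⁻¹ • gradient (gauge L) x⟫_ℝ = ‖gradient (gauge L) x‖⁻¹ := by
  have key : ∀ v ∈ outerNormals ⊤ L x, ⟪x, v⟫_ℝ = ‖gradient (gauge L) x‖⁻¹ ∧
      v = ‖gradient (gauge L) x‖⁻¹ • gradient (gauge L) x := fun v hv => by
    have h1 := hL.gradient_gauge_eq hx hv hg
    have hpos := hL.inner_pos hv
    have h2 : ⟪x, v⟫_ℝ = ‖gradient (gauge L) x‖⁻¹ := by
      rw [h1, norm_smul, hv.2.1, mul_one, norm_inv, inv_inv, Real.norm_of_nonneg hpos.le]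
    refine ⟨h2, ?_⟩
    rw [← h2, h1, smul_smul, mul_inv_cancel₀ hpos.ne', one_smul]
  obtain ⟨v, hv⟩ := hL.exists_outerNormal hx
  obtain ⟨h1, h2⟩ := key v hv
  rw [← h2]
  refine ⟨?_, h1⟩
  ext w
  simp only [Set.mem_singleton_iff]
  refine ⟨fun hw => ?_, fun hw => hw ▸ hv⟩
  rw [(key w hw).2, ← h2]

theorem outerNormal_eq_of_singleton {n : ℕ} {V : Submodule ℝ (Euc n)} {K : Set (Euc n)}
    {x v : Euc n} (h : outerNormals V K x = {v}) : outerNormal V K x = v := by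
  have hex : ∃ v, outerNormals V K x = {v} := ⟨v, h⟩
  rw [outerNormal, dif_pos hex]
  exact (Set.singleton_injective (h.symm.trans hex.choose_spec)).symm

/-! #### Almost everywhere differentiability -/

/-- By homogeneity, on the half-space `⟪a, y⟫ > 0` the gauge is determined by its restriction to the
affine hyperplane `a + aᗮ`. -/
theorem differentiableAt_gauge_of_hyperplane (hL : IsBody L) {a : Euc d} (ha : ‖a‖ = 1)
    {x : Euc d} (hx : 0 < ⟪a, x⟫_ℝ)
    (hz : DifferentiableAt ℝ (fun z : (ℝ ∙ a)ᗮ => gauge L ((z : Euc d) + a))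
      ((ℝ ∙ a)ᗮ.orthogonalProjectionOnto ((⟪a, x⟫_ℝ)⁻¹ • x))) :
    DifferentiableAt ℝ (gauge L) x := by
  have hdec : ∀ y : Euc d, ⟪a, y⟫_ℝ = 1 →
      (((ℝ ∙ a)ᗮ.orthogonalProjectionOnto y : (ℝ ∙ a)ᗮ) : Euc d) + a = y := by
    intro y hy
    have h1 := Submodule.starProjection_add_starProjection_orthogonal (K := ℝ ∙ a) y
    rw [Submodule.starProjection_unit_singleton ℝ ha, hy, one_smul] at h1
    rw [← Submodule.starProjection_apply, add_comm, h1]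
  have hev : gauge L =ᶠ[𝓝 x] fun y => ⟪a, y⟫_ℝ *
      gauge L ((((ℝ ∙ a)ᗮ.orthogonalProjectionOnto ((⟪a, y⟫_ℝ)⁻¹ • y) : (ℝ ∙ a)ᗮ) : Euc d) + a) := by
    have : ∀ᶠ y in 𝓝 x, 0 < ⟪a, y⟫_ℝ :=
      (Continuous.inner continuous_const continuous_id).continuousAt.eventually_const_lt hx
    filter_upwards [this] with y hy
    rw [hdec _ (by rw [inner_smul_right, inv_mul_cancel₀ hy.ne']),
      hL.gauge_smul (by positivity), ← mul_assoc, mul_inv_cancel₀ hy.ne', one_mul]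
  refine DifferentiableAt.congr_of_eventuallyEq ?_ hev
  have h1 : DifferentiableAt ℝ (fun y : Euc d => ⟪a, y⟫_ℝ) x := (innerSL ℝ a).differentiableAt
  refine h1.mul ?_
  refine DifferentiableAt.comp x (f := fun y : Euc d =>
    (ℝ ∙ a)ᗮ.orthogonalProjectionOnto ((⟪a, y⟫_ℝ)⁻¹ • y))
    (g := fun z : (ℝ ∙ a)ᗮ => gauge L ((z : Euc d) + a)) hz ?_
  have h2 : DifferentiableAt ℝ (fun y : Euc d => (⟪a, y⟫_ℝ)⁻¹ • y) x :=
    (h1.inv hx.ne').smul differentiableAt_id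
  exact ((ℝ ∙ a)ᗮ.orthogonalProjectionOnto).differentiableAt.comp x h2

/-- On the hyperplane `a + aᗮ` the normalized Hausdorff measure is Lebesgue measure, and the
Rademacher theorem applies to the Lipschitz gauge there. The radial projection `ψ` of this
hyperplane to the boundary is Lipschitz and maps the exceptional null set onto a set containing all
bad boundary points of the half-space. -/
theorem measure_not_differentiableAt_inter_halfspace (hL : IsBody L) {a : Euc d} (ha : ‖a‖ = 1) :
    μHE[d - 1] {x | x ∈ frontier L ∧ ¬ DifferentiableAt ℝ (gauge L) x ∧ 0 < ⟪a, x⟫_ℝ} = 0 := by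
  obtain ⟨r, R, hr, hR, hrL, hRL⟩ := hL.exists_radii
  set S : Submodule ℝ (Euc d) := (ℝ ∙ a)ᗮ with hS
  have ha0 : a ≠ 0 := fun h => by simp [h] at ha
  have hrank : Module.finrank ℝ S = d - 1 := by
    have h1 := Submodule.finrank_add_finrank_orthogonal (ℝ ∙ a)
    rw [finrank_span_singleton ha0, finrank_euclideanSpace_fin] at h1
    rw [hS]
    omega
  have horth : ∀ z : S, ⟪a, (z : Euc d)⟫_ℝ = 0 := fun z =>
    Submodule.mem_orthogonal_singleton_iff_inner_right.1 z.2
  have hnorm : ∀ z : S, 1 ≤ ‖(z : Euc d) + a‖ := fun z => by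
    have h1 := real_inner_le_norm a ((z : Euc d) + a)
    rw [inner_add_right, horth, real_inner_self_eq_norm_sq, ha] at h1
    linarith
  set Z : Set S := {z | ¬ DifferentiableAt ℝ (fun z : S => gauge L ((z : Euc d) + a)) z}
  have hZ : μHE[d - 1] Z = 0 := by
    rw [← hrank, InnerProductSpace.euclideanHausdorffMeasure_eq_volume]
    have hlip : LipschitzWith (Real.toNNReal r⁻¹) (fun z : S => gauge L ((z : Euc d) + a)) := by
      refine LipschitzWith.of_dist_le_mul fun z w => ?_
      rw [Real.coe_toNNReal _ (by positivity), Real.dist_eq]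
      refine (hL.lipschitz_gauge hr hrL _ _).trans_eq ?_
      rw [add_sub_add_right_eq_sub, dist_eq_norm]
      rfl
    exact hlip.ae_differentiableAt (μ := volume)
  set ψ : S → Euc d := fun z => (gauge L ((z : Euc d) + a))⁻¹ • ((z : Euc d) + a)
  have hψ : LipschitzWith (Real.toNNReal (R + R ^ 2 * r⁻¹)) ψ := by
    refine LipschitzWith.of_dist_le_mul fun z w => ?_
    rw [Real.coe_toNNReal _ (by positivity), dist_eq_norm]
    refine (hL.radial_lipschitz hr hR hrL hRL (hnorm z) (hnorm w)).trans_eq ?_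
    rw [add_sub_add_right_eq_sub, dist_eq_norm]
    rfl
  have h0 : μHE[d - 1] (ψ '' Z) = 0 := by
    have := (hψ.lipschitzOnWith (s := Z)).euclideanHausdorffMeasure_image_le (d - 1)
    rw [hZ, mul_zero] at this
    exact le_antisymm this zero_le
  refine measure_mono_null ?_ h0
  rintro x ⟨hxf, hxd, hxa⟩
  refine ⟨S.orthogonalProjectionOnto ((⟪a, x⟫_ℝ)⁻¹ • x), fun h => hxd ?_, ?_⟩
  · exact hL.differentiableAt_gauge_of_hyperplane ha hxa h
  · have h1 := Submodule.starProjection_add_starProjection_orthogonal (K := ℝ ∙ a)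
      ((⟪a, x⟫_ℝ)⁻¹ • x)
    rw [Submodule.starProjection_unit_singleton ℝ ha, inner_smul_right, inv_mul_cancel₀ hxa.ne',
      one_smul, add_comm, Submodule.starProjection_apply] at h1
    simp only [ψ]
    rw [h1, hL.gauge_smul (by positivity), (hL.gauge_eq_one_iff).2 hxf, mul_one, inv_inv, smul_smul,
      mul_inv_cancel₀ hxa.ne', one_smul]

theorem frontier_ne_zero (hL : IsBody L) {x : Euc d} (hx : x ∈ frontier L) : x ≠ 0 := by
  rintro rfl
  have := (hL.gauge_eq_one_iff).2 hx
  simp at this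

theorem measure_not_differentiableAt (hL : IsBody L) :
    μHE[d - 1] {x | x ∈ frontier L ∧ ¬ DifferentiableAt ℝ (gauge L) x} = 0 := by
  have hsub : {x | x ∈ frontier L ∧ ¬ DifferentiableAt ℝ (gauge L) x} ⊆
      ⋃ i : Fin d, ({x | x ∈ frontier L ∧ ¬ DifferentiableAt ℝ (gauge L) x ∧
        0 < ⟪EuclideanSpace.single i (1 : ℝ), x⟫_ℝ} ∪
        {x | x ∈ frontier L ∧ ¬ DifferentiableAt ℝ (gauge L) x ∧
        0 < ⟪-EuclideanSpace.single i (1 : ℝ), x⟫_ℝ}) := by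
    rintro x ⟨hx, hxd⟩
    have h0 := hL.frontier_ne_zero hx
    obtain ⟨i, hi⟩ : ∃ i, x i ≠ 0 := by
      by_contra! h
      exact h0 (by ext i; simpa using h i)
    refine Set.mem_iUnion.2 ⟨i, ?_⟩
    rcases lt_or_gt_of_ne hi with h | h
    · right
      exact ⟨hx, hxd, by simpa [EuclideanSpace.inner_single_left] using h⟩
    · left
      exact ⟨hx, hxd, by simpa [EuclideanSpace.inner_single_left] using h⟩
  refine measure_mono_null hsub (measure_iUnion_null fun i => measure_union_null ?_ ?_)
  · exact hL.measure_not_differentiableAt_inter_halfspace (by simp)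
  · exact hL.measure_not_differentiableAt_inter_halfspace (by simp)

theorem measurableSet_frontier (_ : IsBody L) : MeasurableSet (frontier L) :=
  isClosed_frontier.measurableSet

theorem ae_differentiableAt (hL : IsBody L) :
    ∀ᵐ x ∂(μHE[d - 1] : Measure (Euc d)).restrict (frontier L),
      DifferentiableAt ℝ (gauge L) x := by
  rw [ae_restrict_iff' hL.measurableSet_frontier, ae_iff]
  simpa using hL.measure_not_differentiableAt

theorem measurable_gradient_gauge (_ : IsBody L) : Measurable (gradient (gauge L)) := by
  have h : Measurable (fderiv ℝ (gauge L)) := measurable_fderiv ℝ _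
  exact (InnerProductSpace.toDual ℝ (Euc d)).symm.continuous.measurable.comp h

end IsBody

/-! ### The cone volume formula -/

theorem MeasureTheory.Measure.le_of_countable_cover {α ι : Type*} [MeasurableSpace α] [Countable ι]
    {μ ν : Measure α} (E : ι → Set α) (hE : ∀ i, MeasurableSet (E i))
    (hcov : μ (⋃ i, E i)ᶜ = 0)
    (h : ∀ i, ∀ A ⊆ E i, MeasurableSet A → μ A ≤ ν A) : μ ≤ ν := by
  refine Measure.le_iff.2 fun A hA => ?_
  have h1 : μ A ≤ μ (A ∩ ⋃ i, E i) := by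
    calc μ A ≤ μ ((A ∩ ⋃ i, E i) ∪ (⋃ i, E i)ᶜ) := by
          refine measure_mono fun x hx => ?_
          by_cases hxE : x ∈ ⋃ i, E i
          · exact Or.inl ⟨hx, hxE⟩
          · exact Or.inr hxE
      _ ≤ _ := (measure_union_le _ _).trans_eq (by rw [hcov, add_zero])
  rcases isEmpty_or_nonempty ι with hι | hι
  · simp only [Set.iUnion_of_empty, Set.inter_empty, measure_empty] at h1
    exact h1.trans zero_le
  obtain ⟨f, hf⟩ := exists_surjective_nat ι
  have hU : ⋃ i, E i = ⋃ n, disjointed (fun n => E (f n)) n := by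
    rw [iUnion_disjointed]
    exact (hf.iUnion_comp E).symm
  have hm : ∀ n, MeasurableSet (disjointed (fun n => E (f n)) n) :=
    MeasurableSet.disjointed fun n => hE _
  have hd : Pairwise (Function.onFun Disjoint
      fun n => A ∩ disjointed (fun n => E (f n)) n) := fun i j hij =>
    (disjoint_disjointed _ hij).mono Set.inter_subset_right Set.inter_subset_right
  calc μ A ≤ μ (A ∩ ⋃ i, E i) := h1
    _ = ∑' n, μ (A ∩ disjointed (fun n => E (f n)) n) := by
      rw [hU, Set.inter_iUnion, measure_iUnion hd fun n => hA.inter (hm n)]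
    _ ≤ ∑' n, ν (A ∩ disjointed (fun n => E (f n)) n) := by
      refine ENNReal.tsum_le_tsum fun n => h (f n) _ ?_ (hA.inter (hm n))
      exact Set.inter_subset_right.trans (disjointed_subset _ n)
    _ = ν (A ∩ ⋃ i, E i) := by
      rw [hU, Set.inter_iUnion, measure_iUnion hd fun n => hA.inter (hm n)]
    _ ≤ ν A := measure_mono Set.inter_subset_left

theorem lintegral_Ioc_div_pow {h : ℝ} (hh : 0 < h) (n : ℕ) :
    ∫⁻ x in Set.Ioc 0 h, ENNReal.ofReal ((x / h) ^ n) = ENNReal.ofReal (h / (n + 1)) := by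
  rw [← ofReal_integral_eq_lintegral_ofReal]
  · rw [← intervalIntegral.integral_of_le hh.le]
    congr 1
    have : ∀ x : ℝ, (x / h) ^ n = x ^ n * (h ^ n)⁻¹ := fun x => by rw [div_pow, div_eq_mul_inv]
    simp only [this]
    rw [intervalIntegral.integral_mul_const, integral_pow]
    field_simp
    simp [pow_succ]
  · exact (Continuous.integrableOn_Icc (by fun_prop)).mono_set Set.Ioc_subset_Icc_self
  · refine (ae_restrict_iff' measurableSet_Ioc).2 (Eventually.of_forall fun x hx => ?_)
    have : 0 < x := hx.1
    simp only [Pi.zero_apply]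
    positivity

namespace IsBody

open scoped Pointwise

variable {d : ℕ} {L : Set (Euc d)}

/-- The radial projection to the boundary. -/
noncomputable def radial (L : Set (Euc d)) (y : Euc d) : Euc d := (gauge L y)⁻¹ • y

theorem measurable_radial (hL : IsBody L) : Measurable (radial L) :=
  (hL.continuous_gauge.measurable.inv).smul measurable_id

theorem radial_smul (hL : IsBody L) {t : ℝ} (ht : 0 < t) (y : Euc d) :
    radial L (t • y) = radial L y := by
  rw [radial, radial, hL.gauge_smul ht.le, smul_smul, mul_inv]
  congr 1
  field_simp

theorem gauge_smul_radial (hL : IsBody L) (y : Euc d) : gauge L y • radial L y = y := by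
  rcases eq_or_ne y 0 with rfl | hy
  · simp [radial]
  · rw [radial, smul_smul, mul_inv_cancel₀ (hL.gauge_pos hy).ne', one_smul]

theorem radial_of_mem_frontier (hL : IsBody L) {x : Euc d} (hx : x ∈ frontier L) :
    radial L x = x := by
  rw [radial, hL.gauge_eq_one_iff.2 hx, inv_one, one_smul]

/-- The volume of the cone over a flat set. -/
theorem volume_flat_cone (hL : IsBody L) (hd : 1 ≤ d) {n₀ : Euc d} (hn : ‖n₀‖ = 1) {h₀ : ℝ}
    (hh : 0 < h₀) {E : Set (Euc d)} (hE : MeasurableSet E) :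
    (d : ℝ≥0∞) * volume {y | (0 < ⟪n₀, y⟫_ℝ ∧ ⟪n₀, y⟫_ℝ ≤ h₀) ∧ radial L y ∈ E} =
      ENNReal.ofReal h₀ * μHE[d - 1] {z | ⟪n₀, z⟫_ℝ = h₀ ∧ radial L z ∈ E} := by
  have hn0 : n₀ ≠ 0 := fun h => by simp [h] at hn
  have hcont : Continuous fun y : Euc d => ⟪n₀, y⟫_ℝ := by fun_prop
  set T := {y | (0 < ⟪n₀, y⟫_ℝ ∧ ⟪n₀, y⟫_ℝ ≤ h₀) ∧ radial L y ∈ E} with hT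
  set F := {z | ⟪n₀, z⟫_ℝ = h₀ ∧ radial L z ∈ E} with hF
  have hTm : MeasurableSet T := by
    refine MeasurableSet.inter ?_ (hL.measurable_radial hE)
    exact (isOpen_lt continuous_const hcont).measurableSet.inter
      (isClosed_le hcont continuous_const).measurableSet
  -- Cavalieri's principle along `n₀`: the slice at height `x` is the top slice `F` scaled by `x /
  -- h₀`, and `(x / h₀) ^ (d - 1)` integrates over `(0, h₀]` to `h₀ / d`.
  have h1 := EuclideanGeometry.euclideanHausdorffMeasure_eq_lintegral (0 : Euc d) hn0 hTm
  rw [finrank_euclideanSpace_fin, EuclideanSpace.euclideanHausdorffMeasure_eq_volume] at h1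
  have hsec : ∀ x : ℝ, μHE[d - 1] (T ∩ AffineSubspace.mk' (x • n₀ +ᵥ (0 : Euc d)) (ℝ ∙ n₀)ᗮ) =
      (Set.Ioc 0 h₀).indicator (fun x => ENNReal.ofReal ((x / h₀) ^ (d - 1)) * μHE[d - 1] F) x := by
    intro x
    have hmem : ∀ y : Euc d, y ∈ AffineSubspace.mk' (x • n₀ +ᵥ (0 : Euc d)) (ℝ ∙ n₀)ᗮ ↔
        ⟪n₀, y⟫_ℝ = x := fun y => by
      rw [AffineSubspace.mem_mk', Submodule.mem_orthogonal_singleton_iff_inner_right]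
      simp [inner_sub_right, inner_smul_right, hn, sub_eq_zero]
    by_cases hx : x ∈ Set.Ioc 0 h₀
    · rw [Set.indicator_of_mem hx]
      have hx0 : 0 < x := hx.1
      have hq : 0 < x / h₀ := by positivity
      have hset : T ∩ AffineSubspace.mk' (x • n₀ +ᵥ (0 : Euc d)) (ℝ ∙ n₀)ᗮ = (x / h₀) • F := by
        ext y
        rw [Set.mem_smul_set_iff_inv_smul_mem₀ hq.ne']
        simp only [Set.mem_inter_iff, SetLike.mem_coe, hmem, hT, hF, Set.mem_ofPred_eq,
          hL.radial_smul (inv_pos.2 hq), inner_smul_right]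
        constructor
        · rintro ⟨⟨-, h2⟩, h3⟩
          refine ⟨?_, h2⟩
          rw [h3]
          field_simp
        · rintro ⟨h2, h3⟩
          have h4 : ⟪n₀, y⟫_ℝ = x := by
            rw [inv_mul_eq_iff_eq_mul₀ hq.ne'] at h2
            rw [h2]
            field_simp
          rw [h4]
          exact ⟨⟨⟨hx0, hx.2⟩, h3⟩, rfl⟩
      rw [hset, Measure.euclideanHausdorffMeasure_smul₀ _ hq.ne', ENNReal.smul_def, smul_eq_mul,
        ENNReal.coe_pow, ENNReal.ofReal_pow hq.le, ← ENNReal.ofReal_coe_nnreal, coe_nnnorm,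
        Real.norm_of_nonneg hq.le]
    · rw [Set.indicator_of_notMem hx]
      have : T ∩ AffineSubspace.mk' (x • n₀ +ᵥ (0 : Euc d)) (ℝ ∙ n₀)ᗮ = ∅ := by
        ext y
        simp only [Set.mem_inter_iff, SetLike.mem_coe, hmem, hT, Set.mem_ofPred_eq,
          Set.mem_empty_iff_false, iff_false]
        rintro ⟨⟨h2, -⟩, rfl⟩
        exact hx h2
      rw [this, measure_empty]
  simp only [hsec] at h1
  rw [lintegral_indicator measurableSet_Ioc, lintegral_mul_const _ (by fun_prop),
    lintegral_Ioc_div_pow hh] at h1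
  have he : ‖n₀‖ₑ = 1 := by rw [← ofReal_norm, hn, ENNReal.ofReal_one]
  rw [h1, he, one_mul, ← mul_assoc]
  congr 1
  rw [← ENNReal.ofReal_natCast, ← ENNReal.ofReal_mul (by positivity)]
  congr 1
  have : ((d - 1 : ℕ) : ℝ) + 1 = d := by
    rw [Nat.cast_sub hd]; simp
  rw [this]
  have : (d : ℝ) ≠ 0 := by positivity
  field_simp

/-! ### Nearly flat boundary pieces and the cones over them. -/

/-- A piece of the boundary that is flat up to factors `c`. -/
structure IsFlatPiece (L : Set (Euc d)) (c : NNReal) (n₀ : Euc d) (h₀ : ℝ) (E : Set (Euc d)) :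
    Prop where
  norm_eq : ‖n₀‖ = 1
  pos : 0 < h₀
  subset : E ⊆ frontier L
  le_mul : ∀ x ∈ E, h₀ ≤ c * ⟪n₀, x⟫_ℝ
  le_mul' : ∀ x ∈ E, ⟪n₀, x⟫_ℝ ≤ c * h₀
  -- The map `x ↦ (h₀ / ⟪n₀, x⟫) • x` is the central projection to the hyperplane `⟪n₀, ·⟫ = h₀`; it
  -- is bi-Lipschitz on `E` with constant `c` in both directions.
  dist_le : ∀ x ∈ E, ∀ y ∈ E,
    ‖(h₀ / ⟪n₀, x⟫_ℝ) • x - (h₀ / ⟪n₀, y⟫_ℝ) • y‖ ≤ c * ‖x - y‖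
  dist_le' : ∀ x ∈ E, ∀ y ∈ E,
    ‖x - y‖ ≤ c * ‖(h₀ / ⟪n₀, x⟫_ℝ) • x - (h₀ / ⟪n₀, y⟫_ℝ) • y‖

theorem IsFlatPiece.mono {c : NNReal} {n₀ : Euc d} {h₀ : ℝ} {E A : Set (Euc d)}
    (h : IsFlatPiece L c n₀ h₀ E) (hA : A ⊆ E) : IsFlatPiece L c n₀ h₀ A where
  norm_eq := h.norm_eq
  pos := h.pos
  subset := hA.trans h.subset
  le_mul x hx := h.le_mul x (hA hx)
  le_mul' x hx := h.le_mul' x (hA hx)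
  dist_le x hx y hy := h.dist_le x (hA hx) y (hA hy)
  dist_le' x hx y hy := h.dist_le' x (hA hx) y (hA hy)

theorem IsFlatPiece.inner_pos {c : NNReal} {n₀ : Euc d} {h₀ : ℝ} {E : Set (Euc d)}
    (h : IsFlatPiece L c n₀ h₀ E) {x : Euc d} (hx : x ∈ E) : 0 < ⟪n₀, x⟫_ℝ :=
  pos_of_mul_pos_right (h.pos.trans_le (h.le_mul x hx)) c.2

theorem IsFlatPiece.image_eq (hL : IsBody L) {c : NNReal} {n₀ : Euc d} {h₀ : ℝ}
    {E : Set (Euc d)} (h : IsFlatPiece L c n₀ h₀ E) :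
    (fun x => (h₀ / ⟪n₀, x⟫_ℝ) • x) '' E = {z | ⟪n₀, z⟫_ℝ = h₀ ∧ radial L z ∈ E} := by
  ext z
  simp only [Set.mem_image, Set.mem_ofPred_eq]
  constructor
  · rintro ⟨x, hx, rfl⟩
    have hp := h.inner_pos hx
    refine ⟨?_, ?_⟩
    · rw [inner_smul_right]; field_simp
    · rw [hL.radial_smul (div_pos h.pos hp), hL.radial_of_mem_frontier (h.subset hx)]
      exact hx
  · rintro ⟨hz, hzE⟩
    refine ⟨_, hzE, ?_⟩
    have hp := h.inner_pos hzE
    have h1 := hL.gauge_smul_radial z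
    have h2 : gauge L z * ⟪n₀, radial L z⟫_ℝ = h₀ := by rw [← inner_smul_right, h1, hz]
    conv_rhs => rw [← h1]
    rw [← h2, mul_div_assoc, div_self hp.ne', mul_one]

theorem IsFlatPiece.measure_image_le {c : NNReal} {n₀ : Euc d} {h₀ : ℝ}
    {E : Set (Euc d)} (h : IsFlatPiece L c n₀ h₀ E) :
    μHE[d - 1] ((fun x => (h₀ / ⟪n₀, x⟫_ℝ) • x) '' E) ≤ (c : ℝ≥0∞) ^ (d - 1) * μHE[d - 1] E := by
  refine LipschitzOnWith.euclideanHausdorffMeasure_image_le ?_ _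
  refine LipschitzOnWith.of_dist_le_mul fun x hx y hy => ?_
  rw [dist_eq_norm, dist_eq_norm]
  exact h.dist_le x hx y hy

theorem IsFlatPiece.measure_le {c : NNReal} {n₀ : Euc d} {h₀ : ℝ}
    {E : Set (Euc d)} (h : IsFlatPiece L c n₀ h₀ E) :
    μHE[d - 1] E ≤ (c : ℝ≥0∞) ^ (d - 1) * μHE[d - 1] ((fun x => (h₀ / ⟪n₀, x⟫_ℝ) • x) '' E) := by
  set τ := fun x : Euc d => (h₀ / ⟪n₀, x⟫_ℝ) • x with hτ
  have hinj : Set.InjOn τ E := fun x hx y hy hxy => by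
    have := h.dist_le' x hx y hy
    change ‖x - y‖ ≤ c * ‖τ x - τ y‖ at this
    rw [hxy, sub_self, norm_zero, mul_zero] at this
    exact sub_eq_zero.1 (norm_le_zero_iff.1 this)
  rcases E.eq_empty_or_nonempty with rfl | hne
  · simp
  obtain ⟨x₀, hx₀⟩ := hne
  have : Nonempty (Euc d) := ⟨x₀⟩
  have hinv : ∀ x ∈ E, Function.invFunOn τ E (τ x) = x := fun x hx => hinj.leftInvOn_invFunOn hx
  have himg : Function.invFunOn τ E '' (τ '' E) = E := by
    rw [Set.image_image]
    conv_rhs => rw [← Set.image_id E]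
    exact Set.image_congr hinv
  conv_lhs => rw [← himg]
  refine LipschitzOnWith.euclideanHausdorffMeasure_image_le ?_ _
  refine LipschitzOnWith.of_dist_le_mul ?_
  rintro _ ⟨x, hx, rfl⟩ _ ⟨y, hy, rfl⟩
  rw [hinv x hx, hinv y hy, dist_eq_norm, dist_eq_norm]
  exact h.dist_le' x hx y hy

theorem volume_smul_pos {c : ℝ} (hc : 0 < c) (s : Set (Euc d)) :
    volume (c • s) = ENNReal.ofReal c ^ d * volume s := by
  rw [Measure.addHaar_smul, finrank_euclideanSpace_fin, abs_of_pos (by positivity),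
    ENNReal.ofReal_pow hc.le]

/-- The cone over `E` and the cone over its central projection to the hyperplane contain each other
up to dilation by `c`, which costs `c ^ d`; the two bases differ by `c ^ (d - 1)`. For the flat cone
the formula is exact. -/
theorem IsFlatPiece.cone_estimates (hL : IsBody L) (hd : 1 ≤ d) {c : NNReal} (hc : 1 ≤ c)
    {n₀ : Euc d} {h₀ : ℝ} {E : Set (Euc d)} (hE : MeasurableSet E)
    (h : IsFlatPiece L c n₀ h₀ E) :
    ENNReal.ofReal h₀ * μHE[d - 1] E ≤
      (c : ℝ≥0∞) ^ (2 * d) * (d * volume {y | y ∈ L ∧ radial L y ∈ E}) ∧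
    d * volume {y | y ∈ L ∧ radial L y ∈ E} ≤
      (c : ℝ≥0∞) ^ (2 * d) * (ENNReal.ofReal h₀ * μHE[d - 1] E) := by
  have hflat := hL.volume_flat_cone hd h.norm_eq h.pos hE
  rw [← h.image_eq hL] at hflat
  set T := {y | (0 < ⟪n₀, y⟫_ℝ ∧ ⟪n₀, y⟫_ℝ ≤ h₀) ∧ radial L y ∈ E} with hT
  set C := {y | y ∈ L ∧ radial L y ∈ E} with hC
  set F := (fun x => (h₀ / ⟪n₀, x⟫_ℝ) • x) '' E
  have hc0 : (0 : ℝ) < c := by exact_mod_cast zero_lt_one.trans_le hc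
  have hc1 : (1 : ℝ≥0∞) ≤ c := by exact_mod_cast hc
  have hinner : ∀ y : Euc d, ⟪n₀, y⟫_ℝ = gauge L y * ⟪n₀, radial L y⟫_ℝ := fun y => by
    rw [← inner_smul_right, hL.gauge_smul_radial]
  have hTC : T ⊆ (c : ℝ) • C := by
    rintro y ⟨⟨hy1, hy2⟩, hyE⟩
    rw [Set.mem_smul_set_iff_inv_smul_mem₀ hc0.ne']
    refine ⟨?_, by rwa [hL.radial_smul (by positivity)]⟩
    rw [← hL.gauge_le_one_iff, hL.gauge_smul (by positivity), inv_mul_le_iff₀ hc0, mul_one]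
    have hp := h.inner_pos hyE
    have h1 := h.le_mul _ hyE
    rw [hinner] at hy2
    exact le_of_mul_le_mul_right (hy2.trans h1) hp
  have hCT : C ⊆ (c : ℝ) • T := by
    rintro y ⟨hy, hyE⟩
    rw [Set.mem_smul_set_iff_inv_smul_mem₀ hc0.ne']
    have hp := h.inner_pos hyE
    have h1 := h.le_mul' _ hyE
    have hy0 : y ≠ 0 := by
      rintro rfl
      simp [radial] at hp
    have hg := hL.gauge_pos hy0
    have hg1 := hL.gauge_le_one_iff.2 hy
    refine ⟨?_, by rwa [hL.radial_smul (by positivity)]⟩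
    rw [inner_smul_right, hinner]
    refine ⟨by positivity, ?_⟩
    rw [inv_mul_le_iff₀ hc0]
    calc gauge L y * ⟪n₀, radial L y⟫_ℝ ≤ 1 * ⟪n₀, radial L y⟫_ℝ := by gcongr
      _ ≤ _ := by rwa [one_mul]
  have vTC : volume T ≤ (c : ℝ≥0∞) ^ d * volume C := by
    refine (measure_mono hTC).trans_eq ?_
    rw [volume_smul_pos hc0, ENNReal.ofReal_coe_nnreal]
  have vCT : volume C ≤ (c : ℝ≥0∞) ^ d * volume T := by
    refine (measure_mono hCT).trans_eq ?_
    rw [volume_smul_pos hc0, ENNReal.ofReal_coe_nnreal]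
  have hpow : (c : ℝ≥0∞) ^ (d - 1) * (c : ℝ≥0∞) ^ d ≤ (c : ℝ≥0∞) ^ (2 * d) := by
    rw [← pow_add]
    exact pow_le_pow_right₀ hc1 (by omega)
  constructor
  · calc ENNReal.ofReal h₀ * μHE[d - 1] E
        ≤ ENNReal.ofReal h₀ * ((c : ℝ≥0∞) ^ (d - 1) * μHE[d - 1] F) := by
          gcongr; exact h.measure_le
      _ = (c : ℝ≥0∞) ^ (d - 1) * (ENNReal.ofReal h₀ * μHE[d - 1] F) := by ring
      _ = (c : ℝ≥0∞) ^ (d - 1) * (d * volume T) := by rw [hflat]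
      _ ≤ (c : ℝ≥0∞) ^ (d - 1) * (d * ((c : ℝ≥0∞) ^ d * volume C)) := by gcongr
      _ = ((c : ℝ≥0∞) ^ (d - 1) * (c : ℝ≥0∞) ^ d) * (d * volume C) := by ring
      _ ≤ _ := by gcongr
  · calc d * volume C ≤ d * ((c : ℝ≥0∞) ^ d * volume T) := by gcongr
      _ = (c : ℝ≥0∞) ^ d * (d * volume T) := by ring
      _ = (c : ℝ≥0∞) ^ d * (ENNReal.ofReal h₀ * μHE[d - 1] F) := by rw [hflat]
      _ ≤ (c : ℝ≥0∞) ^ d * (ENNReal.ofReal h₀ * ((c : ℝ≥0∞) ^ (d - 1) * μHE[d - 1] E)) := by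
          gcongr; exact h.measure_image_le
      _ = ((c : ℝ≥0∞) ^ (d - 1) * (c : ℝ≥0∞) ^ d) * (ENNReal.ofReal h₀ * μHE[d - 1] E) := by ring
      _ ≤ _ := by gcongr

/-- The two expressions are the Lipschitz bounds obtained below for the central projection of a
piece: `(1 - δ)⁻¹ + δ (1 - δ)⁻² = (1 - δ)⁻²` from above, and the expression on the right from below.
-/
theorem exists_flatness_parameter {c : ℝ} (hc : 1 < c) : ∃ δ : ℝ, 0 < δ ∧ δ < 1 ∧
    ((1 - δ) ^ 2)⁻¹ ≤ c ∧ c⁻¹ ≤ (1 + δ)⁻¹ - δ * ((1 - δ) ^ 2)⁻¹ := by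
  have h1 : ContinuousAt (fun δ : ℝ => ((1 - δ) ^ 2)⁻¹) 0 :=
    ContinuousAt.inv₀ (by fun_prop) (by norm_num)
  have h2 : ContinuousAt (fun δ : ℝ => (1 + δ)⁻¹ - δ * ((1 - δ) ^ 2)⁻¹) 0 :=
    (ContinuousAt.inv₀ (by fun_prop) (by norm_num)).sub (continuousAt_id.mul h1)
  have e1 := h1.eventually_lt_const (u := c) (by simpa using hc)
  have e2 := h2.eventually_const_lt (u := c⁻¹) (by simpa using inv_lt_one_of_one_lt₀ hc)
  have e3 : ∀ᶠ δ in 𝓝[>] (0 : ℝ), δ < 1 := mem_nhdsWithin_of_mem_nhds (Iio_mem_nhds one_pos)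
  obtain ⟨δ, ⟨⟨h3, h4⟩, h5⟩, h6⟩ :=
    (((e1.and e2).filter_mono nhdsWithin_le_nhds).and e3 |>.and self_mem_nhdsWithin).exists
  exact ⟨δ, h6, h5, h3.le, h4.le⟩

/-- If points and normals vary little, the piece is almost orthogonal to `n₀`. The central
projection then acts on differences as the scalar `h₀ / ⟪n₀, x⟫`, close to `1`, up to an error of
relative size `δ (1 - δ)⁻²`. -/
theorem isFlatPiece_of_close (hL : IsBody L) {r R : ℝ} (hr : 0 < r) (hR : 0 < R)
    (hrL : Metric.closedBall 0 r ⊆ L) (hRL : L ⊆ Metric.closedBall 0 R) {c : NNReal} {δ : ℝ}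
    (hδ0 : 0 < δ) (hδ1 : δ < 1) (hc1 : ((1 - δ) ^ 2)⁻¹ ≤ (c : ℝ))
    (hc2 : (c : ℝ)⁻¹ ≤ (1 + δ)⁻¹ - δ * ((1 - δ) ^ 2)⁻¹) (hc : 1 ≤ c)
    {x₀ n₀ : Euc d} (hn₀ : n₀ ∈ outerNormals ⊤ L x₀) {E : Set (Euc d)}
    (hE : E ⊆ frontier L) (N : Euc d → Euc d) (hN : ∀ x ∈ E, N x ∈ outerNormals ⊤ L x)
    (hdist : ∀ x ∈ E, ‖x - x₀‖ ≤ δ * r / (1 + R)) (hdistN : ∀ x ∈ E, ‖N x - n₀‖ ≤ δ * r / (1 + R)) :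
    IsFlatPiece L c n₀ ⟪n₀, x₀⟫_ℝ E ∧
      ∀ x ∈ E, ⟪N x, x⟫_ℝ ≤ c * ⟪n₀, x₀⟫_ℝ ∧ ⟪n₀, x₀⟫_ℝ ≤ c * ⟪N x, x⟫_ℝ := by
  -- Since `ε (1 + R) = δ r ≤ δ h₀`, both `⟪n₀, x⟫` and `⟪N x, x⟫` differ from `h₀` by at most `δ
  -- h₀`.
  set ε := δ * r / (1 + R) with hε
  set h₀ := ⟪n₀, x₀⟫_ℝ with hh₀
  have hε0 : 0 < ε := by positivity
  have hεR : ε * (1 + R) = δ * r := by rw [hε]; field_simp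
  have hrh : r ≤ h₀ := by rw [hh₀, real_inner_comm]; exact hL.le_inner hr hrL hn₀
  have h₀pos : 0 < h₀ := hr.trans_le hrh
  have hδh : ε + R * ε ≤ δ * h₀ := by
    calc ε + R * ε = δ * r := by rw [← hεR]; ring
      _ ≤ δ * h₀ := by gcongr
  have hc0 : (0 : ℝ) < c := by exact_mod_cast zero_lt_one.trans_le hc
  have hRnorm : ∀ x ∈ frontier L, ‖x‖ ≤ R := fun x hx => by
    simpa using hRL (hL.frontier_subset hx)
  have hn1 : ‖n₀‖ = 1 := hn₀.2.1
  have h1δ : 0 < 1 - δ := by linarith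
  have hcδ : (1 - δ)⁻¹ ≤ c := by
    refine le_trans ?_ hc1
    gcongr
    nlinarith
  have hcδ' : 1 + δ ≤ c := by
    refine le_trans ?_ hcδ
    rw [le_inv_comm₀ (by positivity) h1δ, inv_eq_one_div, le_div_iff₀ (by positivity)]
    nlinarith
  have close_bounds : ∀ q : ℝ, |q - h₀| ≤ δ * h₀ → q ≤ c * h₀ ∧ h₀ ≤ c * q := fun q hq => by
    rw [abs_le] at hq
    constructor
    · calc q ≤ (1 + δ) * h₀ := by linarith
        _ ≤ _ := by gcongr
    · have h1 : (1 - δ) * h₀ ≤ q := by linarith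
      calc h₀ = (1 - δ)⁻¹ * ((1 - δ) * h₀) := by field_simp
        _ ≤ c * q := by gcongr
  have hs : ∀ x ∈ E, |⟪n₀, x⟫_ℝ - h₀| ≤ δ * h₀ := fun x hx => by
    rw [hh₀, ← inner_sub_right]
    refine (abs_real_inner_le_norm _ _).trans ?_
    rw [hn1, one_mul]
    have := hdist x hx
    nlinarith
  have hh : ∀ x ∈ E, |⟪N x, x⟫_ℝ - h₀| ≤ δ * h₀ := fun x hx => by
    have e : ⟪N x, x⟫_ℝ - h₀ = ⟪N x - n₀, x⟫_ℝ + ⟪n₀, x - x₀⟫_ℝ := by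
      rw [inner_sub_left, inner_sub_right]; ring
    rw [e]
    refine (abs_add_le _ _).trans ?_
    have h1 := abs_real_inner_le_norm (N x - n₀) x
    have h2 := abs_real_inner_le_norm n₀ (x - x₀)
    rw [hn1, one_mul] at h2
    have h3 : ‖N x - n₀‖ * ‖x‖ ≤ ε * R := by
      gcongr
      · exact hdistN x hx
      · exact hRnorm x (hE hx)
    have := hdist x hx
    linarith
  -- The supporting inequality at `x`, with `N x` replaced by `n₀`. Used at both endpoints it bounds
  -- the slope of the piece relative to `n₀`, without any smoothness.
  have hslope : ∀ x ∈ E, ∀ y ∈ E, ⟪n₀, y - x⟫_ℝ ≤ ε * ‖x - y‖ := fun x hx y hy => by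
    have h1 := (hN x hx).2.2 y (hL.frontier_subset (hE hy))
    have e : ⟪n₀, y - x⟫_ℝ = ⟪y - x, N x⟫_ℝ - ⟪N x - n₀, y - x⟫_ℝ := by
      rw [real_inner_comm (N x) (y - x), inner_sub_left]; ring
    have h2 := abs_real_inner_le_norm (N x - n₀) (y - x)
    have h3 : ‖N x - n₀‖ * ‖y - x‖ ≤ ε * ‖x - y‖ := by
      rw [norm_sub_rev y x]
      gcongr
      exact hdistN x hx
    have := (abs_le.1 h2).1
    linarith
  have hslo : ∀ x ∈ E, (1 - δ) * h₀ ≤ ⟪n₀, x⟫_ℝ := fun x hx => by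
    have := (abs_le.1 (hs x hx)).1; linarith
  have hshi : ∀ x ∈ E, ⟪n₀, x⟫_ℝ ≤ (1 + δ) * h₀ := fun x hx => by
    have := (abs_le.1 (hs x hx)).2; linarith
  have hspos : ∀ x ∈ E, 0 < ⟪n₀, x⟫_ℝ := fun x hx => lt_of_lt_of_le (by positivity) (hslo x hx)
  have herr : ∀ x ∈ E, ∀ y ∈ E, ‖(h₀ / ⟪n₀, x⟫_ℝ) • x - (h₀ / ⟪n₀, y⟫_ℝ) • y -
      (h₀ / ⟪n₀, x⟫_ℝ) • (x - y)‖ ≤ δ * ((1 - δ) ^ 2)⁻¹ * ‖x - y‖ := fun x hx y hy => by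
    have e : (h₀ / ⟪n₀, x⟫_ℝ) • x - (h₀ / ⟪n₀, y⟫_ℝ) • y - (h₀ / ⟪n₀, x⟫_ℝ) • (x - y) =
        (h₀ * ⟪n₀, y - x⟫_ℝ / (⟪n₀, x⟫_ℝ * ⟪n₀, y⟫_ℝ)) • y := by
      have h1 := (hspos x hx).ne'
      have h2 := (hspos y hy).ne'
      have h3 : (h₀ / ⟪n₀, x⟫_ℝ) • x - (h₀ / ⟪n₀, y⟫_ℝ) • y - (h₀ / ⟪n₀, x⟫_ℝ) • (x - y) =
          (h₀ / ⟪n₀, x⟫_ℝ - h₀ / ⟪n₀, y⟫_ℝ) • y := by module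
      rw [h3, inner_sub_right]
      congr 1
      field_simp
    have hab : |⟪n₀, y - x⟫_ℝ| ≤ ε * ‖x - y‖ := by
      refine abs_le.2 ⟨?_, hslope x hx y hy⟩
      have h1 := hslope y hy x hx
      rw [norm_sub_rev] at h1
      have e : ⟪n₀, y - x⟫_ℝ = -⟪n₀, x - y⟫_ℝ := by rw [← inner_neg_right, neg_sub]
      linarith
    have hx1 := hslo x hx
    have hy1 := hslo y hy
    have hx0 := hspos x hx
    have hy0 := hspos y hy
    rw [e, norm_smul, Real.norm_eq_abs, abs_div, abs_mul, abs_of_pos h₀pos,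
      abs_of_pos (mul_pos hx0 hy0)]
    calc h₀ * |⟪n₀, y - x⟫_ℝ| / (⟪n₀, x⟫_ℝ * ⟪n₀, y⟫_ℝ) * ‖y‖
        ≤ h₀ * (ε * ‖x - y‖) / (((1 - δ) * h₀) * ((1 - δ) * h₀)) * R := by
          gcongr
          exact hRnorm y (hE hy)
      _ = (R * ε) / h₀ * ((1 - δ) ^ 2)⁻¹ * ‖x - y‖ := by field_simp
      _ ≤ δ * ((1 - δ) ^ 2)⁻¹ * ‖x - y‖ := by
          gcongr
          rw [div_le_iff₀ h₀pos]
          linarith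
  have hmain : ∀ x ∈ E, ‖(h₀ / ⟪n₀, x⟫_ℝ) • (x - x₀)‖ = h₀ / ⟪n₀, x⟫_ℝ * ‖x - x₀‖ := fun x hx => by
    rw [norm_smul, Real.norm_of_nonneg (div_nonneg h₀pos.le (hspos x hx).le)]
  refine ⟨⟨hn1, h₀pos, hE, fun x hx => (close_bounds _ (hs x hx)).2,
    fun x hx => (close_bounds _ (hs x hx)).1, fun x hx y hy => ?_, fun x hx y hy => ?_⟩,
    fun x hx => close_bounds _ (hh x hx)⟩
  · have h1 := herr x hx y hy
    have h2 := norm_le_norm_add_norm_sub' ((h₀ / ⟪n₀, x⟫_ℝ) • x - (h₀ / ⟪n₀, y⟫_ℝ) • y)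
      ((h₀ / ⟪n₀, x⟫_ℝ) • (x - y))
    rw [norm_smul, Real.norm_of_nonneg (div_nonneg h₀pos.le (hspos x hx).le)] at h2
    have h3 : h₀ / ⟪n₀, x⟫_ℝ ≤ (1 - δ)⁻¹ := by
      rw [div_le_iff₀ (hspos x hx), ← div_eq_inv_mul, le_div_iff₀ h1δ]
      linarith [hslo x hx]
    calc _ ≤ _ := h2
      _ ≤ (1 - δ)⁻¹ * ‖x - y‖ + δ * ((1 - δ) ^ 2)⁻¹ * ‖x - y‖ := by gcongr
      _ = ((1 - δ) ^ 2)⁻¹ * ‖x - y‖ := by field_simp; ring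
      _ ≤ c * ‖x - y‖ := by gcongr
  · have h1 := herr x hx y hy
    have h2 := norm_le_norm_add_norm_sub ((h₀ / ⟪n₀, x⟫_ℝ) • x - (h₀ / ⟪n₀, y⟫_ℝ) • y)
      ((h₀ / ⟪n₀, x⟫_ℝ) • (x - y))
    rw [norm_smul, Real.norm_of_nonneg (div_nonneg h₀pos.le (hspos x hx).le)] at h2
    have h3 : (1 + δ)⁻¹ ≤ h₀ / ⟪n₀, x⟫_ℝ := by
      rw [le_div_iff₀ (hspos x hx), ← div_eq_inv_mul, div_le_iff₀ (by positivity)]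
      linarith [hshi x hx]
    have h4 : (c : ℝ)⁻¹ * ‖x - y‖ ≤ ‖(h₀ / ⟪n₀, x⟫_ℝ) • x - (h₀ / ⟪n₀, y⟫_ℝ) • y‖ := by
      calc (c : ℝ)⁻¹ * ‖x - y‖ ≤ ((1 + δ)⁻¹ - δ * ((1 - δ) ^ 2)⁻¹) * ‖x - y‖ := by gcongr
        _ = (1 + δ)⁻¹ * ‖x - y‖ - δ * ((1 - δ) ^ 2)⁻¹ * ‖x - y‖ := by ring
        _ ≤ h₀ / ⟪n₀, x⟫_ℝ * ‖x - y‖ - δ * ((1 - δ) ^ 2)⁻¹ * ‖x - y‖ := by gcongr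
        _ ≤ _ := by linarith
    rwa [inv_mul_le_iff₀ hc0] at h4

/-! ### From nearly flat pieces to the cone volume formula. -/

theorem differentiableAt_gauge_smul_iff (hL : IsBody L) {t : ℝ} (ht : 0 < t) {x : Euc d}
    (h : DifferentiableAt ℝ (gauge L) (t • x)) : DifferentiableAt ℝ (gauge L) x := by
  have e : gauge L = fun y => t⁻¹ * gauge L (t • y) := by
    funext y
    rw [hL.gauge_smul ht.le, ← mul_assoc, inv_mul_cancel₀ ht.ne', one_mul]
  rw [e]
  have h1 : DifferentiableAt ℝ (fun y : Euc d => t • y) x := by fun_prop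
  exact (DifferentiableAt.comp x (f := fun y : Euc d => t • y) h h1).const_mul _

/-- The set of smooth boundary points. -/
def smoothSet (L : Set (Euc d)) : Set (Euc d) :=
  {x | x ∈ frontier L ∧ DifferentiableAt ℝ (gauge L) x}

theorem measurableSet_smoothSet (L : Set (Euc d)) : MeasurableSet (smoothSet L) :=
  isClosed_frontier.measurableSet.inter (measurableSet_of_differentiableAt ℝ _)

theorem ae_differentiableAt_volume (hL : IsBody L) :
    ∀ᵐ x : Euc d, DifferentiableAt ℝ (gauge L) x := by
  obtain ⟨K, hK⟩ := hL.convex.lipschitz_gauge hL.mem_nhds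
  exact hK.ae_differentiableAt

/-- Cone volumes and cone measure agree up to a factor close to `1`. -/
theorem cone_measure_comparison (hL : IsBody L) (hd : 1 ≤ d) {c : NNReal} (hc : 1 < c) :
    (μHE[d - 1].restrict (smoothSet L)).withDensity
        (fun x => ENNReal.ofReal ‖gradient (gauge L) x‖⁻¹) ≤
      ((c : ℝ≥0∞) ^ (2 * d + 1) * d) • (volume.restrict L).map (radial L) ∧
    (d : ℝ≥0∞) • (volume.restrict L).map (radial L) ≤
      (c : ℝ≥0∞) ^ (2 * d + 1) • (μHE[d - 1].restrict (smoothSet L)).withDensity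
        (fun x => ENNReal.ofReal ‖gradient (gauge L) x‖⁻¹) := by
  obtain ⟨r, R, hr, hR, hrL, hRL⟩ := hL.exists_radii
  obtain ⟨δ, hδ0, hδ1, hδ2, hδ3⟩ := exists_flatness_parameter (c := (c : ℝ)) (by exact_mod_cast hc)
  set N : Euc d → Euc d := fun x => ‖gradient (gauge L) x‖⁻¹ • gradient (gauge L) x with hNdef
  have hNm : Measurable N := hL.measurable_gradient_gauge.norm.inv.smul hL.measurable_gradient_gauge
  have hN : ∀ x ∈ smoothSet L, N x ∈ outerNormals ⊤ L x ∧
      ⟪N x, x⟫_ℝ = ‖gradient (gauge L) x‖⁻¹ := fun x hx => by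
    have h := hL.outerNormals_eq_singleton hx.1 hx.2
    refine ⟨?_, by rw [real_inner_comm]; exact h.2⟩
    rw [h.1]
    rfl
  set ε := δ * r / (1 + R) with hε
  have hε0 : 0 < ε := by positivity
  -- The Lindelöf property for the graph of the normal map: countably many pieces suffice on which
  -- points and normals are both `ε`-close. Only measurability of `N` is needed, not continuity.
  obtain ⟨T, hT, hTU⟩ := TopologicalSpace.isOpen_iUnion_countable
    (fun x₀ : smoothSet L => Metric.ball ((x₀ : Euc d), N x₀) ε) (fun _ => Metric.isOpen_ball)
  have hTc : Countable T := hT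
  set E : T → Set (Euc d) := fun i => smoothSet L ∩
    (fun x => (x, N x)) ⁻¹' Metric.ball (((i : smoothSet L) : Euc d), N i) ε with hEdef
  have hEm : ∀ i, MeasurableSet (E i) := fun i => (measurableSet_smoothSet L).inter
    ((measurable_id.prodMk hNm) Metric.isOpen_ball.measurableSet)
  have hcov : ⋃ i, E i = smoothSet L := by
    refine Set.Subset.antisymm (Set.iUnion_subset fun i => Set.inter_subset_left) fun x hx => ?_
    have h1 : ((x, N x) : Euc d × Euc d) ∈
        ⋃ x₀ : smoothSet L, Metric.ball ((x₀ : Euc d), N x₀) ε :=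
      Set.mem_iUnion.2 ⟨⟨x, hx⟩, Metric.mem_ball_self hε0⟩
    rw [← hTU] at h1
    obtain ⟨i, hi, hxi⟩ := Set.mem_iUnion₂.1 h1
    exact Set.mem_iUnion.2 ⟨⟨i, hi⟩, hx, hxi⟩
  have hclose : ∀ i, ∀ x ∈ E i, ‖x - i‖ ≤ ε ∧ ‖N x - N i‖ ≤ ε := fun i x hx => by
    have h1 : dist ((x, N x) : Euc d × Euc d) (((i : smoothSet L) : Euc d), N i) < ε := hx.2
    rw [Prod.dist_eq, max_lt_iff, dist_eq_norm, dist_eq_norm] at h1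
    exact ⟨h1.1.le, h1.2.le⟩
  have hpiece : ∀ i : T, IsFlatPiece L c (N i) ⟪N i, ((i : smoothSet L) : Euc d)⟫_ℝ (E i) ∧
      ∀ x ∈ E i, ⟪N x, x⟫_ℝ ≤ c * ⟪N i, ((i : smoothSet L) : Euc d)⟫_ℝ ∧
        ⟪N i, ((i : smoothSet L) : Euc d)⟫_ℝ ≤ c * ⟪N x, x⟫_ℝ := fun i =>
    hL.isFlatPiece_of_close hr hR hrL hRL hδ0 hδ1 hδ2 hδ3 hc.le
      (hN _ (i : smoothSet L).2).1 (fun x hx => hx.1.1) N (fun x hx => (hN x hx.1).1)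
      (fun x hx => (hclose i x hx).1) (fun x hx => (hclose i x hx).2)
  have hdens : ∀ i : T, ∀ A ⊆ E i, MeasurableSet A →
      (μHE[d - 1].restrict (smoothSet L)).withDensity
        (fun x => ENNReal.ofReal ‖gradient (gauge L) x‖⁻¹) A ≤
        c * (ENNReal.ofReal ⟪N i, ((i : smoothSet L) : Euc d)⟫_ℝ * μHE[d - 1] A) ∧
      ENNReal.ofReal ⟪N i, ((i : smoothSet L) : Euc d)⟫_ℝ * μHE[d - 1] A ≤
      c * (μHE[d - 1].restrict (smoothSet L)).withDensity
        (fun x => ENNReal.ofReal ‖gradient (gauge L) x‖⁻¹) A := by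
    intro i A hA hAm
    have hAS : A ⊆ smoothSet L := hA.trans Set.inter_subset_left
    rw [withDensity_apply _ hAm, Measure.restrict_restrict hAm, Set.inter_eq_left.2 hAS]
    set h₀ := ⟪N i, ((i : smoothSet L) : Euc d)⟫_ℝ
    have hb : ∀ x ∈ A, ENNReal.ofReal ‖gradient (gauge L) x‖⁻¹ ≤ c * ENNReal.ofReal h₀ ∧
        ENNReal.ofReal h₀ ≤ c * ENNReal.ofReal ‖gradient (gauge L) x‖⁻¹ := fun x hx => by
      have h1 := (hpiece i).2 x (hA hx)
      rw [(hN x (hAS hx)).2] at h1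
      rw [← ENNReal.ofReal_coe_nnreal, ← ENNReal.ofReal_mul (NNReal.coe_nonneg c),
        ← ENNReal.ofReal_mul (NNReal.coe_nonneg c)]
      exact ⟨ENNReal.ofReal_le_ofReal h1.1, ENNReal.ofReal_le_ofReal h1.2⟩
    constructor
    · calc _ ≤ ∫⁻ _ in A, c * ENNReal.ofReal h₀ ∂μHE[d - 1] :=
            setLIntegral_mono' hAm fun x hx => (hb x hx).1
        _ = _ := by rw [setLIntegral_const, mul_assoc]
    · calc ENNReal.ofReal h₀ * μHE[d - 1] A = ∫⁻ _ in A, ENNReal.ofReal h₀ ∂μHE[d - 1] := by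
            rw [setLIntegral_const]
        _ ≤ ∫⁻ x in A, c * ENNReal.ofReal ‖gradient (gauge L) x‖⁻¹ ∂μHE[d - 1] :=
            setLIntegral_mono' hAm fun x hx => (hb x hx).2
        _ = _ := lintegral_const_mul' _ _ (by simp)
  have hmap : ∀ A, MeasurableSet A → (volume.restrict L).map (radial L) A =
      volume {y | y ∈ L ∧ radial L y ∈ A} := fun A hA => by
    rw [Measure.map_apply hL.measurable_radial hA, Measure.restrict_apply
      (hL.measurable_radial hA), Set.inter_comm]
    rfl
  constructor
  · refine Measure.le_of_countable_cover E hEm ?_ fun i A hA hAm => ?_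
    · rw [hcov, withDensity_apply _ (measurableSet_smoothSet L).compl, Measure.restrict_restrict
        (measurableSet_smoothSet L).compl, Set.compl_inter_self]
      simp
    · rw [Measure.smul_apply, hmap A hAm, smul_eq_mul]
      have h1 := (((hpiece i).1.mono hA).cone_estimates hL hd hc.le hAm).1
      refine (hdens i A hA hAm).1.trans ?_
      calc _ ≤ (c : ℝ≥0∞) *
            ((c : ℝ≥0∞) ^ (2 * d) * (d * volume {y | y ∈ L ∧ radial L y ∈ A})) := by gcongr
        _ = _ := by ring
  · refine Measure.le_of_countable_cover E hEm ?_ fun i A hA hAm => ?_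
    -- By homogeneity, a nonzero point with a nonsmooth radial projection is itself a point of
    -- nondifferentiability of the gauge; such points form a Lebesgue null set.
    · rw [hcov, Measure.smul_apply, hmap _ (measurableSet_smoothSet L).compl, smul_eq_mul,
        mul_eq_zero]
      right
      have : Nonempty (Fin d) := ⟨⟨0, hd⟩⟩
      have h0 : ∀ᵐ y : Euc d, y ≠ 0 := by
        rw [ae_iff]; simp
      refine measure_mono_null (fun y hy => ?_) (ae_iff.1 (h0.and hL.ae_differentiableAt_volume))
      rintro ⟨hy0, hyd⟩
      refine hy.2 ⟨hL.inv_gauge_smul_mem_frontier hy0, ?_⟩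
      have hg := hL.gauge_pos hy0
      refine hL.differentiableAt_gauge_smul_iff hg ?_
      rwa [hL.gauge_smul_radial]
    · rw [Measure.smul_apply, hmap A hAm, smul_eq_mul, Measure.smul_apply, smul_eq_mul]
      have h1 := (((hpiece i).1.mono hA).cone_estimates hL hd hc.le hAm).2
      refine h1.trans ?_
      calc _ ≤ (c : ℝ≥0∞) ^ (2 * d) * (c * _) := mul_le_mul' le_rfl (hdens i A hA hAm).2
        _ = _ := by ring

theorem _root_.ENNReal.le_of_forall_le_pow_mul {a b : ℝ≥0∞} (n : ℕ)
    (h : ∀ c : NNReal, 1 < c → a ≤ (c : ℝ≥0∞) ^ n * b) : a ≤ b := by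
  by_contra! hlt
  obtain ⟨c, hc, hct, hcb⟩ := ENNReal.exists_one_lt_rpow_mul_lt hlt n
  lift c to NNReal using hct
  rw [ENNReal.rpow_natCast] at hcb
  exact absurd (h c (by exact_mod_cast hc)) (not_le.2 hcb)

theorem restrict_smoothSet (hL : IsBody L) :
    (μHE[d - 1] : Measure (Euc d)).restrict (smoothSet L) =
      μHE[d - 1].restrict (frontier L) := by
  refine Measure.restrict_congr_set ?_
  refine (LE.le.eventuallyLE fun x hx => hx.1).antisymm ?_
  have h1 := hL.measure_not_differentiableAt
  have h2 : ∀ᵐ x ∂(μHE[d - 1] : Measure (Euc d)),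
      ¬ (x ∈ frontier L ∧ ¬ DifferentiableAt ℝ (gauge L) x) := by
    rw [ae_iff]; simpa using h1
  filter_upwards [h2] with x hx hxL
  exact ⟨hxL, by_contra fun h => hx ⟨hxL, h⟩⟩

/-- The volume of a convex body as the integral of the cone volume measure. -/
theorem natCast_mul_volume_eq (hL : IsBody L) (hd : 1 ≤ d) :
    (d : ℝ≥0∞) * volume L =
      ∫⁻ x in frontier L, ENNReal.ofReal ‖gradient (gauge L) x‖⁻¹ ∂μHE[d - 1] := by
  have hS := hL.restrict_smoothSet
  have hu : (volume.restrict L).map (radial L) Set.univ = volume L := by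
    rw [Measure.map_apply hL.measurable_radial MeasurableSet.univ]
    simp
  refine le_antisymm (ENNReal.le_of_forall_le_pow_mul (2 * d + 1) fun c hc => ?_)
    (ENNReal.le_of_forall_le_pow_mul (2 * d + 1) fun c hc => ?_)
  · have := (hL.cone_measure_comparison hd hc).2 Set.univ
    rw [Measure.smul_apply, Measure.smul_apply, hu, withDensity_apply _ MeasurableSet.univ,
      Measure.restrict_univ, hS] at this
    simpa using this
  · have := (hL.cone_measure_comparison hd hc).1 Set.univ
    rw [Measure.smul_apply, hu, withDensity_apply _ MeasurableSet.univ,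
      Measure.restrict_univ, hS] at this
    rw [← mul_assoc]
    simpa using this

end IsBody

/-! ### The projective model -/

/-- The squared chordal distance of two points of the projective model of curvature `lam`. -/
noncomputable def gnomDistSq {d : ℕ} (lam : ℝ) (x y : Euc d) : ℝ :=
  2 * (‖x - y‖ ^ 2 + lam * (‖x‖ ^ 2 * ‖y‖ ^ 2 - ⟪x, y⟫_ℝ ^ 2)) /
    (√(1 + lam * ‖x‖ ^ 2) * √(1 + lam * ‖y‖ ^ 2) *
      (√(1 + lam * ‖x‖ ^ 2) * √(1 + lam * ‖y‖ ^ 2) + 1 + lam * ⟪x, y⟫_ℝ))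

theorem one_add_mul_norm_le_sqrt_mul_sqrt {d : ℕ} {lam : ℝ} (hlam : 0 ≤ lam) (x y : Euc d) :
    1 + lam * (‖x‖ * ‖y‖) ≤ √(1 + lam * ‖x‖ ^ 2) * √(1 + lam * ‖y‖ ^ 2) := by
  rw [← Real.sqrt_mul (by positivity)]
  refine Real.le_sqrt_of_sq_le ?_
  nlinarith [mul_nonneg hlam (sq_nonneg (‖x‖ - ‖y‖))]

theorem two_le_gnom_denominator {d : ℕ} {lam : ℝ} (hlam : 0 ≤ lam) (x y : Euc d) :
    2 ≤ √(1 + lam * ‖x‖ ^ 2) * √(1 + lam * ‖y‖ ^ 2) + 1 + lam * ⟪x, y⟫_ℝ := by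
  have h1 := one_add_mul_norm_le_sqrt_mul_sqrt hlam x y
  have h2 := (abs_le.1 (abs_real_inner_le_norm x y)).1
  nlinarith [mul_le_mul_of_nonneg_left h2 hlam]

namespace ProjectiveModel

variable {d : ℕ} {lam : ℝ} (M : ProjectiveModel d lam)

/-- The inverse of the gnomonic projection. -/
noncomputable def param (x : Euc d) : Euc (d + 1) :=
  (√(1 + lam * ‖x‖ ^ 2))⁻¹ • (M.chart x + M.o)

/-- The adjoint of the chart. -/
noncomputable def chartAdj : Euc (d + 1) →L[ℝ] Euc d :=
  ContinuousLinearMap.adjoint M.chart.toContinuousLinearMap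

/-- The gnomonic projection with values in `ℝᵈ`. -/
noncomputable def proj (u : Euc (d + 1)) : Euc d := (lam * ⟪u, M.o⟫_ℝ)⁻¹ • M.chartAdj u

/-- The outer unit normal of the lifted body, in terms of the Euclidean outer unit normal. -/
noncomputable def liftNormal (x v : Euc d) : Euc (d + 1) :=
  (√(1 + lam * ⟪x, v⟫_ℝ ^ 2))⁻¹ • (M.chart v - (lam * ⟪x, v⟫_ℝ) • M.o)

/-! ### Coordinates on the sphere by the gnomonic projection and its inverse. -/

theorem inner_chartAdj (u : Euc (d + 1)) (x : Euc d) :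
    ⟪M.chartAdj u, x⟫_ℝ = ⟪u, M.chart x⟫_ℝ := by
  rw [chartAdj, ContinuousLinearMap.adjoint_inner_left]
  rfl

theorem chartAdj_chart (x : Euc d) : M.chartAdj (M.chart x) = x :=
  ext_inner_right ℝ fun y => by rw [inner_chartAdj, LinearIsometry.inner_map_map]

theorem chartAdj_o : M.chartAdj M.o = 0 :=
  ext_inner_right ℝ fun y => by rw [inner_chartAdj, real_inner_comm, M.chart_orth, inner_zero_left]

theorem inner_o_chart (x : Euc d) : ⟪M.o, M.chart x⟫_ℝ = 0 := by
  rw [real_inner_comm, M.chart_orth]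

variable (hlam : 0 < lam)

include hlam

theorem mem_sphereLam_iff {u : Euc (d + 1)} : u ∈ sphereLam d lam ↔ ⟪u, u⟫_ℝ = lam⁻¹ := by
  rw [sphereLam, mem_sphere_zero_iff_norm, real_inner_self_eq_norm_sq]
  have : (1 / √lam) ^ 2 = lam⁻¹ := by rw [div_pow, Real.sq_sqrt hlam.le, one_pow, one_div]
  rw [← this, sq_eq_sq₀ (norm_nonneg _) (by positivity)]

theorem inner_o_o : ⟪M.o, M.o⟫_ℝ = lam⁻¹ := (mem_sphereLam_iff hlam).1 M.o_mem

theorem o_ne_zero : M.o ≠ 0 := fun h => by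
  have := M.inner_o_o hlam
  rw [h, inner_zero_left] at this
  exact (inv_pos.2 hlam).ne this

theorem range_chart : LinearMap.range M.chart.toLinearMap = (ℝ ∙ M.o)ᗮ := by
  refine Submodule.eq_of_le_of_finrank_eq ?_ ?_
  · rintro _ ⟨x, rfl⟩
    rw [Submodule.mem_orthogonal_singleton_iff_inner_right]
    exact M.inner_o_chart x
  · rw [LinearMap.finrank_range_of_inj M.chart.injective, finrank_euclideanSpace_fin]
    have h1 := Submodule.finrank_add_finrank_orthogonal (ℝ ∙ M.o)
    rw [finrank_span_singleton (M.o_ne_zero hlam), finrank_euclideanSpace_fin] at h1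
    omega

theorem decomposition (u : Euc (d + 1)) :
    u = M.chart (M.chartAdj u) + (lam * ⟪u, M.o⟫_ℝ) • M.o := by
  have h1 : u - (lam * ⟪u, M.o⟫_ℝ) • M.o ∈ LinearMap.range M.chart.toLinearMap := by
    rw [M.range_chart hlam, Submodule.mem_orthogonal_singleton_iff_inner_right, inner_sub_right,
      inner_smul_right, M.inner_o_o hlam, real_inner_comm]
    field_simp
    simp
  obtain ⟨y, hy⟩ := h1
  have h2 : M.chart y = u - (lam * ⟪u, M.o⟫_ℝ) • M.o := hy
  have h3 : M.chartAdj u = y := by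
    rw [← M.chartAdj_chart y, h2, map_sub, map_smul, M.chartAdj_o, smul_zero, sub_zero]
  rw [h3, h2]
  simp

theorem gnomonic_eq {u : Euc (d + 1)} (hu : ⟪u, M.o⟫_ℝ ≠ 0) :
    gnomonic lam M.o u = M.chart (M.proj u) := by
  have h1 : M.chart (M.chartAdj u) = u - (lam * ⟪u, M.o⟫_ℝ) • M.o :=
    eq_sub_of_add_eq (M.decomposition hlam u).symm
  rw [proj, map_smul, h1, gnomonic, smul_sub, smul_smul, inv_mul_cancel₀ (by positivity), one_smul]

theorem sqrt_pos (x : Euc d) : 0 < √(1 + lam * ‖x‖ ^ 2) := Real.sqrt_pos.2 (by positivity)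

theorem inner_param_o (x : Euc d) :
    ⟪M.param x, M.o⟫_ℝ = (√(1 + lam * ‖x‖ ^ 2))⁻¹ * lam⁻¹ := by
  rw [param, inner_smul_left, inner_add_left, M.chart_orth, M.inner_o_o hlam]
  simp

theorem inner_param_o_pos (x : Euc d) : 0 < ⟪M.param x, M.o⟫_ℝ := by
  rw [M.inner_param_o hlam]
  have := sqrt_pos hlam x
  positivity

theorem inner_param_param (x y : Euc d) : ⟪M.param x, M.param y⟫_ℝ =
    (√(1 + lam * ‖x‖ ^ 2))⁻¹ * (√(1 + lam * ‖y‖ ^ 2))⁻¹ * (⟪x, y⟫_ℝ + lam⁻¹) := by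
  rw [param, param, inner_smul_left, inner_smul_right, inner_add_left, inner_add_right,
    inner_add_right, M.chart_orth, M.inner_o_chart, M.inner_o_o hlam, LinearIsometry.inner_map_map]
  simp
  ring

theorem param_mem_sphere (x : Euc d) : M.param x ∈ sphereLam d lam := by
  rw [mem_sphereLam_iff hlam, M.inner_param_param hlam, ← mul_inv, Real.mul_self_sqrt
    (by positivity), real_inner_self_eq_norm_sq]
  have : 0 < 1 + lam * ‖x‖ ^ 2 := by positivity
  field_simp
  ring

theorem proj_param (x : Euc d) : M.proj (M.param x) = x := by
  have := sqrt_pos hlam x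
  rw [proj, M.inner_param_o hlam, param, map_smul, map_add, M.chartAdj_chart, M.chartAdj_o,
    add_zero, smul_smul]
  have h : (lam * ((√(1 + lam * ‖x‖ ^ 2))⁻¹ * lam⁻¹))⁻¹ * (√(1 + lam * ‖x‖ ^ 2))⁻¹ = 1 := by
    field_simp
  rw [h, one_smul]

theorem param_proj {u : Euc (d + 1)} (hu : u ∈ sphereLam d lam) (ho : 0 < ⟪u, M.o⟫_ℝ) :
    M.param (M.proj u) = u := by
  have hs := (mem_sphereLam_iff hlam).1 hu
  have hdec := M.decomposition hlam u
  have hk : 0 < lam * ⟪u, M.o⟫_ℝ := by positivity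
  have h1 : M.chart (M.proj u) + M.o = (lam * ⟪u, M.o⟫_ℝ)⁻¹ • u := by
    rw [← M.gnomonic_eq hlam ho.ne', gnomonic, sub_add_cancel]
  have h2 : 1 + lam * ‖M.proj u‖ ^ 2 = ((lam * ⟪u, M.o⟫_ℝ)⁻¹) ^ 2 := by
    have h3 : ⟪M.chart (M.proj u) + M.o, M.chart (M.proj u) + M.o⟫_ℝ = ‖M.proj u‖ ^ 2 + lam⁻¹ := by
      rw [inner_add_left, inner_add_right, inner_add_right, M.chart_orth, M.inner_o_chart,
        M.inner_o_o hlam, LinearIsometry.inner_map_map, real_inner_self_eq_norm_sq]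
      ring
    rw [h1, inner_smul_left, inner_smul_right, hs, RCLike.conj_to_real] at h3
    have h4 : ‖M.proj u‖ ^ 2 = (lam * ⟪u, M.o⟫_ℝ)⁻¹ * ((lam * ⟪u, M.o⟫_ℝ)⁻¹ * lam⁻¹) - lam⁻¹ := by
      linarith
    rw [h4]
    field_simp
    ring
  rw [param, h1, h2, Real.sqrt_sq (by positivity), inv_inv, smul_smul, mul_inv_cancel₀ hk.ne',
    one_smul]

theorem continuous_param : Continuous M.param := by
  have h1 : Continuous fun x : Euc d => √(1 + lam * ‖x‖ ^ 2) := by fun_prop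
  exact (h1.inv₀ fun x => (sqrt_pos hlam x).ne').smul
    (M.chart.continuous.add continuous_const)

theorem injective_param : Function.Injective M.param := fun x y h => by
  rw [← M.proj_param hlam x, h, M.proj_param hlam]

theorem continuousAt_proj {u : Euc (d + 1)} (hu : ⟪u, M.o⟫_ℝ ≠ 0) : ContinuousAt M.proj u := by
  have h1 : ContinuousAt (fun u : Euc (d + 1) => lam * ⟪u, M.o⟫_ℝ) u := by fun_prop
  exact (h1.inv₀ (mul_ne_zero hlam.ne' hu)).smul M.chartAdj.continuous.continuousAt

theorem lift_eq_image (L : Set (Euc d)) : M.lift L = M.param '' L := by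
  ext u
  constructor
  · rintro ⟨hu, ho, x, hx, hg⟩
    rw [M.gnomonic_eq hlam ho.ne'] at hg
    refine ⟨x, hx, ?_⟩
    rw [← M.chart.injective hg, M.param_proj hlam hu ho]
  · rintro ⟨x, hx, rfl⟩
    refine ⟨M.param_mem_sphere hlam x, M.inner_param_o_pos hlam x, x, hx, ?_⟩
    rw [M.gnomonic_eq hlam (M.inner_param_o_pos hlam x).ne', M.proj_param hlam]

theorem bdLam_lift {L : Set (Euc d)} (hL : IsCompact L) :
    bdLam lam (M.lift L) = M.param '' frontier L := by
  have hcl : IsClosed (M.param '' L) := (hL.image (M.continuous_param hlam)).isClosed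
  rw [bdLam, M.lift_eq_image hlam, hcl.closure_eq]
  ext u
  constructor
  · rintro ⟨⟨x, hx, rfl⟩, hu⟩
    refine ⟨x, ⟨subset_closure hx, fun hxi => ?_⟩, rfl⟩
    have ho := M.inner_param_o_pos hlam x
    have h1 : ∀ᶠ w in 𝓝 (M.param x), 0 < ⟪w, M.o⟫_ℝ := by
      have : Continuous fun w : Euc (d + 1) => ⟪w, M.o⟫_ℝ := by fun_prop
      exact this.continuousAt.eventually_const_lt ho
    have h2 : ∀ᶠ w in 𝓝 (M.param x), M.proj w ∈ interior L := by
      refine (M.continuousAt_proj hlam ho.ne').eventually_mem ?_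
      rw [M.proj_param hlam]
      exact isOpen_interior.mem_nhds hxi
    obtain ⟨w, ⟨hw1, hw2⟩, hws, hwn⟩ := mem_closure_iff_nhds.1 hu _ (h1.and h2)
    exact hwn ⟨M.proj w, interior_subset hw2, M.param_proj hlam hws hw1⟩
  · rintro ⟨x, hx, rfl⟩
    refine ⟨⟨x, hL.isClosed.frontier_subset hx, rfl⟩, ?_⟩
    rw [frontier_eq_closure_inter_closure] at hx
    refine closure_mono ?_
      (image_closure_subset_closure_image (M.continuous_param hlam) ⟨x, hx.2, rfl⟩)
    rintro _ ⟨y, hy, rfl⟩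
    refine ⟨M.param_mem_sphere hlam y, ?_⟩
    rintro ⟨z, hz, hzy⟩
    rw [M.injective_param hlam hzy] at hz
    exact hy hz

/-! #### Normals -/

/-- Heights over the tangent hyperplane change only by two positive factors, one depending on `y`
and one on the hyperplane. Both the correspondence of normals and the change of curvature rest on
this identity. -/
theorem inner_param_liftNormal (x y v : Euc d) : ⟪M.param y, M.liftNormal x v⟫_ℝ =
    (√(1 + lam * ‖y‖ ^ 2))⁻¹ * (√(1 + lam * ⟪x, v⟫_ℝ ^ 2))⁻¹ * (⟪y, v⟫_ℝ - ⟪x, v⟫_ℝ) := by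
  rw [param, liftNormal, inner_smul_left, inner_smul_right, inner_add_left, inner_sub_right,
    inner_sub_right, inner_smul_right, inner_smul_right, M.chart_orth, M.inner_o_chart,
    M.inner_o_o hlam, LinearIsometry.inner_map_map]
  simp
  field_simp
  ring

theorem norm_liftNormal {x v : Euc d} (hv : ‖v‖ = 1) : ‖M.liftNormal x v‖ = 1 := by
  have h1 : ⟪M.chart v - (lam * ⟪x, v⟫_ℝ) • M.o, M.chart v - (lam * ⟪x, v⟫_ℝ) • M.o⟫_ℝ =
      1 + lam * ⟪x, v⟫_ℝ ^ 2 := by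
    rw [inner_sub_left, inner_sub_right, inner_sub_right, inner_smul_left, inner_smul_right,
      inner_smul_left, inner_smul_right, M.chart_orth, M.inner_o_chart, M.inner_o_o hlam,
      LinearIsometry.inner_map_map, real_inner_self_eq_norm_sq, hv]
    simp
    field_simp
  rw [liftNormal, norm_smul, norm_eq_sqrt_real_inner (M.chart v - _), h1, norm_inv,
    Real.norm_of_nonneg (Real.sqrt_nonneg _)]
  exact inv_mul_cancel₀ (Real.sqrt_pos.2 (by positivity)).ne'

theorem outerNormals_lift (L : Set (Euc d)) (x : Euc d) :
    outerNormals (ℝ ∙ M.param x)ᗮ (M.lift L) (M.param x) =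
      M.liftNormal x '' outerNormals ⊤ L x := by
  have hpos : ∀ v : Euc d, 0 < √(1 + lam * ⟪x, v⟫_ℝ ^ 2) := fun v =>
    Real.sqrt_pos.2 (by positivity)
  rw [M.lift_eq_image hlam]
  ext w
  constructor
  · rintro ⟨hw1, hw2, hw3⟩
    rw [Submodule.mem_orthogonal_singleton_iff_inner_right] at hw1
    -- Split `w` into its chart component `p` and its component `β` along `o`. Tangency at `M.param
    -- x` forces `β = -λ⟪x, p⟫`, and unit length then excludes `p = 0`.
    set p := M.chartAdj w with hp
    set β := lam * ⟪w, M.o⟫_ℝ with hβ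
    have hdec : w = M.chart p + β • M.o := M.decomposition hlam w
    have hin : ∀ y, ⟪M.param y, w⟫_ℝ = (√(1 + lam * ‖y‖ ^ 2))⁻¹ * (⟪y, p⟫_ℝ + β * lam⁻¹) := by
      intro y
      rw [hdec, param, inner_smul_left, inner_add_left, inner_add_right, inner_add_right,
        inner_smul_right, inner_smul_right, M.chart_orth, M.inner_o_chart, M.inner_o_o hlam,
        LinearIsometry.inner_map_map]
      simp
    have hβx : β = -(lam * ⟪x, p⟫_ℝ) := by
      rw [hin] at hw1
      have h1 := (mul_eq_zero.1 hw1).resolve_left (inv_pos.2 (sqrt_pos hlam x)).ne'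
      field_simp at h1
      linarith
    have hns : ‖p‖ ^ 2 + β ^ 2 * lam⁻¹ = 1 := by
      have h1 : ⟪w, w⟫_ℝ = 1 := by rw [real_inner_self_eq_norm_sq, hw2, one_pow]
      rw [hdec, inner_add_left, inner_add_right, inner_add_right, inner_smul_left,
        inner_smul_right, inner_smul_left, inner_smul_right, M.chart_orth, M.inner_o_chart,
        M.inner_o_o hlam, LinearIsometry.inner_map_map, real_inner_self_eq_norm_sq] at h1
      simp only [RCLike.conj_to_real] at h1
      linarith
    have hp0 : p ≠ 0 := by
      intro h0
      rw [hβx, h0] at hns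
      simp at hns
    have hpn : 0 < ‖p‖ := norm_pos_iff.2 hp0
    have hh : ⟪x, ‖p‖⁻¹ • p⟫_ℝ = ‖p‖⁻¹ * ⟪x, p⟫_ℝ := inner_smul_right _ _ _
    refine ⟨‖p‖⁻¹ • p, ⟨trivial, norm_smul_inv_norm hp0, fun y hy => ?_⟩, ?_⟩
    · have h1 := hw3 _ ⟨y, hy, rfl⟩
      rw [inner_sub_left, hw1, sub_zero, hin, hβx] at h1
      have h2 := (mul_nonpos_iff_pos_imp_nonpos.1 h1).1 (inv_pos.2 (sqrt_pos hlam y))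
      have h3 : -(lam * ⟪x, p⟫_ℝ) * lam⁻¹ = -⟪x, p⟫_ℝ := by field_simp
      rw [h3] at h2
      rw [inner_smul_right, inner_sub_left]
      exact mul_nonpos_of_nonneg_of_nonpos (by positivity) (by linarith)
    · have h1 : 1 + lam * (‖p‖⁻¹ * ⟪x, p⟫_ℝ) ^ 2 = ‖p‖⁻¹ ^ 2 := by
        rw [hβx] at hns
        have h2 : ‖p‖ ^ 2 + lam * ⟪x, p⟫_ℝ ^ 2 = 1 := by
          rw [← hns]; field_simp
        rw [mul_pow, inv_pow]
        field_simp
        linarith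
      rw [liftNormal, hh, h1, Real.sqrt_sq (by positivity), inv_inv, map_smul, smul_sub, smul_smul,
        smul_smul, mul_inv_cancel₀ hpn.ne', one_smul]
      conv_rhs => rw [hdec, hβx]
      have h3 : ‖p‖ * (lam * (‖p‖⁻¹ * ⟪x, p⟫_ℝ)) = lam * ⟪x, p⟫_ℝ := by field_simp
      rw [h3, neg_smul, sub_eq_add_neg]
  · rintro ⟨v, ⟨-, hv1, hv2⟩, rfl⟩
    refine ⟨?_, M.norm_liftNormal hlam hv1, ?_⟩
    · rw [Submodule.mem_orthogonal_singleton_iff_inner_right, M.inner_param_liftNormal hlam,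
        sub_self, mul_zero]
    · rintro _ ⟨y, hy, rfl⟩
      rw [inner_sub_left, M.inner_param_liftNormal hlam, M.inner_param_liftNormal hlam, sub_self,
        mul_zero, sub_zero]
      have h1 := hv2 y hy
      rw [inner_sub_left] at h1
      have := sqrt_pos hlam y
      have := hpos v
      exact mul_nonpos_of_nonneg_of_nonpos (by positivity) h1

theorem outerNormals_lift_eq_singleton {L : Set (Euc d)} {x v : Euc d}
    (h : outerNormals ⊤ L x = {v}) :
    outerNormals (ℝ ∙ M.param x)ᗮ (M.lift L) (M.param x) = {M.liftNormal x v} := by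
  rw [M.outerNormals_lift hlam, h, Set.image_singleton]

/-! #### The weight function -/

/-- The point of the great hypersphere nearest to `o` is the normalized orthogonal projection `P` of
`o`. The angle has cosine `1 / b` with `b² = 1 + λt²`, so `tan_λ² = (b² - 1) / λ = t²`. -/
theorem tanLam_distTangentLam_sq {L : Set (Euc d)} {x v : Euc d}
    (h : outerNormals ⊤ L x = {v}) :
    tanLam lam (distTangentLam lam M.o (M.lift L) (M.param x)) ^ 2 = ⟪x, v⟫_ℝ ^ 2 := by
  have hv1 : ‖v‖ = 1 := by
    have : v ∈ outerNormals ⊤ L x := by rw [h]; rfl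
    exact this.2.1
  set t := ⟪x, v⟫_ℝ with ht
  set b := √(1 + lam * t ^ 2) with hb
  set w := M.liftNormal x v with hw
  have hb0 : 0 < b := Real.sqrt_pos.2 (by positivity)
  have hb2 : b ^ 2 = 1 + lam * t ^ 2 := Real.sq_sqrt (by positivity)
  have hw1 : ⟪w, w⟫_ℝ = 1 := by
    rw [real_inner_self_eq_norm_sq, M.norm_liftNormal hlam hv1, one_pow]
  have how : ⟪M.o, w⟫_ℝ = -(b⁻¹ * t) := by
    rw [hw, liftNormal, ← ht, ← hb, inner_smul_right, inner_sub_right, inner_smul_right, M.inner_o_chart,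
      M.inner_o_o hlam]
    field_simp
    simp
  have hN : normalLam (M.lift L) (M.param x) = w :=
    IsBody.outerNormal_eq_of_singleton (M.outerNormals_lift_eq_singleton hlam h)
  have hsl : 0 < √lam := Real.sqrt_pos.2 hlam
  have hsl2 : √lam * √lam = lam := Real.mul_self_sqrt hlam.le
  have hnorm : ∀ y ∈ sphereLam d lam, ‖y‖ = 1 / √lam := fun y hy => by
    simpa [sphereLam] using hy
  have hdist : ∀ y ∈ sphereLam d lam,
      distLam lam M.o y = Real.arccos (lam * ⟪M.o, y⟫_ℝ) / √lam := fun y hy => by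
    rw [distLam, InnerProductGeometry.angle, hnorm _ M.o_mem, hnorm y hy]
    congr 2
    field_simp
    rw [sq, hsl2]
  set P := M.o + (b⁻¹ * t) • w with hP
  have hPw : ⟪P, w⟫_ℝ = 0 := by
    rw [hP, inner_add_left, inner_smul_left, how, hw1]; simp
  have hoP : ⟪M.o, P⟫_ℝ = lam⁻¹ * b⁻¹ ^ 2 := by
    rw [hP, inner_add_right, inner_smul_right, how, M.inner_o_o hlam]
    field_simp
    rw [hb2]; ring_nf
  have hPP : ⟪P, P⟫_ℝ = lam⁻¹ * b⁻¹ ^ 2 := by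
    conv_lhs => rw [hP]
    rw [← hP, inner_add_left, inner_smul_left, hoP, real_inner_comm P w, hPw]
    simp
  have hleast : IsLeast (distLam lam M.o '' tangentHyperplaneLam lam (M.lift L) (M.param x))
      (Real.arccos b⁻¹ / √lam) := by
    constructor
    · refine ⟨b • P, ⟨?_, ?_⟩, ?_⟩
      · rw [mem_sphereLam_iff hlam, inner_smul_left, inner_smul_right, hPP, RCLike.conj_to_real]
        field_simp
      · rw [hN, inner_smul_left, hPw, mul_zero]
      · rw [hdist, inner_smul_right, hoP]
        · congr 2
          field_simp
        · rw [mem_sphereLam_iff hlam, inner_smul_left, inner_smul_right, hPP, RCLike.conj_to_real]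
          field_simp
    · rintro _ ⟨y, ⟨hy, hyw⟩, rfl⟩
      rw [hN] at hyw
      rw [hdist y hy]
      refine div_le_div_of_nonneg_right (Real.arccos_le_arccos ?_) hsl.le
      have h1 : ⟪M.o, y⟫_ℝ = ⟪P, y⟫_ℝ := by
        rw [hP, inner_add_left, inner_smul_left, real_inner_comm y w, hyw]; simp
      have h2 : ‖P‖ = (√lam)⁻¹ * b⁻¹ := by
        rw [norm_eq_sqrt_real_inner, hPP, Real.sqrt_mul (by positivity), Real.sqrt_inv,
          Real.sqrt_sq (by positivity)]
      rw [h1]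
      calc lam * ⟪P, y⟫_ℝ ≤ lam * (‖P‖ * ‖y‖) := by
            gcongr; exact real_inner_le_norm _ _
        _ = b⁻¹ := by
            rw [h2, hnorm y hy]
            field_simp
            rw [sq, hsl2]
  have hD : distTangentLam lam M.o (M.lift L) (M.param x) = Real.arccos b⁻¹ / √lam :=
    hleast.csInf_eq
  have hbinv : b⁻¹ ≤ 1 := by
    refine inv_le_one_of_one_le₀ ?_
    rw [hb]
    exact Real.one_le_sqrt.2 (by nlinarith [mul_nonneg hlam.le (sq_nonneg t)])
  rw [hD, tanLam, sinLam, cosLam, mul_div_cancel₀ _ hsl.ne', Real.sin_arccos,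
    Real.cos_arccos (by linarith [inv_pos.2 hb0]) hbinv, div_pow, div_pow, Real.sq_sqrt, sq (√lam),
    hsl2]
  · field_simp
    rw [hb2]; ring
  · have : b⁻¹ ^ 2 ≤ 1 := pow_le_one₀ (by positivity) hbinv
    linarith

theorem weightLam_lift {L : Set (Euc d)} {x v : Euc d} (h : outerNormals ⊤ L x = {v}) :
    weightLam lam M.o (M.lift L) (M.param x) =
      √((lam + ⟪x, v⟫_ℝ ^ 2) / (1 + lam * ⟪x, v⟫_ℝ ^ 2)) := by
  rw [weightLam, M.tanLam_distTangentLam_sq hlam h, abs_of_nonneg (by positivity)]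

/-- The inner products give `2 (ab - 1 - λ⟪x, y⟫) / (λ ab)`, where `a` and `b` are the two square
roots. Multiplying by the conjugate `ab + 1 + λ⟪x, y⟫` cancels `1 / λ`, which makes the formula
regular at `λ = 0`. -/
theorem norm_param_sub_sq (x y : Euc d) :
    ‖M.param x - M.param y‖ ^ 2 = gnomDistSq lam x y := by
  have hx := sqrt_pos hlam x
  have hy := sqrt_pos hlam y
  have hden := two_le_gnom_denominator hlam.le x y
  rw [← real_inner_self_eq_norm_sq, inner_sub_left, inner_sub_right, inner_sub_right,
    (mem_sphereLam_iff hlam).1 (M.param_mem_sphere hlam x),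
    (mem_sphereLam_iff hlam).1 (M.param_mem_sphere hlam y), real_inner_comm (M.param x),
    M.inner_param_param hlam, gnomDistSq, norm_sub_sq_real]
  have hx2 := Real.sq_sqrt (show 0 ≤ 1 + lam * ‖x‖ ^ 2 by positivity)
  have hy2 := Real.sq_sqrt (show 0 ≤ 1 + lam * ‖y‖ ^ 2 by positivity)
  set a := √(1 + lam * ‖x‖ ^ 2)
  set b := √(1 + lam * ‖y‖ ^ 2)
  rw [eq_div_iff (by positivity)]
  field_simp
  have : (a * b) ^ 2 = (1 + lam * ‖x‖ ^ 2) * (1 + lam * ‖y‖ ^ 2) := by rw [mul_pow, hx2, hy2]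
  linear_combination 2 * this

end ProjectiveModel

theorem gnomDistSq_zero {d : ℕ} (x y : Euc d) : gnomDistSq 0 x y = ‖x - y‖ ^ 2 := by
  simp [gnomDistSq]
  ring

/-! ### Second fundamental forms under maps that preserve tangent hyperplanes -/

section Transfer

theorem Asymptotics.IsBigO.real_inner_mul {α F : Type*} [NormedAddCommGroup F]
    [InnerProductSpace ℝ F] {l : Filter α} {f g : α → F} {r s : α → ℝ} (hf : f =O[l] r)
    (hg : g =O[l] s) : (fun a => ⟪f a, g a⟫_ℝ) =O[l] fun a => r a * s a := by
  refine IsBigO.trans ?_ (hf.norm_left.mul hg.norm_left)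
  refine IsBigO.of_bound 1 (Eventually.of_forall fun a => ?_)
  rw [one_mul, norm_mul, _root_.norm_norm, _root_.norm_norm]
  exact norm_inner_le_norm _ _

theorem Asymptotics.IsLittleO.real_inner_mul {α F : Type*} [NormedAddCommGroup F]
    [InnerProductSpace ℝ F] {l : Filter α} {f g : α → F} {r s : α → ℝ} (hf : f =o[l] r)
    (hg : g =O[l] s) : (fun a => ⟪f a, g a⟫_ℝ) =o[l] fun a => r a * s a := by
  refine IsBigO.trans_isLittleO ?_ (hf.norm_left.mul_isBigO hg.norm_left)
  refine IsBigO.of_bound 1 (Eventually.of_forall fun a => ?_)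
  rw [one_mul, norm_mul, _root_.norm_norm, _root_.norm_norm]
  exact norm_inner_le_norm _ _

theorem IsSecondFundamentalForm.height_isBigO {n : ℕ} {B : Set (Euc n)}
    {T : Submodule ℝ (Euc n)} {x v : Euc n} {A : T →ₗ[ℝ] T} (hA : IsSecondFundamentalForm B T x v A) :
    (fun y : Euc n => ⟪y - x, v⟫_ℝ) =O[𝓝[B] x] fun y => ‖y - x‖ ^ 2 := by
  have h1 : (fun y : Euc n => T.orthogonalProjectionOnto (y - x)) =O[𝓝[B] x] fun y => ‖y - x‖ :=
    (T.orthogonalProjectionOnto.isBigO_comp (fun y => y - x) _).norm_right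
  have h2 : (fun y : Euc n => A (T.orthogonalProjectionOnto (y - x))) =O[𝓝[B] x]
      fun y => ‖y - x‖ :=
    ((LinearMap.toContinuousLinearMap A).isBigO_comp _ _).trans h1
  have h3 := (h2.real_inner_mul h1).const_mul_left (1 / 2)
  simp only [← pow_two] at h3
  have h4 := (hA.expansion.isBigO.add h3).neg_left
  refine h4.congr_left fun y => ?_
  ring

/-- Heights agree up to the factor `c`, and they are quadratically small. By `hperp` the normal part
of `y - x'` is then of second order, so the tangential part of `Ψ y - x` is `P` of the tangential
part of `y - x'` up to `o(‖y - x'‖)`. The quadratic expansion of `B` can therefore be pulled back.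
-/
theorem IsSecondFundamentalForm.transfer {n m : ℕ} {B : Set (Euc n)} {B' : Set (Euc m)}
    {T : Submodule ℝ (Euc n)} {T' : Submodule ℝ (Euc m)} {x v : Euc n} {x' v' : Euc m}
    {A : T →ₗ[ℝ] T} (hA : IsSecondFundamentalForm B T x v A)
    {Ψ : Euc m → Euc n} {Ψ' : Euc m →L[ℝ] Euc n} (hΨ : HasFDerivAt Ψ Ψ' x') (hx : Ψ x' = x)
    (hB : ∀ᶠ y in 𝓝[B'] x', Ψ y ∈ B) (P : T' →ₗ[ℝ] T) (hP : ∀ w : T', Ψ' w = P w)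
    {c : Euc m → ℝ} {c₀ : ℝ} (hc : Tendsto c (𝓝[B'] x') (𝓝 c₀))
    (hheight : ∀ᶠ y in 𝓝[B'] x', ⟪y - x', v'⟫_ℝ = c y * ⟪Ψ y - x, v⟫_ℝ)
    {C : ℝ} (hperp : ∀ᶠ y in 𝓝[B'] x', ‖(y - x') - (T'.orthogonalProjectionOnto (y - x') : Euc m)‖ ≤
      C * (|⟪y - x', v'⟫_ℝ| + ‖y - x'‖ ^ 2)) :
    IsSecondFundamentalForm B' T' x' v' (c₀ • (P.adjoint ∘ₗ A ∘ₗ P)) := by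
  set l := 𝓝[B'] x' with hl
  set p : Euc n →L[ℝ] T := T.orthogonalProjectionOnto with hp
  set p' : Euc m →L[ℝ] T' := T'.orthogonalProjectionOnto with hp'
  set r : Euc m → ℝ := fun y => ‖y - x'‖ with hr
  have hadj : ∀ w : T', ⟪(c₀ • (P.adjoint ∘ₗ A ∘ₗ P)) w, w⟫_ℝ = c₀ * ⟪A (P w), P w⟫_ℝ :=
    fun w => by
      rw [LinearMap.smul_apply, inner_smul_left, RCLike.conj_to_real, LinearMap.comp_apply,
        LinearMap.comp_apply, LinearMap.adjoint_inner_left]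
  constructor
  · intro w z
    simp only [LinearMap.smul_apply, LinearMap.comp_apply, inner_smul_left, inner_smul_right,
      RCLike.conj_to_real, LinearMap.adjoint_inner_left, LinearMap.adjoint_inner_right]
    rw [hA.symm]
  have htend : Tendsto Ψ l (𝓝[B] x) := by
    refine tendsto_nhdsWithin_iff.2 ⟨?_, hB⟩
    rw [← hx]
    exact hΨ.continuousAt.tendsto.mono_left nhdsWithin_le_nhds
  have hζ : (fun y => Ψ y - x) =O[l] r := by
    rw [← hx]
    exact (hΨ.isBigO_sub.mono nhdsWithin_le_nhds).norm_right
  have hζ2 : (fun y => ‖Ψ y - x‖ ^ 2) =O[l] fun y => r y ^ 2 := hζ.norm_left.pow 2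
  have hE := (hA.expansion.comp_tendsto htend).trans_isBigO hζ2
  have hv : (fun y => ⟪Ψ y - x, v⟫_ℝ) =O[l] fun y => r y ^ 2 :=
    (hA.height_isBigO.comp_tendsto htend).trans hζ2
  have hv' : (fun y => ⟪y - x', v'⟫_ℝ) =O[l] fun y => r y ^ 2 := by
    have h1 := (hc.isBigO_one ℝ).mul hv
    simp only [one_mul] at h1
    exact (EventuallyEq.trans_isBigO hheight h1)
  have hr0 : Tendsto r l (𝓝 0) := by
    have : Continuous r := by fun_prop
    have := this.tendsto x'
    simp only [hr, sub_self, norm_zero] at this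
    exact this.mono_left nhdsWithin_le_nhds
  have hr2 : (fun y => r y ^ 2) =o[l] r := by
    have h1 := ((isLittleO_one_iff ℝ).2 hr0).mul_isBigO (isBigO_refl r l)
    simpa [pow_two] using h1
  have hz : (fun y => (y - x') - (p' (y - x') : Euc m)) =o[l] r := by
    refine IsBigO.trans_isLittleO ?_ hr2
    have h1 := (hv'.norm_left.add (isBigO_refl (fun y => r y ^ 2) l)).const_mul_left C
    refine IsBigO.trans (IsBigO.of_bound 1 ?_) h1
    filter_upwards [hperp] with y hy
    rw [one_mul]
    exact hy.trans (le_abs_self _)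
  have hη : (fun y => p (Ψ y - x) - P (p' (y - x'))) =o[l] r := by
    have h1 : (fun y => Ψ y - x - Ψ' (y - x')) =o[l] r := by
      rw [← hx]
      exact (hΨ.isLittleO.mono nhdsWithin_le_nhds).norm_right
    have h2 : (fun y => Ψ' ((y - x') - (p' (y - x') : Euc m))) =o[l] r :=
      (Ψ'.isBigO_comp _ _).trans_isLittleO hz
    have h3 := (p.isBigO_comp _ _).trans_isLittleO (h1.add h2)
    refine h3.congr_left fun y => ?_
    have h4 : p (Ψ' (p' (y - x'))) = P (p' (y - x')) := by
      rw [hP]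
      exact Submodule.orthogonalProjectionOnto_mem_subspace_eq_self _
    rw [← h4, ← map_sub, map_sub Ψ' (y - x') (p' (y - x') : Euc m)]
    congr 1
    abel
  have hpζ : (fun y => p (Ψ y - x)) =O[l] r := (p.isBigO_comp _ _).trans hζ
  have hp'z : (fun y => p' (y - x')) =O[l] r := (p'.isBigO_comp (fun y => y - x') l).norm_right
  have hPz : (fun y => P (p' (y - x'))) =O[l] r :=
    ((LinearMap.toContinuousLinearMap P).isBigO_comp _ _).trans hp'z
  have hA1 : ∀ {f : Euc m → T}, f =O[l] r → (fun y => A (f y)) =O[l] r := fun hf =>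
    ((LinearMap.toContinuousLinearMap A).isBigO_comp _ _).trans hf
  have hA2 : (fun y => A (p (Ψ y - x) - P (p' (y - x')))) =o[l] r :=
    ((LinearMap.toContinuousLinearMap A).isBigO_comp _ _).trans_isLittleO hη
  have hq : (fun y => ⟪A (p (Ψ y - x)), p (Ψ y - x)⟫_ℝ) =O[l] fun y => r y ^ 2 := by
    simpa only [pow_two] using (hA1 hpζ).real_inner_mul hpζ
  have hd : (fun y => ⟪A (p (Ψ y - x)), p (Ψ y - x)⟫_ℝ -
      ⟪A (P (p' (y - x'))), P (p' (y - x'))⟫_ℝ) =o[l] fun y => r y ^ 2 := by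
    have h1 := hA2.real_inner_mul hpζ
    have h2 := hη.real_inner_mul (hA1 hPz)
    have h3 := h1.add h2
    simp only [← pow_two] at h3
    refine h3.congr_left fun y => ?_
    rw [real_inner_comm (A _), map_sub, inner_sub_left, inner_sub_right]
    ring
  have hcc : (fun y => c y - c₀) =o[l] fun _ => (1 : ℝ) :=
    (isLittleO_one_iff ℝ).2 (by simpa using hc.sub_const c₀)
  -- Three errors: the expansion of `B` itself, the variation of `c`, and the replacement of the
  -- tangential displacement by its image under `P`.
  have t1 : (fun y => c y * (-⟪Ψ y - x, v⟫_ℝ - 1 / 2 * ⟪A (p (Ψ y - x)), p (Ψ y - x)⟫_ℝ)) =o[l]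
      fun y => r y ^ 2 := by
    have h1 := (hc.isBigO_one ℝ).mul_isLittleO hE
    simp only [one_mul] at h1
    exact h1
  have t2 : (fun y => 1 / 2 * ((c y - c₀) * ⟪A (p (Ψ y - x)), p (Ψ y - x)⟫_ℝ)) =o[l]
      fun y => r y ^ 2 := by
    simpa using (hcc.mul_isBigO hq).const_mul_left (1 / 2)
  have t3 := hd.const_mul_left (1 / 2 * c₀)
  refine ((t1.add t2).add t3).congr' ?_ EventuallyEq.rfl
  filter_upwards [hheight] with y hy
  rw [hadj, hy]
  ring

/-- `P` joins two different spaces and has no determinant of its own; the product is regrouped as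
`(P* P) ∘ (P⁻¹ A P)`. -/
theorem LinearMap.det_adjoint_comp_comp {E F : Type*} [NormedAddCommGroup E]
    [InnerProductSpace ℝ E] [FiniteDimensional ℝ E] [NormedAddCommGroup F] [InnerProductSpace ℝ F]
    [FiniteDimensional ℝ F] (P : E ≃ₗ[ℝ] F) (A : F →ₗ[ℝ] F) :
    LinearMap.det (LinearMap.adjoint (P : E →ₗ[ℝ] F) ∘ₗ A ∘ₗ (P : E →ₗ[ℝ] F)) =
      LinearMap.det (LinearMap.adjoint (P : E →ₗ[ℝ] F) ∘ₗ (P : E →ₗ[ℝ] F)) * LinearMap.det A := by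
  have h1 : LinearMap.adjoint (P : E →ₗ[ℝ] F) ∘ₗ A ∘ₗ (P : E →ₗ[ℝ] F) =
      (LinearMap.adjoint (P : E →ₗ[ℝ] F) ∘ₗ (P : E →ₗ[ℝ] F)) ∘ₗ
        ((P.symm : F →ₗ[ℝ] E) ∘ₗ A ∘ₗ (P.symm.symm : E →ₗ[ℝ] F)) := by
    ext z
    simp
  rw [h1, LinearMap.det_comp, LinearMap.det_conj A P.symm]

theorem LinearMap.det_adjoint_comp_self_mul_symm {E F : Type*} [NormedAddCommGroup E]
    [InnerProductSpace ℝ E] [FiniteDimensional ℝ E] [NormedAddCommGroup F] [InnerProductSpace ℝ F]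
    [FiniteDimensional ℝ F] (P : E ≃ₗ[ℝ] F) :
    LinearMap.det (LinearMap.adjoint (P.symm : F →ₗ[ℝ] E) ∘ₗ (P.symm : F →ₗ[ℝ] E)) *
      LinearMap.det (LinearMap.adjoint (P : E →ₗ[ℝ] F) ∘ₗ (P : E →ₗ[ℝ] F)) = 1 := by
  have h2 : LinearMap.adjoint (P.symm : F →ₗ[ℝ] E) ∘ₗ
      (LinearMap.adjoint (P : E →ₗ[ℝ] F) ∘ₗ (P : E →ₗ[ℝ] F)) ∘ₗ (P.symm : F →ₗ[ℝ] E) =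
      LinearMap.id := by
    rw [LinearMap.comp_assoc, LinearEquiv.comp_symm, LinearMap.comp_id, ← LinearMap.adjoint_comp,
      LinearEquiv.comp_symm, LinearMap.adjoint_id]
  have h3 := LinearMap.det_adjoint_comp_comp P.symm
    (LinearMap.adjoint (P : E →ₗ[ℝ] F) ∘ₗ (P : E →ₗ[ℝ] F))
  rw [h2, LinearMap.det_id] at h3
  exact h3.symm

/-! ### Bounds for the components of a displacement normal to a hypersurface. -/

theorem norm_sub_orthogonalProjectionOnto_le {n : ℕ} (T : Submodule ℝ (Euc n)) (z t : Euc n)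
    (ht : t ∈ T) : ‖z - (T.orthogonalProjectionOnto z : Euc n)‖ ≤ ‖z - t‖ := by
  rw [← Submodule.starProjection_apply, Submodule.starProjection_minimal]
  exact ciInf_le ⟨0, by rintro _ ⟨y, rfl⟩; positivity⟩ (⟨t, ht⟩ : T)

theorem perp_bound_of_top {n : ℕ} {v : Euc n} (hv : ‖v‖ = 1) (z : Euc n) :
    ‖z - ((⊤ ⊓ (ℝ ∙ v)ᗮ : Submodule ℝ (Euc n)).orthogonalProjectionOnto z : Euc n)‖ ≤
      1 * (|⟪z, v⟫_ℝ| + ‖z‖ ^ 2) := by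
  refine (norm_sub_orthogonalProjectionOnto_le _ z (z - ⟪z, v⟫_ℝ • v) ?_).trans ?_
  · refine ⟨trivial, ?_⟩
    rw [SetLike.mem_coe, Submodule.mem_orthogonal_singleton_iff_inner_left, inner_sub_left,
      inner_smul_left, real_inner_self_eq_norm_sq, hv]
    simp
  · rw [sub_sub_cancel, norm_smul, hv, mul_one, one_mul, Real.norm_eq_abs]
    have := sq_nonneg ‖z‖
    linarith

/-- For two points of one sphere `⟪y - u, u⟫ = -‖y - u‖² / 2`, so the radial component is of second
order. -/
theorem perp_bound_of_sphere {n : ℕ} {u v y : Euc n} (hv : ‖v‖ = 1) (hu : u ≠ 0)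
    (huv : ⟪u, v⟫_ℝ = 0) (hy : ‖y‖ = ‖u‖) :
    ‖(y - u) - (((ℝ ∙ u)ᗮ ⊓ (ℝ ∙ v)ᗮ : Submodule ℝ (Euc n)).orthogonalProjectionOnto
      (y - u) : Euc n)‖ ≤ (1 + ‖u‖⁻¹) * (|⟪y - u, v⟫_ℝ| + ‖y - u‖ ^ 2) := by
  have hu0 : 0 < ‖u‖ := norm_pos_iff.2 hu
  set z := y - u with hz
  have huz : ⟪z, u⟫_ℝ = -(‖z‖ ^ 2 / 2) := by
    have h1 : ‖z‖ ^ 2 = ‖y‖ ^ 2 - 2 * ⟪y, u⟫_ℝ + ‖u‖ ^ 2 := norm_sub_sq_real y u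
    rw [hz, inner_sub_left, real_inner_self_eq_norm_sq, ← hz]
    rw [hy] at h1
    linarith
  refine (norm_sub_orthogonalProjectionOnto_le _ z
    (z - (⟪z, v⟫_ℝ • v + ((‖u‖ ^ 2)⁻¹ * ⟪z, u⟫_ℝ) • u)) ?_).trans ?_
  · constructor
    · rw [SetLike.mem_coe, Submodule.mem_orthogonal_singleton_iff_inner_left, inner_sub_left,
        inner_add_left, inner_smul_left, inner_smul_left, real_inner_self_eq_norm_sq,
        real_inner_comm u v, huv]
      simp only [RCLike.conj_to_real]
      field_simp
      simp
    · rw [SetLike.mem_coe, Submodule.mem_orthogonal_singleton_iff_inner_left, inner_sub_left,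
        inner_add_left, inner_smul_left, inner_smul_left, real_inner_self_eq_norm_sq, huv, hv]
      simp
  · rw [sub_sub_cancel]
    refine (norm_add_le _ _).trans ?_
    rw [norm_smul, norm_smul, hv, mul_one, Real.norm_eq_abs, Real.norm_eq_abs, huz, abs_mul,
      abs_neg, abs_of_nonneg (a := (‖u‖ ^ 2)⁻¹) (by positivity),
      abs_of_nonneg (a := ‖z‖ ^ 2 / 2) (by positivity)]
    have e : (‖u‖ ^ 2)⁻¹ * (‖z‖ ^ 2 / 2) * ‖u‖ = ‖u‖⁻¹ * ‖z‖ ^ 2 / 2 := by field_simp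
    rw [e]
    have h1 : 0 ≤ ‖u‖⁻¹ * |⟪z, v⟫_ℝ| := by positivity
    have h2 : 0 ≤ ‖u‖⁻¹ * ‖z‖ ^ 2 := by positivity
    have h3 : 0 ≤ ‖z‖ ^ 2 := by positivity
    linarith

end Transfer

/-! ### The differential of the inverse gnomonic projection -/

namespace ProjectiveModel

variable {d : ℕ} {lam : ℝ} (M : ProjectiveModel d lam)

/-- The differential of `param` at `x`. -/
noncomputable def dparam (x : Euc d) : Euc d →L[ℝ] Euc (d + 1) :=
  (√(1 + lam * ‖x‖ ^ 2))⁻¹ • M.chart.toContinuousLinearMap -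
    (innerSL ℝ x).smulRight ((lam * (√(1 + lam * ‖x‖ ^ 2))⁻¹ ^ 3) • (M.chart x + M.o))

theorem dparam_apply (x w : Euc d) : M.dparam x w = (√(1 + lam * ‖x‖ ^ 2))⁻¹ • M.chart w -
    (⟪x, w⟫_ℝ * (lam * (√(1 + lam * ‖x‖ ^ 2))⁻¹ ^ 3)) • (M.chart x + M.o) := by
  simp [dparam, smul_smul]

theorem finrank_tangent (hd : 1 ≤ d) {v : Euc d} (hv : ‖v‖ = 1) :
    Module.finrank ℝ (⊤ ⊓ (ℝ ∙ v)ᗮ : Submodule ℝ (Euc d)) = d - 1 := by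
  have hv0 : v ≠ 0 := fun h => by simp [h] at hv
  have h1 := Submodule.finrank_add_finrank_orthogonal (ℝ ∙ v)
  rw [finrank_span_singleton hv0, finrank_euclideanSpace_fin] at h1
  rw [top_inf_eq]
  omega

variable (hlam : 0 < lam)

include hlam

theorem hasFDerivAt_param (x : Euc d) : HasFDerivAt M.param (M.dparam x) x := by
  have hs := sqrt_pos hlam x
  have hpos : 0 < 1 + lam * ‖x‖ ^ 2 := by positivity
  have h1 : HasFDerivAt (fun y : Euc d => 1 + lam * ‖y‖ ^ 2) (lam • (2 • innerSL ℝ x)) x :=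
    ((hasStrictFDerivAt_norm_sq x).hasFDerivAt.const_mul lam).const_add 1
  have h2 := (hasDerivAt_inv hs.ne').comp_hasFDerivAt x (h1.sqrt hpos.ne')
  have h3 : HasFDerivAt (fun y : Euc d => M.chart y + M.o) M.chart.toContinuousLinearMap x :=
    M.chart.toContinuousLinearMap.hasFDerivAt.add_const _
  refine (h2.smul h3).congr_fderiv ?_
  ext1 w
  rw [dparam_apply]
  simp only [add_apply, smul_apply,
    ContinuousLinearMap.smulRight_apply, innerSL_apply_apply, nsmul_eq_mul, smul_eq_mul,
    Function.comp, LinearIsometry.coe_toContinuousLinearMap]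
  rw [sub_eq_add_neg, ← neg_smul]
  congr 2
  push_cast
  field_simp

theorem inner_dparam (x w z : Euc d) : ⟪M.dparam x w, M.dparam x z⟫_ℝ =
    (√(1 + lam * ‖x‖ ^ 2))⁻¹ ^ 2 * (⟪w, z⟫_ℝ -
      lam * (√(1 + lam * ‖x‖ ^ 2))⁻¹ ^ 2 * (⟪x, w⟫_ℝ * ⟪x, z⟫_ℝ)) := by
  have hs := sqrt_pos hlam x
  have hs2 := Real.sq_sqrt (show 0 ≤ 1 + lam * ‖x‖ ^ 2 by positivity)
  rw [dparam_apply, dparam_apply]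
  simp only [inner_sub_left, inner_sub_right, inner_add_left, inner_add_right, inner_smul_left,
    inner_smul_right, M.chart_orth, M.inner_o_chart, M.inner_o_o hlam,
    LinearIsometry.inner_map_map, RCLike.conj_to_real, real_inner_self_eq_norm_sq,
    real_inner_comm x w]
  set s := √(1 + lam * ‖x‖ ^ 2)
  have hx : ‖x‖ ^ 2 = (s ^ 2 - 1) / lam := by rw [hs2]; field_simp; ring
  rw [hx]
  field_simp
  ring

theorem inner_param_dparam (x w : Euc d) : ⟪M.param x, M.dparam x w⟫_ℝ = 0 := by
  have hs := sqrt_pos hlam x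
  have hs2 := Real.sq_sqrt (show 0 ≤ 1 + lam * ‖x‖ ^ 2 by positivity)
  rw [dparam_apply, param]
  simp only [inner_sub_right, inner_add_left, inner_add_right, inner_smul_left,
    inner_smul_right, M.chart_orth, M.inner_o_chart, M.inner_o_o hlam,
    LinearIsometry.inner_map_map, RCLike.conj_to_real, real_inner_self_eq_norm_sq]
  set s := √(1 + lam * ‖x‖ ^ 2)
  have hx : ‖x‖ ^ 2 = (s ^ 2 - 1) / lam := by rw [hs2]; field_simp; ring
  rw [hx]
  field_simp
  ring

theorem inner_dparam_liftNormal (x w v : Euc d) : ⟪M.dparam x w, M.liftNormal x v⟫_ℝ =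
    (√(1 + lam * ‖x‖ ^ 2))⁻¹ * (√(1 + lam * ⟪x, v⟫_ℝ ^ 2))⁻¹ * ⟪w, v⟫_ℝ := by
  rw [dparam_apply, liftNormal]
  simp only [inner_sub_left, inner_sub_right, inner_add_left, inner_smul_left,
    inner_smul_right, M.chart_orth, M.inner_o_chart, M.inner_o_o hlam,
    LinearIsometry.inner_map_map, RCLike.conj_to_real]
  field_simp
  ring

theorem differentiableAt_proj {u : Euc (d + 1)} (hu : ⟪u, M.o⟫_ℝ ≠ 0) :
    DifferentiableAt ℝ M.proj u := by
  have h1 : DifferentiableAt ℝ (fun u : Euc (d + 1) => lam * ⟪u, M.o⟫_ℝ) u :=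
    (differentiableAt_id.inner ℝ (differentiableAt_const _)).const_mul lam
  exact (h1.inv (mul_ne_zero hlam.ne' hu)).smul M.chartAdj.differentiableAt

theorem fderiv_proj_dparam (x w : Euc d) :
    fderiv ℝ M.proj (M.param x) (M.dparam x w) = w := by
  have h1 := (M.differentiableAt_proj hlam (M.inner_param_o_pos hlam x).ne').hasFDerivAt.comp x
    (M.hasFDerivAt_param hlam x)
  have h2 : M.proj ∘ M.param = id := funext fun y => M.proj_param hlam y
  rw [h2] at h1
  have h3 := h1.unique (hasFDerivAt_id x)
  have := congrArg (fun f : Euc d →L[ℝ] Euc d => f w) h3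
  simpa using this

theorem finrank_tangent_lift (hd : 1 ≤ d) {x v : Euc d} (hv : ‖v‖ = 1) :
    Module.finrank ℝ ((ℝ ∙ M.param x)ᗮ ⊓ (ℝ ∙ M.liftNormal x v)ᗮ : Submodule ℝ (Euc (d + 1))) =
      d - 1 := by
  have hn := M.norm_liftNormal hlam (x := x) hv
  have hn0 : M.liftNormal x v ≠ 0 := fun h => by simp [h] at hn
  have hu0 : M.param x ≠ 0 := fun h => by
    have := M.inner_param_o_pos hlam x
    simp [h] at this
  have horth : ⟪M.param x, M.liftNormal x v⟫_ℝ = 0 := by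
    rw [M.inner_param_liftNormal hlam, sub_self, mul_zero]
  have h1 := Submodule.finrank_sup_add_finrank_inf_eq (ℝ ∙ M.param x) (ℝ ∙ M.liftNormal x v)
  have h2 : (ℝ ∙ M.param x) ⊓ (ℝ ∙ M.liftNormal x v) = ⊥ := by
    refine disjoint_iff.1 (Submodule.IsOrtho.disjoint ?_)
    rw [Submodule.isOrtho_span]
    intro a ha b hb
    rw [Set.mem_singleton_iff.1 ha, Set.mem_singleton_iff.1 hb]
    exact horth
  rw [h2, finrank_bot, finrank_span_singleton hu0, finrank_span_singleton hn0] at h1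
  rw [Submodule.inf_orthogonal]
  have h3 := Submodule.finrank_add_finrank_orthogonal ((ℝ ∙ M.param x) ⊔ (ℝ ∙ M.liftNormal x v))
  rw [finrank_euclideanSpace_fin] at h3
  omega

/-- The differential of `param` is inverted by that of `proj`, hence injective, and both tangent
spaces have dimension `d - 1`. -/
theorem exists_tangent_equiv (hd : 1 ≤ d) {x v : Euc d} (hv : ‖v‖ = 1) :
    ∃ P : (⊤ ⊓ (ℝ ∙ v)ᗮ : Submodule ℝ (Euc d)) ≃ₗ[ℝ]
        ((ℝ ∙ M.param x)ᗮ ⊓ (ℝ ∙ M.liftNormal x v)ᗮ : Submodule ℝ (Euc (d + 1))),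
      (∀ w : (⊤ ⊓ (ℝ ∙ v)ᗮ : Submodule ℝ (Euc d)), M.dparam x w = P w) ∧
      ∀ w : ((ℝ ∙ M.param x)ᗮ ⊓ (ℝ ∙ M.liftNormal x v)ᗮ : Submodule ℝ (Euc (d + 1))),
        fderiv ℝ M.proj (M.param x) w = P.symm w := by
  set T : Submodule ℝ (Euc d) := ⊤ ⊓ (ℝ ∙ v)ᗮ with hT
  set T' : Submodule ℝ (Euc (d + 1)) := (ℝ ∙ M.param x)ᗮ ⊓ (ℝ ∙ M.liftNormal x v)ᗮ with hT'
  have hmem : ∀ w : T, ((M.dparam x).toLinearMap.domRestrict T) w ∈ T' := fun w => by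
    have hw : ⟪(w : Euc d), v⟫_ℝ = 0 :=
      Submodule.mem_orthogonal_singleton_iff_inner_left.1 w.2.2
    constructor
    · rw [SetLike.mem_coe, Submodule.mem_orthogonal_singleton_iff_inner_right]
      exact M.inner_param_dparam hlam x w
    · rw [SetLike.mem_coe, Submodule.mem_orthogonal_singleton_iff_inner_left]
      change ⟪M.dparam x w, M.liftNormal x v⟫_ℝ = 0
      rw [M.inner_dparam_liftNormal hlam, hw, mul_zero]
  set f : T →ₗ[ℝ] T' := ((M.dparam x).toLinearMap.domRestrict T).codRestrict T' hmem with hf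
  have hfa : ∀ w : T, (f w : Euc (d + 1)) = M.dparam x w := fun w => rfl
  have hinj : Function.Injective f := fun w z h => by
    have h1 : M.dparam x w = M.dparam x z := by rw [← hfa, h, hfa]
    have h2 := congrArg (fderiv ℝ M.proj (M.param x)) h1
    rw [M.fderiv_proj_dparam hlam, M.fderiv_proj_dparam hlam] at h2
    exact Subtype.ext h2
  have hfin : Module.finrank ℝ T = Module.finrank ℝ T' := by
    rw [hT, hT', finrank_tangent hd hv, M.finrank_tangent_lift hlam hd hv]
  refine ⟨LinearMap.linearEquivOfInjective f hinj hfin, fun w => (hfa w).symm, fun w => ?_⟩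
  obtain ⟨z, rfl⟩ := (LinearMap.linearEquivOfInjective f hinj hfin).surjective w
  rw [LinearEquiv.symm_apply_apply]
  change fderiv ℝ M.proj (M.param x) (M.dparam x z) = z
  rw [M.fderiv_proj_dparam hlam]

/-- On the tangent space the pulled-back metric is `t² (1 - λt² ξ ⊗ ξ)`, with `ξ` the tangential
part of `x`. The rank-one perturbation has determinant `1 - λt²‖ξ‖² = t² (1 + λ⟪x, v⟫²)`. -/
theorem det_tangent_equiv (hd : 1 ≤ d) {x v : Euc d} (hv : ‖v‖ = 1)
    {T : Submodule ℝ (Euc d)} (hT : T = ⊤ ⊓ (ℝ ∙ v)ᗮ) (P : T ≃ₗ[ℝ]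
        ((ℝ ∙ M.param x)ᗮ ⊓ (ℝ ∙ M.liftNormal x v)ᗮ : Submodule ℝ (Euc (d + 1))))
    (hP : ∀ w : T, M.dparam x w = P w) :
    LinearMap.det (LinearMap.adjoint P.toLinearMap ∘ₗ P.toLinearMap) =
      ((√(1 + lam * ‖x‖ ^ 2))⁻¹ ^ 2) ^ (d - 1) *
        ((√(1 + lam * ‖x‖ ^ 2))⁻¹ ^ 2 * √(1 + lam * ⟪x, v⟫_ℝ ^ 2) ^ 2) := by
  have hs := sqrt_pos hlam x
  have hs2 := Real.sq_sqrt (show 0 ≤ 1 + lam * ‖x‖ ^ 2 by positivity)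
  have hb2 := Real.sq_sqrt (show 0 ≤ 1 + lam * ⟪x, v⟫_ℝ ^ 2 by positivity)
  set t := (√(1 + lam * ‖x‖ ^ 2))⁻¹ with ht
  have hxT : x - ⟪x, v⟫_ℝ • v ∈ T := by
    rw [hT]
    refine ⟨trivial, ?_⟩
    rw [SetLike.mem_coe, Submodule.mem_orthogonal_singleton_iff_inner_left, inner_sub_left,
      inner_smul_left, real_inner_self_eq_norm_sq, hv]
    simp
  set ξ : T := ⟨x - ⟪x, v⟫_ℝ • v, hxT⟩ with hξ
  have hxw : ∀ w : T, ⟪x, (w : Euc d)⟫_ℝ = ⟪ξ, w⟫_ℝ := fun w => by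
    have hw : ⟪v, (w : Euc d)⟫_ℝ = 0 :=
      Submodule.mem_orthogonal_singleton_iff_inner_right.1 (hT.le w.2).2
    rw [Submodule.coe_inner, hξ, inner_sub_left, inner_smul_left, hw]
    simp
  have hcomp : LinearMap.adjoint P.toLinearMap ∘ₗ P.toLinearMap =
      (t ^ 2) • LinearMap.transvection (-(lam * t ^ 2) • (innerSL ℝ ξ).toLinearMap) ξ := by
    refine LinearMap.ext fun w => ext_inner_right ℝ fun z => ?_
    rw [LinearMap.comp_apply, LinearMap.adjoint_inner_left, LinearEquiv.coe_coe,
      Submodule.coe_inner, ← hP, ← hP, M.inner_dparam hlam, hxw, hxw, LinearMap.smul_apply,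
      inner_smul_left, LinearMap.transvection.apply, inner_add_left, inner_smul_left]
    simp only [ContinuousLinearMap.coe_coe, LinearMap.smul_apply, innerSL_apply_apply, smul_eq_mul,
      RCLike.conj_to_real, ← ht, Submodule.coe_inner]
    ring
  have hξξ : ⟪ξ, ξ⟫_ℝ = ‖x‖ ^ 2 - ⟪x, v⟫_ℝ ^ 2 := by
    rw [← hxw, hξ, inner_sub_right, inner_smul_right, real_inner_self_eq_norm_sq]
    ring
  have hfin : Module.finrank ℝ T = d - 1 := by rw [hT, finrank_tangent hd hv]
  rw [hcomp, LinearMap.det_smul, LinearMap.transvection.det, hfin]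
  congr 1
  simp only [LinearMap.smul_apply, ContinuousLinearMap.coe_coe, innerSL_apply_apply, hξξ,
    smul_eq_mul]
  rw [hb2, ht, inv_pow, hs2]
  have : 0 < 1 + lam * ‖x‖ ^ 2 := by positivity
  field_simp
  ring

/-- The factor by which the Gauss-Kronecker curvature changes. -/
theorem hasGaussKronecker_lift (hd : 1 ≤ d) {L B : Set (Euc d)} {x v : Euc d} {k : ℝ}
    (hv : outerNormals ⊤ L x = {v}) (h : HasGaussKronecker ⊤ L B x k) :
    HasGaussKronecker (ℝ ∙ M.param x)ᗮ (M.lift L) (M.param '' B) (M.param x)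
      ((√(1 + lam * ‖x‖ ^ 2) * (√(1 + lam * ⟪x, v⟫_ℝ ^ 2))⁻¹) ^ (d + 1) * k) := by
  obtain ⟨v', hv', A, hA, hdet⟩ := h
  obtain rfl : v = v' := Set.singleton_injective (hv.symm.trans hv')
  have hv1 : ‖v‖ = 1 := by
    have : v ∈ outerNormals ⊤ L x := by rw [hv]; rfl
    exact this.2.1
  obtain ⟨P, hP, hPs⟩ := M.exists_tangent_equiv hlam hd (x := x) hv1
  have hs := sqrt_pos hlam x
  set b := √(1 + lam * ⟪x, v⟫_ℝ ^ 2) with hb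
  have hb0 : 0 < b := Real.sqrt_pos.2 (by positivity)
  have ho := M.inner_param_o_pos hlam x
  have hu0 : M.param x ≠ 0 := fun h => by simp [h] at ho
  have hcont : ContinuousAt (fun y => (√(1 + lam * ‖M.proj y‖ ^ 2))⁻¹ * b⁻¹) (M.param x) := by
    have h1 := (M.continuousAt_proj hlam ho.ne')
    have h2 : ContinuousAt (fun y => √(1 + lam * ‖M.proj y‖ ^ 2)) (M.param x) :=
      (continuousAt_const.add (continuousAt_const.mul (h1.norm.pow 2))).sqrt
    exact (h2.inv₀ (sqrt_pos hlam _).ne').mul continuousAt_const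
  refine ⟨M.liftNormal x v, M.outerNormals_lift_eq_singleton hlam hv, _,
    hA.transfer (M.differentiableAt_proj hlam ho.ne').hasFDerivAt (M.proj_param hlam x) ?_
    (P.symm : _ →ₗ[ℝ] _) hPs (c := fun y => (√(1 + lam * ‖M.proj y‖ ^ 2))⁻¹ * b⁻¹)
    (hcont.tendsto.mono_left nhdsWithin_le_nhds) ?_ (C := 1 + ‖M.param x‖⁻¹) ?_, ?_⟩
  · filter_upwards [self_mem_nhdsWithin] with y hy
    obtain ⟨z, hz, rfl⟩ := hy
    rwa [M.proj_param hlam]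
  · filter_upwards [self_mem_nhdsWithin] with y hy
    obtain ⟨z, hz, rfl⟩ := hy
    rw [M.proj_param hlam, inner_sub_left, M.inner_param_liftNormal hlam,
      M.inner_param_liftNormal hlam, sub_self, mul_zero, sub_zero, inner_sub_left, ← hb]
  · filter_upwards [self_mem_nhdsWithin] with y hy
    obtain ⟨z, hz, rfl⟩ := hy
    refine perp_bound_of_sphere (M.norm_liftNormal hlam hv1) hu0 ?_ ?_
    · rw [M.inner_param_liftNormal hlam, sub_self, mul_zero]
    · have h1 := M.param_mem_sphere hlam z
      have h2 := M.param_mem_sphere hlam x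
      rw [sphereLam, mem_sphere_zero_iff_norm] at h1 h2
      rw [h1, h2]
  · have hd1 := M.det_tangent_equiv hlam hd hv1 rfl P hP
    have hd2 := LinearMap.det_adjoint_comp_self_mul_symm P
    -- With `s` the square root at `x`, the heights contribute `(s b)⁻¹` to the power `d - 1`.
    -- Division by `det (P* P) = b² / s ^ (2 d)` gives `(s / b) ^ (d + 1)`.
    rw [LinearMap.det_smul, LinearMap.det_adjoint_comp_comp P.symm A, hdet,
      M.finrank_tangent_lift hlam hd hv1, M.proj_param hlam]
    rw [hd1, ← hb] at hd2
    rw [eq_div_of_mul_eq (by positivity) hd2]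
    obtain ⟨m, rfl⟩ : ∃ m, d = m + 1 := ⟨d - 1, by omega⟩
    simp only [Nat.add_sub_cancel, mul_pow, inv_pow, ← pow_mul]
    generalize √(1 + lam * ‖x‖ ^ 2) = s at hs ⊢
    field_simp
    ring

/-- The converse direction makes existence of the curvature equivalent in the two models and lets
uniqueness on the sphere be inherited from `ℝᵈ`. -/
theorem hasGaussKronecker_of_lift (hd : 1 ≤ d) {L B : Set (Euc d)} {x v : Euc d} {k : ℝ}
    (hv : outerNormals ⊤ L x = {v})
    (h : HasGaussKronecker (ℝ ∙ M.param x)ᗮ (M.lift L) (M.param '' B) (M.param x) k) :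
    HasGaussKronecker ⊤ L B x
      (((√(1 + lam * ‖x‖ ^ 2) * (√(1 + lam * ⟪x, v⟫_ℝ ^ 2))⁻¹) ^ (d + 1))⁻¹ * k) := by
  obtain ⟨v', hv', A, hA, hdet⟩ := h
  obtain rfl : M.liftNormal x v = v' :=
    Set.singleton_injective ((M.outerNormals_lift_eq_singleton hlam hv).symm.trans hv')
  have hv1 : ‖v‖ = 1 := by
    have : v ∈ outerNormals ⊤ L x := by rw [hv]; rfl
    exact this.2.1
  obtain ⟨P, hP, hPs⟩ := M.exists_tangent_equiv hlam hd (x := x) hv1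
  have hs := sqrt_pos hlam x
  set b := √(1 + lam * ⟪x, v⟫_ℝ ^ 2) with hb
  have hb0 : 0 < b := Real.sqrt_pos.2 (by positivity)
  have hcont : ContinuousAt (fun y : Euc d => √(1 + lam * ‖y‖ ^ 2) * b) x := by fun_prop
  refine ⟨v, hv, _, hA.transfer (M.hasFDerivAt_param hlam x) rfl ?_
    (P : _ →ₗ[ℝ] _) hP (c := fun y => √(1 + lam * ‖y‖ ^ 2) * b)
    (hcont.tendsto.mono_left nhdsWithin_le_nhds) ?_ (C := 1) ?_, ?_⟩
  · filter_upwards [self_mem_nhdsWithin] with y hy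
    exact ⟨y, hy, rfl⟩
  · refine Eventually.of_forall fun y => ?_
    have hsy := sqrt_pos hlam y
    rw [inner_sub_left (M.param y), M.inner_param_liftNormal hlam,
      M.inner_param_liftNormal hlam, sub_self, mul_zero, sub_zero, inner_sub_left, ← hb]
    field_simp
  · exact Eventually.of_forall fun y => perp_bound_of_top hv1 _
  · rw [LinearMap.det_smul, LinearMap.det_adjoint_comp_comp P A, hdet,
      M.det_tangent_equiv hlam hd hv1 rfl P hP, finrank_tangent hd hv1, ← hb]
    obtain ⟨m, rfl⟩ : ∃ m, d = m + 1 := ⟨d - 1, by omega⟩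
    simp only [Nat.add_sub_cancel, mul_pow, inv_pow, ← pow_mul]
    generalize √(1 + lam * ‖x‖ ^ 2) = s at hs ⊢
    field_simp
    ring

end ProjectiveModel

/-! ### Uniqueness of the Gauss–Kronecker curvature -/

namespace IsBody

variable {d : ℕ} {L : Set (Euc d)}

/-- In every tangent direction at a boundary point with a second fundamental form, the boundary
contains a path with that derivative. -/
theorem exists_tangent_path (hL : IsBody L) {x v : Euc d} (hx : x ∈ frontier L)
    (hv : v ∈ outerNormals ⊤ L x) {T : Submodule ℝ (Euc d)} {A : T →ₗ[ℝ] T}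
    (hA : IsSecondFundamentalForm (frontier L) T x v A) (w : Euc d) (hw : ⟪w, v⟫_ℝ = 0) :
    ∃ y : ℝ → Euc d, Tendsto y (𝓝[>] 0) (𝓝[frontier L] x) ∧
      Tendsto (fun t => t⁻¹ • (y t - x)) (𝓝[>] 0) (𝓝 w) := by
  obtain ⟨r, R, hr, hR, hrL, hRL⟩ := hL.exists_radii
  have hh := hL.inner_pos hv
  have hx1 : gauge L x = 1 := hL.gauge_eq_one_iff.2 hx
  set g : ℝ → ℝ := fun t => gauge L (x + t • w) with hg
  have hgc : Tendsto g (𝓝[>] 0) (𝓝 1) := by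
    have : Continuous g := hL.continuous_gauge.comp (by fun_prop)
    have h1 := this.tendsto 0
    simp only [hg, zero_smul, add_zero, hx1] at h1
    exact h1.mono_left nhdsWithin_le_nhds
  have hgpos : ∀ᶠ t in 𝓝[>] (0 : ℝ), 0 < g t := hgc.eventually_const_lt one_pos
  have hg1 : (fun t => 1 - g t) =O[𝓝[>] 0] fun t : ℝ => t := by
    refine IsBigO.of_bound (r⁻¹ * ‖w‖) (Eventually.of_forall fun t => ?_)
    have h1 := hL.lipschitz_gauge hr hrL x (x + t • w)
    rw [hx1, sub_add_cancel_left, norm_neg, norm_smul] at h1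
    rw [Real.norm_eq_abs (1 - g t)]
    exact h1.trans_eq (by ring)
  set y : ℝ → Euc d := fun t => (g t)⁻¹ • (x + t • w) with hy
  have hginv : Tendsto (fun t => (g t)⁻¹) (𝓝[>] 0) (𝓝 1) := by
    simpa using hgc.inv₀ one_ne_zero
  have hyx : ∀ᶠ t in 𝓝[>] (0 : ℝ), y t - x = (g t)⁻¹ • ((1 - g t) • x + t • w) := by
    filter_upwards [hgpos] with t ht
    change (g t)⁻¹ • (x + t • w) - x = _
    rw [sub_smul, one_smul, smul_add, smul_add, smul_sub, smul_smul (g t)⁻¹ (g t),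
      inv_mul_cancel₀ ht.ne', one_smul]
    abel
  have hyO : (fun t => y t - x) =O[𝓝[>] 0] fun t : ℝ => t := by
    have h1 : (fun t : ℝ => (1 - g t) • x + t • w) =O[𝓝[>] 0] fun t : ℝ => t * 1 :=
      (hg1.smul (isBigO_const_const x one_ne_zero _)).add
        ((isBigO_refl _ _).smul (isBigO_const_const w one_ne_zero _))
    have h2 := (hginv.isBigO_one ℝ).smul h1
    simp only [one_smul, mul_one] at h2
    exact h2.congr' (hyx.mono fun t ht => ht.symm) EventuallyEq.rfl
  have hyt : Tendsto y (𝓝[>] 0) (𝓝[frontier L] x) := by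
    refine tendsto_nhdsWithin_iff.2 ⟨?_, ?_⟩
    · have h1 : Tendsto (fun t : ℝ => t) (𝓝[>] 0) (𝓝 0) := tendsto_id.mono_left nhdsWithin_le_nhds
      simpa using (hyO.trans_tendsto h1).add_const x
    · filter_upwards [hgpos] with t ht
      exact hL.inv_gauge_smul_mem_frontier fun h => by simp [hg, h] at ht
  refine ⟨y, hyt, ?_⟩
  -- As `w` is tangent, the height of `y t` is `(g t)⁻¹ (1 - g t) ⟪x, v⟫`. It is quadratically
  -- small, so renormalizing by the gauge does not change the derivative of the path.
  have hsq : (fun t => 1 - g t) =O[𝓝[>] 0] fun t : ℝ => t ^ 2 := by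
    have h1 := (hA.height_isBigO.comp_tendsto hyt).trans (hyO.norm_left.pow 2)
    have h2 : (fun t => g t * (⟪x, v⟫_ℝ)⁻¹ * ⟪y t - x, v⟫_ℝ) =O[𝓝[>] 0]
        fun t : ℝ => 1 * t ^ 2 := ((hgc.mul_const _).isBigO_one ℝ).mul h1
    simp only [one_mul] at h2
    refine h2.congr' ?_ EventuallyEq.rfl
    filter_upwards [hyx, hgpos] with t ht ht0
    rw [ht, inner_smul_left, inner_add_left, inner_smul_left, inner_smul_left, hw]
    simp
    field_simp
  have hlim : Tendsto (fun t => t⁻¹ * (1 - g t)) (𝓝[>] 0) (𝓝 0) := by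
    have h1 : (fun t : ℝ => t⁻¹ * (1 - g t)) =O[𝓝[>] 0] fun t : ℝ => t⁻¹ * t ^ 2 :=
      (isBigO_refl _ _).mul hsq
    refine h1.trans_tendsto ?_
    have h2 : Tendsto (fun t : ℝ => t) (𝓝[>] 0) (𝓝 0) := tendsto_id.mono_left nhdsWithin_le_nhds
    refine h2.congr' ?_
    filter_upwards [self_mem_nhdsWithin] with t ht
    have : t ≠ 0 := (Set.mem_Ioi.1 ht).ne'
    field_simp
  have hfin : Tendsto (fun t => (g t)⁻¹ • ((t⁻¹ * (1 - g t)) • x + w)) (𝓝[>] 0)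
      (𝓝 ((1 : ℝ) • ((0 : ℝ) • x + w))) := hginv.smul ((hlim.smul_const x).add_const w)
  rw [zero_smul, zero_add, one_smul] at hfin
  refine hfin.congr' ?_
  filter_upwards [hyx, self_mem_nhdsWithin] with t ht ht0
  have ht0 : t ≠ 0 := (Set.mem_Ioi.1 ht0).ne'
  rw [ht, smul_comm t⁻¹, smul_add t⁻¹, smul_smul t⁻¹, smul_smul t⁻¹ t, inv_mul_cancel₀ ht0, one_smul]

/-- The two quadratic forms agree up to `o(‖y - x‖²)` on the boundary. Along a boundary path with
derivative `w`, homogeneity of degree two turns this into equality at `w`. -/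
theorem isSecondFundamentalForm_unique (hL : IsBody L) {x v : Euc d} (hx : x ∈ frontier L)
    (hv : v ∈ outerNormals ⊤ L x) {T : Submodule ℝ (Euc d)} (hT : T ≤ (ℝ ∙ v)ᗮ)
    {A A' : T →ₗ[ℝ] T} (hA : IsSecondFundamentalForm (frontier L) T x v A)
    (hA' : IsSecondFundamentalForm (frontier L) T x v A') : A = A' := by
  rw [← sub_eq_zero, ← (hA.symm.sub hA'.symm).inner_map_self_eq_zero]
  intro w
  have hw : ⟪(w : Euc d), v⟫_ℝ = 0 :=
    Submodule.mem_orthogonal_singleton_iff_inner_left.1 (hT w.2)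
  obtain ⟨y, hy, hyw⟩ := hL.exists_tangent_path hx hv hA w hw
  set q : T → ℝ := fun z => ⟪(A - A') z, z⟫_ℝ with hq
  have hqc : Continuous q :=
    ((LinearMap.toContinuousLinearMap (A - A')).continuous).inner continuous_id
  have hqs : ∀ (c : ℝ) z, q (c • z) = c ^ 2 * q z := fun c z => by
    change ⟪(A - A') (c • z), c • z⟫_ℝ = c ^ 2 * ⟪(A - A') z, z⟫_ℝ
    rw [map_smul, Submodule.coe_inner, Submodule.coe_inner, Submodule.coe_smul, Submodule.coe_smul,
      real_inner_smul_left, real_inner_smul_right]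
    ring
  set p := T.orthogonalProjectionOnto with hp
  have h1 : (fun z : Euc d => q (p (z - x))) =o[𝓝[frontier L] x] fun z => ‖z - x‖ ^ 2 := by
    refine ((hA'.expansion.sub hA.expansion).const_mul_left 2).congr_left fun z => ?_
    simp only [hq, LinearMap.sub_apply, inner_sub_left]
    ring
  have h2 : Tendsto (fun t => q (p (t⁻¹ • (y t - x)))) (𝓝[>] 0) (𝓝 (q w)) := by
    have : p (w : Euc d) = w := Submodule.orthogonalProjectionOnto_mem_subspace_eq_self w
    have h3 := (hqc.comp p.continuous).tendsto (w : Euc d)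
    rw [Function.comp_apply, this] at h3
    exact h3.comp hyw
  have h3 : Tendsto (fun t => q (p (t⁻¹ • (y t - x)))) (𝓝[>] 0) (𝓝 0) := by
    have h4 : (fun t : ℝ => t⁻¹ ^ 2 * q (p (y t - x))) =o[𝓝[>] 0]
        fun t : ℝ => t⁻¹ ^ 2 * ‖y t - x‖ ^ 2 :=
      (isBigO_refl _ _).mul_isLittleO (h1.comp_tendsto hy)
    have h5 : (fun t : ℝ => t⁻¹ ^ 2 * ‖y t - x‖ ^ 2) =O[𝓝[>] 0] fun _ => (1 : ℝ) := by
      refine ((hyw.norm.pow 2).isBigO_one ℝ).congr_left fun t => ?_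
      rw [norm_smul, mul_pow, norm_inv, Real.norm_eq_abs, inv_pow, inv_pow, sq_abs]
    refine ((isLittleO_one_iff ℝ).1 (h4.trans_isBigO h5)).congr fun t => ?_
    rw [map_smul, hqs]
  exact tendsto_nhds_unique h2 h3

theorem hasGaussKronecker_unique (hL : IsBody L) {x : Euc d} (hx : x ∈ frontier L) {k k' : ℝ}
    (h : HasGaussKronecker ⊤ L (frontier L) x k) (h' : HasGaussKronecker ⊤ L (frontier L) x k') :
    k = k' := by
  obtain ⟨v, hv, A, hA, rfl⟩ := h
  obtain ⟨v', hv', A', hA', rfl⟩ := h'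
  obtain rfl : v = v' := Set.singleton_injective (hv.symm.trans hv')
  have hvm : v ∈ outerNormals ⊤ L x := by rw [hv]; rfl
  rw [hL.isSecondFundamentalForm_unique hx hvm inf_le_right hA hA']

theorem curvE_eq (hL : IsBody L) {x : Euc d} (hx : x ∈ frontier L) {k : ℝ}
    (h : HasGaussKronecker ⊤ L (frontier L) x k) : curvE L x = k := by
  have hex : ∃ k, HasGaussKronecker ⊤ L (frontier L) x k := ⟨k, h⟩
  rw [curvE, gaussKronecker, dif_pos hex]
  exact hL.hasGaussKronecker_unique hx hex.choose_spec h

end IsBody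

/-- Where no curvature exists, both sides take the default value `0`; elsewhere uniqueness makes the
choice in `gaussKronecker` immaterial. -/
theorem ProjectiveModel.curvLam_lift {d : ℕ} {lam : ℝ} (M : ProjectiveModel d lam)
    (hlam : 0 < lam) (hd : 1 ≤ d) {L : Set (Euc d)} (hL : IsBody L) {x v : Euc d}
    (hx : x ∈ frontier L) (hv : outerNormals ⊤ L x = {v}) :
    curvLam lam (M.lift L) (M.param x) =
      (√(1 + lam * ‖x‖ ^ 2) * (√(1 + lam * ⟪x, v⟫_ℝ ^ 2))⁻¹) ^ (d + 1) * curvE L x := by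
  set ρ := (√(1 + lam * ‖x‖ ^ 2) * (√(1 + lam * ⟪x, v⟫_ℝ ^ 2))⁻¹) ^ (d + 1) with hρ
  have hρ0 : 0 < ρ := by
    have h1 := sqrt_pos hlam x
    have h2 : 0 < √(1 + lam * ⟪x, v⟫_ℝ ^ 2) := Real.sqrt_pos.2 (by positivity)
    positivity
  rw [curvLam, M.bdLam_lift hlam hL.isCompact]
  by_cases hex : ∃ k, HasGaussKronecker ⊤ L (frontier L) x k
  · obtain ⟨k, hk⟩ := hex
    have hex' : ∃ k, HasGaussKronecker (ℝ ∙ M.param x)ᗮ (M.lift L) (M.param '' frontier L)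
      (M.param x) k := ⟨_, M.hasGaussKronecker_lift hlam hd hv hk⟩
    rw [gaussKronecker, dif_pos hex',
      hL.curvE_eq hx (M.hasGaussKronecker_of_lift hlam hd hv hex'.choose_spec), ← hρ,
      mul_inv_cancel_left₀ hρ0.ne']
  · have hex' : ¬ ∃ k, HasGaussKronecker (ℝ ∙ M.param x)ᗮ (M.lift L) (M.param '' frontier L)
        (M.param x) k := fun ⟨k, hk⟩ => hex ⟨_, M.hasGaussKronecker_of_lift hlam hd hv hk⟩
    rw [gaussKronecker, dif_neg hex', curvE, gaussKronecker, dif_neg hex, mul_zero]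

/-! ### Comparison of the boundary measures of the models -/

section GnomDist

variable {d : ℕ}

/-- The denominator of `gnomDistSq`. -/
noncomputable def gnomDenom (lam : ℝ) (x y : Euc d) : ℝ :=
  √(1 + lam * ‖x‖ ^ 2) * √(1 + lam * ‖y‖ ^ 2) *
    (√(1 + lam * ‖x‖ ^ 2) * √(1 + lam * ‖y‖ ^ 2) + 1 + lam * ⟪x, y⟫_ℝ)

theorem continuous_gnomDenom :
    Continuous fun z : ℝ × Euc d × Euc d => gnomDenom z.1 z.2.1 z.2.2 := by
  unfold gnomDenom
  fun_prop

theorem two_le_gnomDenom {lam : ℝ} (hlam : 0 ≤ lam) (x y : Euc d) : 2 ≤ gnomDenom lam x y := by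
  have h1 := two_le_gnom_denominator hlam x y
  have h2 : 1 ≤ √(1 + lam * ‖x‖ ^ 2) * √(1 + lam * ‖y‖ ^ 2) := by
    have := one_add_mul_norm_le_sqrt_mul_sqrt hlam x y
    have h3 : 0 ≤ lam * (‖x‖ * ‖y‖) := by positivity
    linarith
  rw [gnomDenom]
  nlinarith

theorem gnomDistSq_eq (lam : ℝ) (x y : Euc d) : gnomDistSq lam x y =
    2 * (‖x - y‖ ^ 2 + lam * (‖x‖ ^ 2 * ‖y‖ ^ 2 - ⟪x, y⟫_ℝ ^ 2)) / gnomDenom lam x y := rfl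

theorem gram_nonneg (x y : Euc d) : 0 ≤ ‖x‖ ^ 2 * ‖y‖ ^ 2 - ⟪x, y⟫_ℝ ^ 2 := by
  have h := abs_real_inner_le_norm x y
  have := sq_le_sq' (abs_le.1 h).1 (abs_le.1 h).2
  rw [mul_pow] at this
  linarith

/-- The Gram determinant of `x, y` is that of `x, x - y`. The `λ`-dependent part of the chordal
distance is thus controlled by `‖x - y‖²`, also near the diagonal. -/
theorem gram_le {R : ℝ} {x : Euc d} (hx : ‖x‖ ≤ R) (y : Euc d) :
    ‖x‖ ^ 2 * ‖y‖ ^ 2 - ⟪x, y⟫_ℝ ^ 2 ≤ R ^ 2 * ‖x - y‖ ^ 2 := by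
  have h1 : ‖x‖ ^ 2 * ‖y‖ ^ 2 - ⟪x, y⟫_ℝ ^ 2 ≤ ‖x‖ ^ 2 * ‖x - y‖ ^ 2 := by
    rw [norm_sub_sq_real]
    nlinarith [sq_nonneg (‖x‖ ^ 2 - ⟪x, y⟫_ℝ)]
  refine h1.trans ?_
  gcongr

theorem gnomDistSq_nonneg {lam : ℝ} (hlam : 0 ≤ lam) (x y : Euc d) : 0 ≤ gnomDistSq lam x y := by
  have h1 := gram_nonneg x y
  have h2 := two_le_gnomDenom hlam x y
  rw [gnomDistSq_eq]
  positivity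

theorem gnomDistSq_le_mul {lam mu R A : ℝ} (hlam : 0 ≤ lam) (hmu : 0 ≤ mu) {x y : Euc d}
    (hx : ‖x‖ ≤ R) (hA : gnomDenom mu x y ≤ A * gnomDenom lam x y) :
    gnomDistSq lam x y ≤ (1 + |lam - mu| * R ^ 2) * A * gnomDistSq mu x y := by
  have hl := two_le_gnomDenom hlam x y
  have hm := two_le_gnomDenom hmu x y
  have hW := gram_nonneg x y
  have hWR := gram_le hx y
  set W := ‖x‖ ^ 2 * ‖y‖ ^ 2 - ⟪x, y⟫_ℝ ^ 2
  set D := ‖x - y‖ ^ 2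
  have hD : 0 ≤ D := by positivity
  have h1 : D + lam * W ≤ (1 + |lam - mu| * R ^ 2) * (D + mu * W) := by
    have h2 : (lam - mu) * W ≤ |lam - mu| * (R ^ 2 * D) :=
      mul_le_mul (le_abs_self _) hWR hW (abs_nonneg _)
    have h3 : 0 ≤ |lam - mu| * R ^ 2 * (mu * W) := by positivity
    nlinarith
  rw [gnomDistSq_eq, gnomDistSq_eq, ← mul_div_assoc, div_le_div_iff₀ (by positivity)
    (by positivity)]
  have h4 : 0 ≤ (1 + |lam - mu| * R ^ 2) * (D + mu * W) := by positivity
  calc 2 * (D + lam * W) * gnomDenom mu x y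
      ≤ 2 * ((1 + |lam - mu| * R ^ 2) * (D + mu * W)) * (A * gnomDenom lam x y) := by gcongr
    _ = _ := by ring

theorem exists_gnomDistSq_le_mul {lam mu : ℝ} (hlam : 0 ≤ lam) (hmu : 0 ≤ mu) (R : ℝ) :
    ∃ C : ℝ, 0 ≤ C ∧ ∀ x y : Euc d, ‖x‖ ≤ R → ‖y‖ ≤ R →
      gnomDistSq lam x y ≤ C * gnomDistSq mu x y := by
  have hK : IsCompact (Metric.closedBall (0 : Euc d) R ×ˢ Metric.closedBall (0 : Euc d) R) :=
    (isCompact_closedBall _ _).prod (isCompact_closedBall _ _)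
  have hc : Continuous fun z : Euc d × Euc d => gnomDenom mu z.1 z.2 :=
    continuous_gnomDenom.comp (by fun_prop : Continuous fun z : Euc d × Euc d => (mu, z.1, z.2))
  obtain ⟨B, hB⟩ := hK.exists_bound_of_continuousOn hc.continuousOn
  refine ⟨(1 + |lam - mu| * R ^ 2) * |B|, by positivity, fun x y hx hy =>
    gnomDistSq_le_mul hlam hmu hx ?_⟩
  have h1 := (le_abs_self _).trans (hB (x, y) ⟨by simpa using hx, by simpa using hy⟩)
  have h2 := two_le_gnomDenom hlam x y
  have h3 := le_abs_self B
  have h4 := abs_nonneg B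
  simp only at h1
  nlinarith

theorem eventually_gnomDistSq_le_mul {lam₀ : ℝ} (hlam₀ : 0 ≤ lam₀) (R : ℝ) {C : ℝ} (hC : 1 < C) :
    ∀ᶠ lam in 𝓝 lam₀, 0 ≤ lam → ∀ x y : Euc d, ‖x‖ ≤ R → ‖y‖ ≤ R →
      gnomDistSq lam x y ≤ C * gnomDistSq lam₀ x y ∧
        gnomDistSq lam₀ x y ≤ C * gnomDistSq lam x y := by
  obtain ⟨A, hA1, hAC⟩ := exists_between hC
  have hK : IsCompact (Metric.closedBall (0 : Euc d) R ×ˢ Metric.closedBall (0 : Euc d) R) :=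
    (isCompact_closedBall _ _).prod (isCompact_closedBall _ _)
  have hcz : Continuous fun z : ℝ × Euc d × Euc d => gnomDenom lam₀ z.2.1 z.2.2 :=
    continuous_gnomDenom.comp
      (by fun_prop : Continuous fun z : ℝ × Euc d × Euc d => (lam₀, z.2.1, z.2.2))
  have h1 : ∀ᶠ lam in 𝓝 lam₀, ∀ z ∈ Metric.closedBall (0 : Euc d) R ×ˢ
      Metric.closedBall (0 : Euc d) R, gnomDenom lam₀ z.1 z.2 < A * gnomDenom lam z.1 z.2 ∧
        gnomDenom lam z.1 z.2 < A * gnomDenom lam₀ z.1 z.2 := by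
    refine hK.eventually_forall_of_forall_eventually (P := fun lam z =>
      gnomDenom lam₀ z.1 z.2 < A * gnomDenom lam z.1 z.2 ∧
        gnomDenom lam z.1 z.2 < A * gnomDenom lam₀ z.1 z.2) fun z _ => ?_
    have h2 := two_le_gnomDenom hlam₀ z.1 z.2
    have h3 : gnomDenom lam₀ z.1 z.2 < A * gnomDenom lam₀ z.1 z.2 := by nlinarith
    have h4 : IsOpen {w : ℝ × Euc d × Euc d |
        gnomDenom lam₀ w.2.1 w.2.2 < A * gnomDenom w.1 w.2.1 w.2.2} :=
      isOpen_lt hcz (continuous_const.mul continuous_gnomDenom)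
    have h5 : IsOpen {w : ℝ × Euc d × Euc d |
        gnomDenom w.1 w.2.1 w.2.2 < A * gnomDenom lam₀ w.2.1 w.2.2} :=
      isOpen_lt continuous_gnomDenom (continuous_const.mul hcz)
    have h6 := h4.mem_nhds (x := (lam₀, z)) h3
    have h7 := h5.mem_nhds (x := (lam₀, z)) h3
    exact Filter.Eventually.and h6 h7
  have h2 : ∀ᶠ lam in 𝓝 lam₀, (1 + |lam - lam₀| * R ^ 2) * A < C := by
    have h3 : Continuous fun lam => (1 + |lam - lam₀| * R ^ 2) * A := by fun_prop
    exact h3.continuousAt.eventually_lt_const (by simpa using hAC)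
  filter_upwards [h1, h2] with lam h1 h2 hlam x y hx hy
  have h3 := h1 (x, y) ⟨by simpa using hx, by simpa using hy⟩
  constructor
  · exact (gnomDistSq_le_mul hlam hlam₀ hx h3.1.le).trans
      (mul_le_mul_of_nonneg_right h2.le (gnomDistSq_nonneg hlam₀ x y))
  · refine (gnomDistSq_le_mul hlam₀ hlam hx h3.2.le).trans
      (mul_le_mul_of_nonneg_right ?_ (gnomDistSq_nonneg hlam x y))
    rw [abs_sub_comm]
    exact h2.le

end GnomDist

/-- An embedding of `ℝᵈ` with the chordal metric of the projective model of curvature `lam`. -/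
structure IsModelMap {d m : ℕ} (lam : ℝ) (f : Euc d → Euc m) : Prop where
  continuous : Continuous f
  injective : Function.Injective f
  norm_sub_sq : ∀ x y, ‖f x - f y‖ ^ 2 = gnomDistSq lam x y

theorem isModelMap_id (d : ℕ) : IsModelMap 0 (id : Euc d → Euc d) :=
  ⟨continuous_id, Function.injective_id, fun x y => (gnomDistSq_zero x y).symm⟩

theorem ProjectiveModel.isModelMap_param {d : ℕ} {lam : ℝ} (M : ProjectiveModel d lam)
    (hlam : 0 < lam) : IsModelMap lam M.param :=
  ⟨M.continuous_param hlam, M.injective_param hlam, M.norm_param_sub_sq hlam⟩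

/-! ### Boundary measures pulled back to the Euclidean body. -/

theorem IsModelMap.measurableEmbedding {d m : ℕ} {lam : ℝ} {f : Euc d → Euc m}
    (hf : IsModelMap lam f) : MeasurableEmbedding f :=
  hf.continuous.measurableEmbedding hf.injective

/-- The boundary measure of `L`, as seen through the embedding `f`. -/
noncomputable def bdMeasure {d m : ℕ} (f : Euc d → Euc m) (L : Set (Euc d)) : Measure (Euc d) :=
  ((μHE[d - 1] : Measure (Euc m)).comap f).restrict (frontier L)

theorem bdMeasure_id {d : ℕ} (L : Set (Euc d)) :
    bdMeasure (id : Euc d → Euc d) L = (μHE[d - 1] : Measure (Euc d)).restrict (frontier L) := by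
  rw [bdMeasure]
  exact congrArg (fun μ : Measure (Euc d) => μ.restrict (frontier L)) (Measure.comap_id _)

theorem setLIntegral_image_eq {d m : ℕ} {f : Euc d → Euc m} (hf : MeasurableEmbedding f)
    (L : Set (Euc d)) (G : Euc m → ℝ≥0∞) :
    ∫⁻ u in f '' frontier L, G u ∂μHE[d - 1] = ∫⁻ x, G (f x) ∂bdMeasure f L := by
  rw [bdMeasure, ← hf.lintegral_map, ← hf.injective.preimage_image (frontier L), ← hf.restrict_map,
    hf.map_comap, Measure.restrict_restrict_of_subset (Set.image_subset_range _ _),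
    hf.injective.preimage_image]

theorem euclideanHausdorffMeasure_image_le_image {d m m' : ℕ} {f : Euc d → Euc m}
    {g : Euc d → Euc m'} (hg : Function.Injective g) {S : Set (Euc d)} {C : NNReal}
    (h : ∀ x ∈ S, ∀ y ∈ S, ‖f x - f y‖ ≤ C * ‖g x - g y‖) (n : ℕ) :
    μHE[n] (f '' S) ≤ (C : ℝ≥0∞) ^ n * μHE[n] (g '' S) := by
  have h1 : f '' S = (f ∘ Function.invFun g) '' (g '' S) := by
    rw [Set.image_image]
    simp only [Function.comp, Function.leftInverse_invFun hg _]
  rw [h1]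
  refine LipschitzOnWith.euclideanHausdorffMeasure_image_le (LipschitzOnWith.of_dist_le_mul ?_) n
  rintro _ ⟨x, hx, rfl⟩ _ ⟨y, hy, rfl⟩
  simp only [Function.comp, Function.leftInverse_invFun hg _, dist_eq_norm]
  exact h x hx y hy

/-- The identity of `L`, read as a map between the two embedded boundaries, is `C`-Lipschitz. The
Lipschitz bound for Hausdorff measures takes the place of an area formula. -/
theorem bdMeasure_le_of_gnomDistSq_le {d m m' : ℕ} {lam mu : ℝ} {f : Euc d → Euc m}
    {g : Euc d → Euc m'} (hf : IsModelMap lam f) (hg : IsModelMap mu g) {L : Set (Euc d)}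
    {C : NNReal} (h : ∀ x ∈ frontier L, ∀ y ∈ frontier L,
      gnomDistSq lam x y ≤ (C : ℝ) ^ 2 * gnomDistSq mu x y) :
    bdMeasure f L ≤ (C : ℝ≥0∞) ^ (d - 1) • bdMeasure g L := by
  refine Measure.le_iff.2 fun S hS => ?_
  rw [Measure.smul_apply, smul_eq_mul, bdMeasure, bdMeasure, Measure.restrict_apply hS,
    Measure.restrict_apply hS, hf.measurableEmbedding.comap_apply,
    hg.measurableEmbedding.comap_apply]
  refine euclideanHausdorffMeasure_image_le_image hg.injective (fun x hx y hy => ?_) _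
  have h1 := h x hx.2 y hy.2
  rw [← hf.norm_sub_sq, ← hg.norm_sub_sq, ← mul_pow] at h1
  exact (sq_le_sq₀ (by positivity) (by positivity)).1 h1

namespace IsBody

variable {d : ℕ} {L : Set (Euc d)}

theorem exists_bdMeasure_le (hL : IsBody L) {m m' : ℕ} {lam mu : ℝ} (hlam : 0 ≤ lam) (hmu : 0 ≤ mu)
    {f : Euc d → Euc m} {g : Euc d → Euc m'} (hf : IsModelMap lam f) (hg : IsModelMap mu g) :
    ∃ C : ℝ≥0∞, C ≠ ∞ ∧ bdMeasure f L ≤ C • bdMeasure g L := by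
  obtain ⟨r, R, hr, hR, hrL, hRL⟩ := hL.exists_radii
  have hn : ∀ x ∈ frontier L, ‖x‖ ≤ R := fun x hx => by
    simpa using hRL (hL.frontier_subset hx)
  obtain ⟨C, hC, h⟩ := exists_gnomDistSq_le_mul (d := d) hlam hmu R
  refine ⟨(Real.toNNReal √C : ℝ≥0∞) ^ (d - 1), ENNReal.pow_ne_top ENNReal.coe_ne_top,
    bdMeasure_le_of_gnomDistSq_le hf hg fun x hx y hy => ?_⟩
  rw [Real.coe_toNNReal _ (Real.sqrt_nonneg _), Real.sq_sqrt hC]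
  exact h x y (hn x hx) (hn y hy)

theorem eventually_bdMeasure_le (hL : IsBody L) {m m' : ℕ} {lam₀ : ℝ} (hlam₀ : 0 ≤ lam₀)
    {g : Euc d → Euc m'} (hg : IsModelMap lam₀ g) {l : Filter ℝ} (hl : l ≤ 𝓝 lam₀)
    {f : ℝ → Euc d → Euc m} (hf : ∀ᶠ lam in l, 0 ≤ lam ∧ IsModelMap lam (f lam)) {c : ℝ≥0∞}
    (hc : 1 < c) :
    ∀ᶠ lam in l, bdMeasure (f lam) L ≤ c • bdMeasure g L ∧
      bdMeasure g L ≤ c • bdMeasure (f lam) L := by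
  obtain ⟨r, R, hr, hR, hrL, hRL⟩ := hL.exists_radii
  have hn : ∀ x ∈ frontier L, ‖x‖ ≤ R := fun x hx => by
    simpa using hRL (hL.frontier_subset hx)
  obtain ⟨C, hC1, hCc⟩ : ∃ C : NNReal, 1 < C ∧ (C : ℝ≥0∞) ^ (d - 1) < c := by
    have h1 : Continuous fun C : NNReal => (C : ℝ≥0∞) ^ (d - 1) := by fun_prop
    have h2 : ∀ᶠ C : NNReal in 𝓝[>] 1, (C : ℝ≥0∞) ^ (d - 1) < c :=
      (h1.continuousAt.eventually_lt_const (by simpa using hc)).filter_mono nhdsWithin_le_nhds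
    exact ((eventually_mem_nhdsWithin).and h2).exists
  have hC2 : (1 : ℝ) < (C : ℝ) ^ 2 := one_lt_pow₀ (by exact_mod_cast hC1) two_ne_zero
  filter_upwards [hl (eventually_gnomDistSq_le_mul (d := d) hlam₀ R hC2), hf] with lam h1 h2
  have h3 := h1 h2.1
  have hle : ∀ ν : Measure (Euc d), (C : ℝ≥0∞) ^ (d - 1) • ν ≤ c • ν := fun ν =>
    Measure.le_iff.2 fun S _ => by
      simp only [Measure.smul_apply, smul_eq_mul]
      gcongr
  exact ⟨(bdMeasure_le_of_gnomDistSq_le h2.2 hg fun x hx y hy =>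
    (h3 x y (hn x hx) (hn y hy)).1).trans (hle _), (bdMeasure_le_of_gnomDistSq_le hg h2.2
      fun x hx y hy => (h3 x y (hn x hx) (hn y hy)).2).trans (hle _)⟩

end IsBody

/-! ### Stability of integrals of powers -/

/-- Both comparisons are assumed because a negative exponent reverses the inequality. -/
theorem ENNReal.rpow_le_rpow_abs_mul_rpow {a b c : ℝ≥0∞} (hc : 1 ≤ c) (hct : c ≠ ∞)
    (hab : a ≤ c * b) (hba : b ≤ c * a) (s : ℝ) : a ^ s ≤ c ^ |s| * b ^ s := by
  have key : ∀ a b : ℝ≥0∞, a ≤ c * b → ∀ t : ℝ, 0 ≤ t → a ^ t ≤ c ^ t * b ^ t := fun a b h t ht => by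
    rw [← ENNReal.mul_rpow_of_nonneg _ _ ht]
    exact ENNReal.rpow_le_rpow h ht
  rcases le_total 0 s with hs | hs
  · rw [abs_of_nonneg hs]
    exact key a b hab s hs
  · have ht : 0 ≤ -s := by linarith
    have h1 := key b a hba (-s) ht
    have hc0 : c ^ (-s) ≠ 0 := (ENNReal.rpow_pos (one_pos.trans_le hc) hct).ne'
    have hct' : c ^ (-s) ≠ ∞ := ENNReal.rpow_ne_top_of_nonneg ht hct
    rw [abs_of_nonpos hs, ← neg_neg s, ENNReal.rpow_neg a, ENNReal.rpow_neg b, neg_neg]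
    rw [← ENNReal.inv_le_inv, ENNReal.mul_inv (Or.inl hc0) (Or.inl hct')] at h1
    calc (a ^ (-s))⁻¹ = c ^ (-s) * ((c ^ (-s))⁻¹ * (a ^ (-s))⁻¹) := by
          rw [← mul_assoc, ENNReal.mul_inv_cancel hc0 hct', one_mul]
      _ ≤ _ := by gcongr

/-- Continuity of integrals of powers when the measure and the function are perturbed by factors
close to `1`. -/
theorem tendsto_lintegral_rpow {α ι : Type*} [MeasurableSpace α] {l : Filter ι} (m : Measure α)
    (k : α → ℝ≥0∞) (m' : ι → Measure α) (k' : ι → α → ℝ≥0∞)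
    (h : ∀ c : ℝ≥0∞, 1 < c → c ≠ ∞ → ∀ᶠ i in l, m' i ≤ c • m ∧ m ≤ c • m' i ∧
      (∀ᵐ x ∂m, k' i x ≤ c * k x) ∧ ∀ᵐ x ∂m, k x ≤ c * k' i x) (s : ℝ) :
    Tendsto (fun i => ∫⁻ x, k' i x ^ s ∂m' i) l (𝓝 (∫⁻ x, k x ^ s ∂m)) := by
  refine ENNReal.tendsto_of_eventually_le_mul fun c hc _ => ?_
  -- One factor `b` pays for the change of measure and `b ^ |s|` for the change of the integrand.
  obtain ⟨b, hb1, hbt, hbc⟩ := ENNReal.exists_one_lt_rpow_mul_lt hc (1 + |s|)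
  have hb0 : b ≠ 0 := (one_pos.trans hb1).ne'
  rw [mul_one, ENNReal.rpow_add _ _ hb0 hbt, ENNReal.rpow_one] at hbc
  have hbs : b ^ |s| ≠ ∞ := ENNReal.rpow_ne_top_of_nonneg (abs_nonneg s) hbt
  filter_upwards [h b hb1 hbt] with i hi
  obtain ⟨h1, h2, h3, h4⟩ := hi
  constructor
  · calc ∫⁻ x, k' i x ^ s ∂m' i ≤ ∫⁻ x, k' i x ^ s ∂(b • m) := lintegral_mono' h1 le_rfl
      _ = b * ∫⁻ x, k' i x ^ s ∂m := lintegral_smul_measure _ _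
      _ ≤ b * ∫⁻ x, b ^ |s| * k x ^ s ∂m := by
          refine mul_le_mul_right (lintegral_mono_ae ?_) b
          filter_upwards [h3, h4] with x hx3 hx4
          exact ENNReal.rpow_le_rpow_abs_mul_rpow hb1.le hbt hx3 hx4 s
      _ = b * b ^ |s| * ∫⁻ x, k x ^ s ∂m := by rw [lintegral_const_mul' _ _ hbs, mul_assoc]
      _ ≤ c * ∫⁻ x, k x ^ s ∂m := by gcongr
  · have hac : m' i ≪ m := Measure.absolutelyContinuous_of_le_smul h1
    calc ∫⁻ x, k x ^ s ∂m ≤ ∫⁻ x, k x ^ s ∂(b • m' i) := lintegral_mono' h2 le_rfl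
      _ = b * ∫⁻ x, k x ^ s ∂m' i := lintegral_smul_measure _ _
      _ ≤ b * ∫⁻ x, b ^ |s| * k' i x ^ s ∂m' i := by
          refine mul_le_mul_right (lintegral_mono_ae ?_) b
          filter_upwards [hac h3, hac h4] with x hx3 hx4
          exact ENNReal.rpow_le_rpow_abs_mul_rpow hb1.le hbt hx4 hx3 s
      _ = b * b ^ |s| * ∫⁻ x, k' i x ^ s ∂m' i := by rw [lintegral_const_mul' _ _ hbs, mul_assoc]
      _ ≤ c * ∫⁻ x, k' i x ^ s ∂m' i := by gcongr

/-! ### The weighted boundary measures and curvatures of the models -/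

theorem IsCompact.eventually_forall_lt_mul {Z : Type*} [TopologicalSpace Z] {K : Set Z}
    (hK : IsCompact K) {F : ℝ → Z → ℝ} {lam₀ : ℝ}
    (hF : ∀ z ∈ K, ContinuousAt (fun w : ℝ × Z => F w.1 w.2) (lam₀, z))
    (hpos : ∀ z ∈ K, 0 < F lam₀ z) {C : ℝ} (hC : 1 < C) :
    ∀ᶠ lam in 𝓝 lam₀, ∀ z ∈ K, F lam z < C * F lam₀ z ∧ F lam₀ z < C * F lam z := by
  refine hK.eventually_forall_of_forall_eventually
    (P := fun lam z => F lam z < C * F lam₀ z ∧ F lam₀ z < C * F lam z) fun z hz => ?_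
  have h1 : ContinuousAt (fun w : ℝ × Z => F lam₀ w.2) (lam₀, z) :=
    ContinuousAt.comp (f := fun w : ℝ × Z => (lam₀, w.2)) (g := fun w : ℝ × Z => F w.1 w.2)
      (x := (lam₀, z)) (hF z hz)
      (by fun_prop : Continuous fun w : ℝ × Z => (lam₀, w.2)).continuousAt
  have h2 : F lam₀ z < C * F lam₀ z := by nlinarith [hpos z hz]
  exact ((hF z hz).eventually_lt (continuousAt_const.mul h1) h2).and
    (h1.eventually_lt (continuousAt_const.mul (hF z hz)) h2)

/-- The weight function in terms of the Euclidean distance `h` of the tangent hyperplane. -/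
noncomputable def modelWeight (lam h : ℝ) : ℝ := √((lam + h ^ 2) / (1 + lam * h ^ 2))

/-- The ratio of the weighted curvature of the model and the Euclidean curvature. -/
noncomputable def curvFactor (n : ℕ) (lam s h : ℝ) : ℝ :=
  (√(1 + lam * s ^ 2) * (√(1 + lam * h ^ 2))⁻¹) ^ n / modelWeight lam h ^ n

theorem modelWeight_pos {lam h : ℝ} (hlam : 0 ≤ lam) (hh : 0 < h) : 0 < modelWeight lam h :=
  Real.sqrt_pos.2 (by positivity)

theorem curvFactor_pos (n : ℕ) {lam h : ℝ} (hlam : 0 ≤ lam) (s : ℝ) (hh : 0 < h) :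
    0 < curvFactor n lam s h := by
  have h1 := modelWeight_pos hlam hh
  have h2 : 0 < √(1 + lam * s ^ 2) := Real.sqrt_pos.2 (by positivity)
  have h3 : 0 < √(1 + lam * h ^ 2) := Real.sqrt_pos.2 (by positivity)
  unfold curvFactor
  positivity

theorem continuousAt_modelWeight {lam h : ℝ} (hlam : 0 ≤ lam) (s : ℝ) :
    ContinuousAt (fun w : ℝ × ℝ × ℝ => modelWeight w.1 w.2.2) (lam, s, h) := by
  have h1 : 1 + lam * h ^ 2 ≠ 0 := by positivity
  have h2 : Continuous fun w : ℝ × ℝ × ℝ => w.1 + w.2.2 ^ 2 := by fun_prop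
  have h3 : Continuous fun w : ℝ × ℝ × ℝ => 1 + w.1 * w.2.2 ^ 2 := by fun_prop
  exact (h2.continuousAt.div h3.continuousAt h1).sqrt

theorem continuousAt_curvFactor (n : ℕ) {lam h : ℝ} (hlam : 0 ≤ lam) (s : ℝ) (hh : 0 < h) :
    ContinuousAt (fun w : ℝ × ℝ × ℝ => curvFactor n w.1 w.2.1 w.2.2) (lam, s, h) := by
  have h1 := modelWeight_pos hlam hh
  have h3 : 0 < √(1 + lam * h ^ 2) := Real.sqrt_pos.2 (by positivity)
  refine ContinuousAt.div ?_ ((continuousAt_modelWeight hlam s).pow n) (pow_pos h1 n).ne'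
  have h4 : Continuous fun w : ℝ × ℝ × ℝ => √(1 + w.1 * w.2.1 ^ 2) := by fun_prop
  have h5 : Continuous fun w : ℝ × ℝ × ℝ => √(1 + w.1 * w.2.2 ^ 2) := by fun_prop
  exact (h4.continuousAt.mul (h5.continuousAt.inv₀ h3.ne')).pow n

section Functionals

variable {d : ℕ}

/-- The distance of the tangent hyperplane at a smooth boundary point of `L` from the origin. -/
noncomputable def tangentDist (L : Set (Euc d)) (x : Euc d) : ℝ := ‖gradient (gauge L) x‖⁻¹

/-- The weighted boundary measure of `L` in the model of curvature `lam` embedded by `f`. -/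
noncomputable def modelMeasure {m : ℕ} (lam : ℝ) (f : Euc d → Euc m) (L : Set (Euc d)) :
    Measure (Euc d) :=
  (bdMeasure f L).withDensity fun x => ENNReal.ofReal (modelWeight lam (tangentDist L x))

/-- The weighted curvature of `L` in the model of curvature `lam`. -/
noncomputable def modelCurv (lam : ℝ) (L : Set (Euc d)) (x : Euc d) : ℝ≥0∞ :=
  ENNReal.ofReal (curvFactor (d + 1) lam ‖x‖ (tangentDist L x) * curvE L x)

namespace IsBody

variable {L : Set (Euc d)}

theorem measurable_modelWeight (hL : IsBody L) (lam : ℝ) :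
    Measurable fun x => ENNReal.ofReal (modelWeight lam (tangentDist L x)) := by
  have h : Measurable (tangentDist L) := hL.measurable_gradient_gauge.norm.inv
  unfold modelWeight
  fun_prop

/-- The boundary measures of all models are mutually comparable, so the Euclidean statement about
normals passes to each of them. -/
theorem ae_bdMeasure (hL : IsBody L) {m : ℕ} {lam : ℝ} (hlam : 0 ≤ lam) {f : Euc d → Euc m}
    (hf : IsModelMap lam f) : ∀ᵐ x ∂bdMeasure f L,
      x ∈ frontier L ∧ ∃ v, outerNormals ⊤ L x = {v} ∧ ⟪x, v⟫_ℝ = tangentDist L x := by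
  obtain ⟨C, -, hC⟩ := hL.exists_bdMeasure_le hlam le_rfl hf (isModelMap_id d)
  refine Measure.absolutelyContinuous_of_le_smul hC ?_
  rw [bdMeasure_id]
  filter_upwards [ae_restrict_mem hL.measurableSet_frontier, hL.ae_differentiableAt] with x h1 h2
  exact ⟨h1, _, hL.outerNormals_eq_singleton h1 h2⟩

/-- The radii do not depend on the model; they fix one compact rectangle on which weights and
curvature factors vary uniformly continuously in `λ`. -/
theorem ae_tangentDist_mem (hL : IsBody L) : ∃ r R : ℝ, 0 < r ∧ 0 < R ∧
    ∀ {m : ℕ} {lam : ℝ} {f : Euc d → Euc m}, 0 ≤ lam → IsModelMap lam f →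
      ∀ᵐ x ∂bdMeasure f L, ‖x‖ ∈ Set.Icc 0 R ∧ tangentDist L x ∈ Set.Icc r R := by
  obtain ⟨r, R, hr, hR, hrL, hRL⟩ := hL.exists_radii
  refine ⟨r, R, hr, hR, fun hlam hf => ?_⟩
  filter_upwards [hL.ae_bdMeasure hlam hf] with x hx
  obtain ⟨hx, v, hv, hxv⟩ := hx
  have hvm : v ∈ outerNormals ⊤ L x := by rw [hv]; rfl
  have h1 : ‖x‖ ≤ R := by simpa using hRL (hL.frontier_subset hx)
  have h2 := real_inner_le_norm x v
  rw [hvm.2.1, mul_one] at h2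
  rw [← hxv]
  exact ⟨⟨norm_nonneg _, h1⟩, hL.le_inner hr hrL hvm, h2.trans h1⟩

theorem lintegral_modelMeasure (hL : IsBody L) {m : ℕ} (lam : ℝ) (f : Euc d → Euc m)
    (G : Euc d → ℝ≥0∞) : ∫⁻ x, G x ∂modelMeasure lam f L =
      ∫⁻ x, G x * ENNReal.ofReal (modelWeight lam (tangentDist L x)) ∂bdMeasure f L := by
  rw [modelMeasure, lintegral_withDensity_eq_lintegral_mul_non_measurable₀ _
    (hL.measurable_modelWeight lam).aemeasurable
    (Eventually.of_forall fun x => ENNReal.ofReal_lt_top)]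
  simp only [Pi.mul_apply, mul_comm]

theorem modelMeasure_univ_zero_id (hL : IsBody L) (hd : 1 ≤ d) :
    modelMeasure 0 (id : Euc d → Euc d) L Set.univ = d * volume L := by
  rw [hL.natCast_mul_volume_eq hd, modelMeasure, withDensity_apply _ MeasurableSet.univ,
    Measure.restrict_univ, bdMeasure_id]
  refine lintegral_congr fun x => ?_
  simp only [modelWeight, tangentDist, zero_add, zero_mul, add_zero, div_one]
  rw [Real.sqrt_sq (by positivity)]

theorem natCast_mul_volume_ne_zero (hL : IsBody L) (hd : 1 ≤ d) :
    (d : ℝ≥0∞) * volume L ≠ 0 :=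
  mul_ne_zero (by exact_mod_cast (by omega : d ≠ 0)) (Measure.measure_pos_of_mem_nhds _ hL.mem_nhds).ne'

/-- Support values are at least `r`, so the cone volume formula bounds the Euclidean boundary
measure by `d vol(L) / r`; comparison gives the other models. -/
theorem isFiniteMeasure_bdMeasure (hL : IsBody L) (hd : 1 ≤ d) {m : ℕ} {lam : ℝ} (hlam : 0 ≤ lam)
    {f : Euc d → Euc m} (hf : IsModelMap lam f) : IsFiniteMeasure (bdMeasure f L) := by
  obtain ⟨r, R, hr, hR, hae⟩ := hL.ae_tangentDist_mem
  obtain ⟨C, hCt, hC⟩ := hL.exists_bdMeasure_le hlam le_rfl hf (isModelMap_id d)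
  have h1 : ENNReal.ofReal r * bdMeasure (id : Euc d → Euc d) L Set.univ ≤ d * volume L := by
    rw [hL.natCast_mul_volume_eq hd, ← lintegral_const, bdMeasure_id]
    refine lintegral_mono_ae ?_
    have := hae le_rfl (isModelMap_id d)
    rw [bdMeasure_id] at this
    filter_upwards [this] with x hx
    exact ENNReal.ofReal_le_ofReal hx.2.1
  have h2 : (d : ℝ≥0∞) * volume L ≠ ∞ :=
    ENNReal.mul_ne_top (ENNReal.natCast_ne_top d) hL.isCompact.measure_lt_top.ne
  have h3 : bdMeasure (id : Euc d → Euc d) L Set.univ ≠ ∞ := fun h => by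
    rw [h, ENNReal.mul_top (ENNReal.ofReal_pos.2 hr).ne', top_le_iff] at h1
    exact h2 h1
  refine ⟨(hC Set.univ).trans_lt ?_⟩
  rw [Measure.smul_apply, smul_eq_mul]
  exact (ENNReal.mul_ne_top hCt h3).lt_top

theorem isFiniteMeasure_modelMeasure (hL : IsBody L) (hd : 1 ≤ d) {m : ℕ} {lam : ℝ}
    (hlam : 0 ≤ lam) {f : Euc d → Euc m} (hf : IsModelMap lam f) :
    IsFiniteMeasure (modelMeasure lam f L) := by
  obtain ⟨r, R, hr, hR, hae⟩ := hL.ae_tangentDist_mem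
  have := hL.isFiniteMeasure_bdMeasure hd hlam hf
  refine isFiniteMeasure_withDensity (ne_of_lt ?_)
  calc ∫⁻ x, ENNReal.ofReal (modelWeight lam (tangentDist L x)) ∂bdMeasure f L
      ≤ ∫⁻ _, ENNReal.ofReal √(lam + R ^ 2) ∂bdMeasure f L := by
        refine lintegral_mono_ae ?_
        filter_upwards [hae hlam hf] with x hx
        have h1 : 0 < tangentDist L x := hr.trans_le hx.2.1
        refine ENNReal.ofReal_le_ofReal (Real.sqrt_le_sqrt ?_)
        refine (div_le_self (by positivity) ?_).trans ?_
        · have : 0 ≤ lam * tangentDist L x ^ 2 := by positivity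
          linarith
        · have := pow_le_pow_left₀ h1.le hx.2.2 2
          linarith
    _ < ∞ := by
        rw [lintegral_const]
        exact ENNReal.mul_lt_top ENNReal.ofReal_lt_top (measure_lt_top _ _)

theorem modelMeasure_ne_zero (hL : IsBody L) (hd : 1 ≤ d) {m : ℕ} {lam : ℝ}
    (hlam : 0 ≤ lam) {f : Euc d → Euc m} (hf : IsModelMap lam f) :
    modelMeasure lam f L ≠ 0 := by
  obtain ⟨r, R, hr, hR, hae⟩ := hL.ae_tangentDist_mem
  intro h0
  rw [modelMeasure, withDensity_eq_zero_iff (hL.measurable_modelWeight lam).aemeasurable] at h0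
  have h1 : bdMeasure f L = 0 := by
    rw [← ae_eq_bot, ← empty_mem_iff_bot]
    filter_upwards [h0, hae hlam hf] with x hx hx2
    have := modelWeight_pos hlam (hr.trans_le hx2.2.1)
    exact (ENNReal.ofReal_pos.2 this).ne' hx
  obtain ⟨C, -, hC⟩ := hL.exists_bdMeasure_le le_rfl hlam (isModelMap_id d) hf
  rw [h1, smul_zero] at hC
  have h2 : bdMeasure (id : Euc d → Euc d) L = 0 := le_antisymm hC (Measure.zero_le _)
  have h3 := hL.modelMeasure_univ_zero_id hd
  rw [modelMeasure, h2] at h3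
  simp only [withDensity_zero_left, Measure.coe_zero, Pi.zero_apply] at h3
  exact hL.natCast_mul_volume_ne_zero hd h3.symm

theorem _root_.ENNReal.ofReal_le_mul_ofReal {a b : ℝ} {c : ℝ≥0∞} (hct : c ≠ ∞)
    (h : a ≤ c.toReal * b) : ENNReal.ofReal a ≤ c * ENNReal.ofReal b := by
  conv_rhs => rw [← ENNReal.ofReal_toReal hct, ← ENNReal.ofReal_mul ENNReal.toReal_nonneg]
  exact ENNReal.ofReal_le_ofReal h

theorem modelMeasure_le (_ : IsBody L) {m m' : ℕ} {lam mu : ℝ} {f : Euc d → Euc m}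
    {g : Euc d → Euc m'} {b c : ℝ≥0∞} (hb : b ≠ ∞) (hbc : b * b ≤ c)
    (h : bdMeasure f L ≤ b • bdMeasure g L)
    (hw : ∀ᵐ x ∂bdMeasure g L, ENNReal.ofReal (modelWeight lam (tangentDist L x)) ≤
      b * ENNReal.ofReal (modelWeight mu (tangentDist L x))) :
    modelMeasure lam f L ≤ c • modelMeasure mu g L := by
  refine Measure.le_iff.2 fun S hS => ?_
  rw [Measure.smul_apply, smul_eq_mul, modelMeasure, modelMeasure, withDensity_apply _ hS,
    withDensity_apply _ hS]
  calc ∫⁻ x in S, ENNReal.ofReal (modelWeight lam (tangentDist L x)) ∂bdMeasure f L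
      ≤ ∫⁻ x in S, ENNReal.ofReal (modelWeight lam (tangentDist L x)) ∂(b • bdMeasure g L) :=
        lintegral_mono' (Measure.restrict_mono le_rfl h) le_rfl
    _ = b * ∫⁻ x in S, ENNReal.ofReal (modelWeight lam (tangentDist L x)) ∂bdMeasure g L := by
        rw [Measure.restrict_smul, lintegral_smul_measure, smul_eq_mul]
    _ ≤ b * ∫⁻ x in S, b * ENNReal.ofReal (modelWeight mu (tangentDist L x)) ∂bdMeasure g L := by
        exact mul_le_mul_right (lintegral_mono_ae (ae_restrict_of_ae hw)) b
    _ = b * b * ∫⁻ x in S, ENNReal.ofReal (modelWeight mu (tangentDist L x)) ∂bdMeasure g L := by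
        rw [lintegral_const_mul' _ _ hb, mul_assoc]
    _ ≤ _ := by gcongr

/-- This is the hypothesis of both `tendsto_lintegral_rpow` and `tendsto_geomMean`: all the geometry
of the limit `λ → λ₀` is contained in it. -/
theorem eventually_model_le (hL : IsBody L) {m m' : ℕ} {lam₀ : ℝ} (hlam₀ : 0 ≤ lam₀)
    {g : Euc d → Euc m'} (hg : IsModelMap lam₀ g) {l : Filter ℝ} (hl : l ≤ 𝓝 lam₀)
    {f : ℝ → Euc d → Euc m} (hf : ∀ᶠ lam in l, 0 ≤ lam ∧ IsModelMap lam (f lam)) (c : ℝ≥0∞)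
    (hc : 1 < c) (hct : c ≠ ∞) :
    ∀ᶠ lam in l, modelMeasure lam (f lam) L ≤ c • modelMeasure lam₀ g L ∧
      modelMeasure lam₀ g L ≤ c • modelMeasure lam (f lam) L ∧
      (∀ᵐ x ∂modelMeasure lam₀ g L, modelCurv lam L x ≤ c * modelCurv lam₀ L x) ∧
      ∀ᵐ x ∂modelMeasure lam₀ g L, modelCurv lam₀ L x ≤ c * modelCurv lam L x := by
  -- Here `b * b < c`: one factor for the Hausdorff measures, one for the weights.
  obtain ⟨b, hb1, hbt, hbc⟩ := ENNReal.exists_one_lt_rpow_mul_lt hc 2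
  rw [mul_one, ENNReal.rpow_two, pow_two] at hbc
  obtain ⟨r, R, hr, hR, hae⟩ := hL.ae_tangentDist_mem
  have hK : IsCompact (Set.Icc (0 : ℝ) R ×ˢ Set.Icc r R) := isCompact_Icc.prod isCompact_Icc
  have hbR : 1 < b.toReal := by
    rw [← ENNReal.toReal_one]; exact (ENNReal.toReal_lt_toReal ENNReal.one_ne_top hbt).2 hb1
  have hcR : 1 < c.toReal := by
    rw [← ENNReal.toReal_one]; exact (ENNReal.toReal_lt_toReal ENNReal.one_ne_top hct).2 hc
  have hw := hl (hK.eventually_forall_lt_mul (F := fun lam z => modelWeight lam z.2) (lam₀ := lam₀)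
    (fun z _ => continuousAt_modelWeight hlam₀ z.1)
    (fun z hz => modelWeight_pos hlam₀ (hr.trans_le hz.2.1)) hbR)
  have hk := hl (hK.eventually_forall_lt_mul (F := fun lam z => curvFactor (d + 1) lam z.1 z.2)
    (lam₀ := lam₀)
    (fun z hz => continuousAt_curvFactor (d + 1) hlam₀ z.1 (hr.trans_le hz.2.1))
    (fun z hz => curvFactor_pos (d + 1) hlam₀ z.1 (hr.trans_le hz.2.1)) hcR)
  filter_upwards [hw, hk, hf, hL.eventually_bdMeasure_le hlam₀ hg hl hf hb1] with lam hw hk hf hm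
  have hac : modelMeasure lam₀ g L ≪ bdMeasure g L := withDensity_absolutelyContinuous _ _
  have hmul : ∀ {a a' k : ℝ}, 0 < a → 0 < a' → a < c.toReal * a' →
      ENNReal.ofReal (a * k) ≤ c * ENNReal.ofReal (a' * k) := fun {a a' k} ha ha' h => by
    rw [ENNReal.ofReal_mul ha.le, ENNReal.ofReal_mul ha'.le, ← mul_assoc]
    gcongr
    exact ENNReal.ofReal_le_mul_ofReal hct h.le
  refine ⟨hL.modelMeasure_le hbt hbc.le hm.1 ?_, hL.modelMeasure_le hbt hbc.le hm.2 ?_,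
    hac ?_, hac ?_⟩
  · filter_upwards [hae hlam₀ hg] with x hx
    exact ENNReal.ofReal_le_mul_ofReal hbt (hw (‖x‖, tangentDist L x) hx).1.le
  · filter_upwards [hae hf.1 hf.2] with x hx
    exact ENNReal.ofReal_le_mul_ofReal hbt (hw (‖x‖, tangentDist L x) hx).2.le
  · filter_upwards [hae hlam₀ hg] with x hx
    exact hmul (curvFactor_pos _ hf.1 _ (hr.trans_le hx.2.1))
      (curvFactor_pos _ hlam₀ _ (hr.trans_le hx.2.1)) (hk (‖x‖, tangentDist L x) hx).1
  · filter_upwards [hae hlam₀ hg] with x hx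
    exact hmul (curvFactor_pos _ hlam₀ _ (hr.trans_le hx.2.1))
      (curvFactor_pos _ hf.1 _ (hr.trans_le hx.2.1)) (hk (‖x‖, tangentDist L x) hx).2

end IsBody

end Functionals

/-! ### The functionals as integrals over the boundary of the projective model -/

theorem ProjectiveModel.affineSurfaceAreaLam_lift {d : ℕ} {lam : ℝ} (M : ProjectiveModel d lam)
    (hlam : 0 < lam) (hd : 1 ≤ d) {L : Set (Euc d)} (hL : IsBody L) (p : ℝ) :
    affineSurfaceAreaLam lam M.o p (M.lift L) =
      ∫⁻ x, modelCurv lam L x ^ (p / (d + p)) ∂modelMeasure lam M.param L := by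
  have hf := M.isModelMap_param hlam
  rw [affineSurfaceAreaLam, M.bdLam_lift hlam hL.isCompact,
    setLIntegral_image_eq hf.measurableEmbedding, hL.lintegral_modelMeasure]
  refine lintegral_congr_ae ?_
  filter_upwards [hL.ae_bdMeasure hlam.le hf] with x hx
  obtain ⟨hx, v, hv, hxv⟩ := hx
  rw [M.weightLam_lift hlam hv, M.curvLam_lift hlam hd hL hx hv, hxv, modelCurv, curvFactor,
    modelWeight, mul_div_right_comm]

/-- At `λ = 0` the weight is `h` and the curvature factor is `h ^ (-(d + 1))`, which reproduces `d
V_K` and the centro-affine curvature. -/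
theorem IsBody.affineSurfaceArea_eq {d : ℕ} (hd : 1 ≤ d) {L : Set (Euc d)} (hL : IsBody L)
    (p : ℝ) : affineSurfaceArea p L =
      ∫⁻ x, modelCurv 0 L x ^ (p / (d + p)) ∂modelMeasure 0 (id : Euc d → Euc d) L := by
  have hd0 : (0 : ℝ) < d := by exact_mod_cast hd
  rw [affineSurfaceArea, hL.lintegral_modelMeasure, ← bdMeasure_id,
    ← lintegral_const_mul' _ _ (ENNReal.natCast_ne_top d)]
  refine lintegral_congr_ae ?_
  filter_upwards [hL.ae_bdMeasure le_rfl (isModelMap_id d)] with x hx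
  obtain ⟨hx, v, hv, hxv⟩ := hx
  have hh : 0 < tangentDist L x := by
    rw [← hxv]
    exact hL.inner_pos (by rw [hv]; rfl)
  have hw : modelWeight 0 (tangentDist L x) = tangentDist L x := by
    simp [modelWeight, Real.sqrt_sq hh.le]
  rw [centroAffineCurv, normalE, outerNormal_eq_of_singleton hv, hxv, modelCurv, curvFactor, hw,
    mul_left_comm, ← ENNReal.ofReal_natCast d, ← ENNReal.ofReal_mul hd0.le, ← mul_assoc,
    mul_one_div_cancel hd0.ne', one_mul]
  simp [div_eq_inv_mul]

theorem weightLam_one {d : ℕ} (o : Euc (d + 1)) (K : Set (Euc (d + 1))) (u : Euc (d + 1)) :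
    weightLam 1 o K u = 1 := by
  rw [weightLam, one_mul, div_self (by positivity), abs_one, Real.sqrt_one]

theorem floatingArea_eq {d : ℕ} (p : ℝ) (o : Euc (d + 1)) (K : Set (Euc (d + 1))) :
    floatingArea p K = affineSurfaceAreaLam 1 o p K := by
  simp only [floatingArea, affineSurfaceAreaLam, weightLam_one, one_pow, div_one,
    ENNReal.ofReal_one, mul_one]

theorem perimeterS_eq {d : ℕ} (o : Euc (d + 1)) (K : Set (Euc (d + 1))) :
    perimeterS K = affineSurfaceAreaLam 1 o 0 K := by
  simp only [perimeterS, affineSurfaceAreaLam, weightLam_one, zero_div, ENNReal.rpow_zero,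
    ENNReal.ofReal_one, mul_one, setLIntegral_one]

/-! ### Polar and dual bodies -/

theorem IsBody.polarBody {d : ℕ} {L : Set (Euc d)} (hL : IsBody L) : IsBody (polarBody L) := by
  obtain ⟨r, R, hr, hR, hrL, hRL⟩ := hL.exists_radii
  refine ⟨?_, ?_, ?_⟩
  · intro y hy z hz a b ha hb hab x hx
    rw [inner_add_right, inner_smul_right, inner_smul_right]
    have h1 := mul_le_mul_of_nonneg_left (hy x hx) ha
    have h2 := mul_le_mul_of_nonneg_left (hz x hx) hb
    linarith
  · refine Metric.isCompact_of_isClosed_isBounded ?_ ?_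
    · have : _root_.polarBody L = ⋂ x ∈ L, {y | ⟪x, y⟫_ℝ ≤ 1} := by
        ext y
        simp [_root_.polarBody]
      rw [this]
      exact isClosed_biInter fun x _ => isClosed_le (by fun_prop) continuous_const
    · refine (Metric.isBounded_closedBall (x := (0 : Euc d)) (r := r⁻¹)).subset fun y hy => ?_
      rw [mem_closedBall_zero_iff]
      rcases eq_or_ne y 0 with rfl | hy0
      · rw [norm_zero]; positivity
      have hn : 0 < ‖y‖ := norm_pos_iff.2 hy0
      have h1 := hy ((r * ‖y‖⁻¹) • y) (hrL (by
        rw [mem_closedBall_zero_iff, norm_smul, norm_mul, norm_inv, _root_.norm_norm,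
          Real.norm_of_nonneg hr.le, mul_assoc, inv_mul_cancel₀ hn.ne', mul_one]))
      rw [real_inner_smul_left, real_inner_self_eq_norm_sq] at h1
      rw [← one_div, le_div_iff₀ hr]
      calc ‖y‖ * r = r * ‖y‖⁻¹ * ‖y‖ ^ 2 := by field_simp
        _ ≤ 1 := h1
  · refine mem_of_superset (Metric.closedBall_mem_nhds 0 (inv_pos.2 hR)) fun y hy x hx => ?_
    have h1 : ‖x‖ ≤ R := by simpa using hRL hx
    have h2 : ‖y‖ ≤ R⁻¹ := by simpa using hy
    calc ⟪x, y⟫_ℝ ≤ ‖x‖ * ‖y‖ := real_inner_le_norm _ _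
      _ ≤ R * R⁻¹ := by gcongr
      _ = 1 := mul_inv_cancel₀ hR.ne'

namespace ProjectiveModel

variable {d : ℕ}

theorem oPolar_lift {lam : ℝ} (M : ProjectiveModel d lam) (hlam : 0 < lam) (L : Set (Euc d)) :
    oPolar lam M.o (M.lift L) = M.lift (polarBody L) := by
  ext v
  refine and_congr_right fun _ => and_congr_right fun ho => ?_
  rw [M.gnomonic_eq hlam ho.ne', M.lift_eq_image hlam, Set.forall_mem_image]
  have h1 : ∀ x, ⟪gnomonic lam M.o (M.param x), M.chart (M.proj v)⟫_ℝ = ⟪x, M.proj v⟫_ℝ :=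
    fun x => by
      rw [M.gnomonic_eq hlam (M.inner_param_o_pos hlam x).ne', M.proj_param hlam,
        LinearIsometry.inner_map_map]
  simp only [h1, M.chart.injective.eq_iff, exists_eq_right']
  rfl

/-- The projective model with the reflected chart. -/
noncomputable def reflect {lam : ℝ} (M : ProjectiveModel d lam) : ProjectiveModel d lam where
  o := M.o
  o_mem := M.o_mem
  chart := M.chart.comp (LinearIsometryEquiv.neg ℝ).toLinearIsometry
  chart_orth _ := M.chart_orth _

/-- Duality asks for `⟪x, M.proj v⟫ ≥ -1` and polarity for `≤ 1`, so the dual body projects to the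
negative of the polar body; the sign is absorbed into the chart. -/
theorem dualS_lift (M : ProjectiveModel d 1) {L : Set (Euc d)} (hL : IsBody L) :
    dualS (M.lift L) = M.reflect.lift (polarBody L) := by
  have hin : ∀ v x, 0 ≤ ⟪v, M.param x⟫_ℝ ↔ 0 ≤ ⟪M.chartAdj v, x⟫_ℝ + ⟪v, M.o⟫_ℝ := fun v x => by
    rw [param, real_inner_smul_right, inner_add_right, M.inner_chartAdj,
      mul_nonneg_iff_of_pos_left (inv_pos.2 (sqrt_pos one_pos x))]
  ext v
  refine and_congr_right fun hv => ?_
  rw [M.lift_eq_image one_pos, Set.forall_mem_image]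
  simp only [hin]
  have hproj : 0 < ⟪v, M.o⟫_ℝ → ∀ x, ⟪M.chartAdj v, x⟫_ℝ = ⟪v, M.o⟫_ℝ * ⟪x, M.proj v⟫_ℝ :=
    fun ho x => by
      rw [proj, one_mul, real_inner_smul_right, real_inner_comm, mul_inv_cancel_left₀ ho.ne']
  constructor
  · intro h
    have ho : 0 ≤ ⟪v, M.o⟫_ℝ := by simpa using h hL.zero_mem
    have ho' : 0 < ⟪v, M.o⟫_ℝ := by
      -- A dual vector on the equator would be nonnegative on a ball around the origin, hence zero
      -- in the chart direction and zero altogether, which the sphere excludes.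
      refine lt_of_le_of_ne ho fun h0 => ?_
      obtain ⟨r, R, hr, hR, hrL, hRL⟩ := hL.exists_radii
      have h1 : M.chartAdj v = 0 := by
        by_contra hne
        have hn : 0 < ‖M.chartAdj v‖ := norm_pos_iff.2 hne
        have h2 := h (hrL (a := (-(r * ‖M.chartAdj v‖⁻¹)) • M.chartAdj v) (by
          rw [mem_closedBall_zero_iff, norm_smul, norm_neg (r * _), norm_mul r, norm_inv, _root_.norm_norm,
            Real.norm_of_nonneg hr.le, mul_assoc, inv_mul_cancel₀ hn.ne', mul_one]))
        rw [← h0, add_zero, real_inner_smul_right, real_inner_self_eq_norm_sq] at h2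
        have h3 : 0 < r * ‖M.chartAdj v‖⁻¹ * ‖M.chartAdj v‖ ^ 2 := by positivity
        linarith
      have h2 := M.decomposition one_pos v
      rw [h1, ← h0, map_zero, mul_zero, zero_smul, add_zero] at h2
      rw [h2, mem_sphereLam_iff one_pos, inner_zero_left] at hv
      norm_num at hv
    refine ⟨ho', -M.proj v, fun x hx => ?_, ?_⟩
    · have h1 := h hx
      rw [hproj ho'] at h1
      rw [inner_neg_right]
      have h2 : 0 ≤ ⟪v, M.o⟫_ℝ * (⟪x, M.proj v⟫_ℝ + 1) := by linarith
      have h3 := (mul_nonneg_iff_of_pos_left ho').1 h2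
      linarith
    · change gnomonic 1 M.o v = M.chart (-(-M.proj v))
      rw [neg_neg, M.gnomonic_eq one_pos ho'.ne']
  · rintro ⟨ho, y, hy, hg⟩ x hx
    change 0 < ⟪v, M.o⟫_ℝ at ho
    change gnomonic 1 M.o v = M.chart (-y) at hg
    rw [M.gnomonic_eq one_pos ho.ne'] at hg
    rw [hproj ho, M.chart.injective hg, inner_neg_right]
    have h1 := hy x hx
    nlinarith

end ProjectiveModel

/-! ### The entropy power functionals as geometric means -/

theorem IsBody.tendsto_entropyQuotient {d : ℕ} (hd : 1 ≤ d) {L : Set (Euc d)} (hL : IsBody L)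
    {m : ℕ} {lam : ℝ} (hlam : 0 ≤ lam) {f : Euc d → Euc m} (hf : IsModelMap lam f) :
    Tendsto (fun q : ℝ => ((∫⁻ x, modelCurv lam L x ^ (q / (d + q)) ∂modelMeasure lam f L) /
      modelMeasure lam f L Set.univ) ^ (1 + d / q)) (𝓝[>] 0)
      (𝓝 (geomMean (modelMeasure lam f L) (modelCurv lam L))) :=
  have := hL.isFiniteMeasure_modelMeasure hd hlam hf
  tendsto_div_rpow_one_add_div _ (hL.modelMeasure_ne_zero hd hlam hf) _ (by exact_mod_cast hd)

theorem IsBody.tendsto_entropyQuotientE {d : ℕ} (hd : 1 ≤ d) {L : Set (Euc d)} (hL : IsBody L) :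
    Tendsto (entropyQuotientE L) (𝓝[>] 0) (𝓝 (geomMean
      (modelMeasure 0 (id : Euc d → Euc d) (_root_.polarBody L))
      (modelCurv 0 (_root_.polarBody L)))) := by
  refine (hL.polarBody.tendsto_entropyQuotient hd le_rfl (isModelMap_id d)).congr fun q => ?_
  rw [entropyQuotientE, hL.polarBody.affineSurfaceArea_eq hd,
    hL.polarBody.modelMeasure_univ_zero_id hd]

theorem ProjectiveModel.tendsto_entropyQuotientLam {d : ℕ} {lam : ℝ} (M : ProjectiveModel d lam)
    (hlam : 0 < lam) (hd : 1 ≤ d) {L : Set (Euc d)} (hL : IsBody L) :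
    Tendsto (entropyQuotientLam lam M.o (M.lift L)) (𝓝[>] 0) (𝓝 (geomMean
      (modelMeasure lam M.param (polarBody L)) (modelCurv lam (polarBody L)))) := by
  refine (hL.polarBody.tendsto_entropyQuotient hd hlam.le (M.isModelMap_param hlam)).congr
    fun q => ?_
  rw [entropyQuotientLam, M.oPolar_lift hlam, M.affineSurfaceAreaLam_lift hlam hd hL.polarBody,
    M.affineSurfaceAreaLam_lift hlam hd hL.polarBody]
  simp only [zero_div, ENNReal.rpow_zero, lintegral_one]

theorem ProjectiveModel.tendsto_entropyQuotientS {d : ℕ} (M : ProjectiveModel d 1)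
    (hd : 1 ≤ d) {L : Set (Euc d)} (hL : IsBody L) :
    Tendsto (entropyQuotientS (M.lift L)) (𝓝[>] 0) (𝓝 (geomMean
      (modelMeasure 1 M.reflect.param (polarBody L)) (modelCurv 1 (polarBody L)))) := by
  refine (hL.polarBody.tendsto_entropyQuotient hd zero_le_one
    (M.reflect.isModelMap_param one_pos)).congr fun q => ?_
  rw [entropyQuotientS, M.dualS_lift hL, floatingArea_eq q M.reflect.o,
    perimeterS_eq M.reflect.o, M.reflect.affineSurfaceAreaLam_lift one_pos hd hL.polarBody,
    M.reflect.affineSurfaceAreaLam_lift one_pos hd hL.polarBody]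
  simp only [zero_div, ENNReal.rpow_zero, lintegral_one]

/-! ### Limits in the curvature -/

section Limits

variable {d : ℕ} (hd : 1 ≤ d) {L : Set (Euc d)} (hL : IsBody L)
  (M : ∀ lam : ℝ, ProjectiveModel d lam) {lam₀ : ℝ} (hlam₀ : 0 ≤ lam₀) {l : Filter ℝ}
  (hl : l ≤ 𝓝 lam₀) (hpos : ∀ᶠ lam in l, 0 < lam) {m : ℕ} {g : Euc d → Euc m}
  (hg : IsModelMap lam₀ g)

include hd hL hlam₀ hl hpos hg

/-- The embedding `g` at `λ₀` is unrelated to the models `M`, since only chordal distances enter.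
This makes the choices of `o` and of the charts irrelevant and allows the identity at `λ₀ = 0`. -/
theorem tendsto_affineSurfaceAreaLam (p : ℝ) :
    Tendsto (fun lam => affineSurfaceAreaLam lam (M lam).o p ((M lam).lift L)) l
      (𝓝 (∫⁻ x, modelCurv lam₀ L x ^ (p / (d + p)) ∂modelMeasure lam₀ g L)) := by
  have h := tendsto_lintegral_rpow (modelMeasure lam₀ g L) (modelCurv lam₀ L)
    (fun lam => modelMeasure lam (M lam).param L) (fun lam => modelCurv lam L)
    (hL.eventually_model_le hlam₀ hg hl (hpos.mono fun lam h =>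
      ⟨h.le, (M lam).isModelMap_param h⟩)) (p / (d + p))
  refine h.congr' (hpos.mono fun lam h => ?_)
  exact ((M lam).affineSurfaceAreaLam_lift h hd hL p).symm

theorem tendsto_entropyPowerLam :
    Tendsto (fun lam => entropyPowerLam lam (M lam).o ((M lam).lift L)) l
      (𝓝 (geomMean (modelMeasure lam₀ g (polarBody L)) (modelCurv lam₀ (polarBody L)))) := by
  have := hL.polarBody.isFiniteMeasure_modelMeasure hd hlam₀ hg
  have h := tendsto_geomMean (modelMeasure lam₀ g (polarBody L))
    (hL.polarBody.modelMeasure_ne_zero hd hlam₀ hg) (modelCurv lam₀ (polarBody L))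
    (fun lam => modelMeasure lam (M lam).param (polarBody L))
    (fun lam => modelCurv lam (polarBody L))
    (hL.polarBody.eventually_model_le hlam₀ hg hl (hpos.mono fun lam h =>
      ⟨h.le, (M lam).isModelMap_param h⟩))
  refine h.congr' (hpos.mono fun lam h => ?_)
  exact ((M lam).tendsto_entropyQuotientLam h hd hL).limUnder_eq.symm

end Limits

theorem Filter.Tendsto.neg_ennreal_log {α : Type*} {l : Filter α} {u : α → ℝ≥0∞} {a : ℝ≥0∞}
    (h : Tendsto u l (𝓝 a)) : Tendsto (fun i => -ENNReal.log (u i)) l (𝓝 (-ENNReal.log a)) :=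
  ((continuous_neg.comp ENNReal.continuous_log).tendsto a).comp h

/-- A body `K` in the projective model is evaluated through its lift to `𝕊ᵈ(λ)`. The point `o` and
the identification of `ℝᵈ` with `oᗮ` may be chosen arbitrarily for every `λ`; only `λ > 0` matters
(for `λ ≤ 0` the value of `M` is not used in the limits below). -/
theorem mainTheorem12 (d : ℕ) (hd : 2 ≤ d) (K : ConvexBody (Euc d))
    (hK : (0 : Euc d) ∈ interior (K : Set (Euc d)))
    (M : ∀ lam : ℝ, ProjectiveModel d lam) :
    -- the limits of the `L_p`-affine surface areas
    (∀ p : ℝ, p ≠ -(d : ℝ) →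
      Tendsto (fun lam => affineSurfaceAreaLam lam (M lam).o p ((M lam).lift K))
        (𝓝[>] 0) (𝓝 (affineSurfaceArea p (K : Set (Euc d)))) ∧
      Tendsto (fun lam => affineSurfaceAreaLam lam (M lam).o p ((M lam).lift K))
        (𝓝 1) (𝓝 (floatingArea p ((M 1).lift K)))) ∧
    -- the limits that define the entropy power functionals exist
    (∀ lam : ℝ, 0 < lam →
      Tendsto (entropyQuotientLam lam (M lam).o ((M lam).lift K)) (𝓝[>] 0)
        (𝓝 (entropyPowerLam lam (M lam).o ((M lam).lift K)))) ∧
    Tendsto (entropyQuotientE (K : Set (Euc d))) (𝓝[>] 0)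
      (𝓝 (entropyPowerE (K : Set (Euc d)))) ∧
    Tendsto (entropyQuotientS ((M 1).lift K)) (𝓝[>] 0)
      (𝓝 (entropyPowerS ((M 1).lift K))) ∧
    -- the limits of the entropy power functionals
    Tendsto (fun lam => entropyPowerLam lam (M lam).o ((M lam).lift K))
      (𝓝[>] 0) (𝓝 (entropyPowerE (K : Set (Euc d)))) ∧
    Tendsto (fun lam => entropyPowerLam lam (M lam).o ((M lam).lift K))
      (𝓝 1) (𝓝 (entropyPowerS ((M 1).lift K))) ∧
    -- the limits of the entropies
    Tendsto (fun lam => entropyPWLam lam (M lam).o ((M lam).lift K))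
      (𝓝[>] 0) (𝓝 (entropyPW (K : Set (Euc d)))) ∧
    Tendsto (fun lam => entropyPWLam lam (M lam).o ((M lam).lift K))
      (𝓝 1) (𝓝 (entropyS ((M 1).lift K))) := by
  have hd1 : 1 ≤ d := by omega
  have hL : IsBody (K : Set (Euc d)) :=
    ⟨K.convex, K.isCompact, mem_interior_iff_mem_nhds.1 hK⟩
  have h0 : (𝓝[>] (0 : ℝ)) ≤ 𝓝 0 := nhdsWithin_le_nhds
  have hp0 : ∀ᶠ lam : ℝ in 𝓝[>] 0, 0 < lam := self_mem_nhdsWithin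
  have hp1 : ∀ᶠ lam : ℝ in 𝓝 1, 0 < lam := lt_mem_nhds one_pos
  have hE : entropyPowerE (K : Set (Euc d)) = _ := (hL.tendsto_entropyQuotientE hd1).limUnder_eq
  have hS : entropyPowerS ((M 1).lift K) = _ :=
    ((M 1).tendsto_entropyQuotientS hd1 hL).limUnder_eq
  have hE0 := tendsto_entropyPowerLam hd1 hL M le_rfl h0 hp0 (isModelMap_id d)
  -- The limit model at `λ = 1` carries the reflected chart, in which the spherical dual is the lift
  -- of the polar body.
  have hS1 := tendsto_entropyPowerLam hd1 hL M zero_le_one le_rfl hp1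
    ((M 1).reflect.isModelMap_param one_pos)
  rw [← hE] at hE0
  rw [← hS] at hS1
  refine ⟨fun p _ => ⟨?_, ?_⟩, fun lam hlam => ?_, ?_, ?_, hE0, hS1, hE0.neg_ennreal_log,
    hS1.neg_ennreal_log⟩
  · rw [hL.affineSurfaceArea_eq hd1]
    exact tendsto_affineSurfaceAreaLam hd1 hL M le_rfl h0 hp0 (isModelMap_id d) p
  · rw [floatingArea_eq p (M 1).o, (M 1).affineSurfaceAreaLam_lift one_pos hd1 hL]
    exact tendsto_affineSurfaceAreaLam hd1 hL M zero_le_one le_rfl hp1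
      ((M 1).isModelMap_param one_pos) p
  · have h := (M lam).tendsto_entropyQuotientLam hlam hd1 hL
    rwa [← h.limUnder_eq] at h
  · rw [hE]
    exact hL.tendsto_entropyQuotientE hd1
  · rw [hS]
    exact (M 1).tendsto_entropyQuotientS hd1 hL
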